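/- **Setting.** A system of subspaces $S=(H;H_1,\dots,H_8)$ consists of a complex Hilbert space $H$ (of arbitrary dimension) and closed subspaces $H_1,\dots,H_8$; $P_i$ denotes the orthogonal projection of $H$ onto $H_i$. Let $\tau_0\in(0,1/3)$ and $$\tau=(\tau_1,\tau_2,\tau_3,\tau_4)=(\tau_0,\sqrt2\,\tau_0,2\tau_0,3\tau_0).$$ Put $t_{2}=t_{3}=\tau_1$, $t_4=t_5=\tau_2$, $t_6=t_7=\tau_3$, $t_8=\tau_4$. We consider the systems satisfying * (Ang) $P_1P_kP_1=t_k^2P_1$ and $P_kP_1P_k=t_k^2P_k$ for $2\le k\le 8$; * (Com) $P_{2k}P_{2k+1}=P_{2k+1}P_{2k}$ for $k=1,2,3$; * (Ort) $P_iP_j=0$ for all distinct $i,j\in\{2,\dots,8\}$ with $\{i,j\}\ne\{2,3\},\{4,5\},\{6,7\}$. A system is *nonzero* if some $H_i\neq0$, and *irreducible* if every bounded operator commuting with all $P_i$ is scalar. Systems $S,S'$ are *unitarily equivalent* if there is a unitary $U:H\to H'$ with $U(H_i)=H_i'$ for all $i$. Generalized dimension $(d;e)$ means $\dim H=d$ and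 $\dim H_i=e$ for all $i$. For orthogonal projections $R_1,R_2,R_3$ in a Hilbert space $H_0$ let $Q_k=I-R_k$, and let $B$ be the operator on $H_0^{\oplus 8}$ with blocks $B_{ii}=I$, $B_{1k}=B_{k1}=t_kI$ ($2\le k\le8$), $B_{2k,2k+1}=B_{2k+1,2k}=Q_k$ ($k=1,2,3$), and all other blocks $0$. If $B\ge0$, let $\mathcal G(B)$ be the system formed by the completion of $H_0^{\oplus8}/\mathrm{Ker}\,B$ with respect to $\langle x,y\rangle_B=\langle Bx,y\rangle$ and the images in it of the eight summands. A system *corresponds to the angle* $\varphi$ if it is unitarily equivalent to $\mathcal G(B)$ for $H_0=\mathbb C^2$ and $$R_1=\begin{pmatrix}1&0\\0&0\end{pmatrix},\quad R_2=\begin{pmatrix}\cos^2\varphi&\cos\varphi\sin\varphi\\ \cos\varphi\sin\varphi&\sin^2\varphi\end{pmatrix},\quad R_3=0$$ (in particular $B\ge 0$ for these projections). The description problem is called *$*$-wild* if the $*$-algebra $\mathcal A$ with generators $p_i=p_i^*=p_i^2$ ($1\le i\le8$) and the relations (Ang), (Com), (Ort) majorizes the group C*-algebra $C^*(F_2)$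 of the free group on two generators: for some $n\ge1$ there is a unital $*$-homomorphism $\psi:\mathcal A\to M_n(C^*(F_2))$ such that the induced functor from the (unital) $*$-representations of $C^*(F_2)$ on Hilbert spaces $H$ to the $*$-representations of $\mathcal A$ on $H^n$ (that is, to systems of subspaces of $H^n$ satisfying (Ang), (Com), (Ort)), acting on intertwining operators by $X\mapsto X\oplus\dots\oplus X$, is full. **Statement.** If $\tau_0\in(0,1/\sqrt{20})$, the problem of describing the irreducible systems satisfying (Ang), (Com), (Ort) up to unitary equivalence is $*$-wild. If $\tau_0\in[1/\sqrt{20},1/4]$, then, up to unitary equivalence, all nonzero irreducible systems satisfying (Ang), (Com), (Ort) are the following, the listed systems being pairwise inequivalent. 1. $\tau_0=1/\sqrt{20}$: two systems of generalized dimension $(5;1)$; two of $(6;1)$; one of $(7;1)$; a family of systems of generalized dimension $(12;2)$, one for each angle $\varphi\in(0,\pi/2)$. 2. $\tau_0\in(1/\sqrt{20},1/\sqrt{19})$: one system of $(5;1)$; two of $(6;1)$; one of $(7;1)$; a family of systems of $(12;2)$, one for each angle $\varphi\in(0,\pi/2)$. 3. $\tau_0=1/\sqrt{19}$: one system of $(5;1)$;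 three of $(6;1)$; a family of systems of $(12;2)$, one for each angle $\varphi\in(0,\pi/2)$. 4. $\tau_0\in(1/\sqrt{19},1/\sqrt{18})$: one system of $(5;1)$; two of $(6;1)$; a family of systems of $(12;2)$, one for each angle $\varphi\in(\varphi(\tau),\pi/2)$, where $$\varphi(\tau)=\arccos\left(\frac{(1-17\tau_0^2)(1-18\tau_0^2)}{2\tau_0^4}\right)^{1/2}\in(0,\pi/2),$$ the fraction lying in $(0,1)$; and one system of $(11;2)$, which corresponds to the angle $\varphi(\tau)$. 5. $\tau_0=1/\sqrt{18}$: two systems of $(5;1)$ and one of $(6;1)$. 6. $\tau_0\in(1/\sqrt{18},1/\sqrt{17})$: one system of $(5;1)$ and one of $(6;1)$. 7. $\tau_0=1/\sqrt{17}$: two systems of $(5;1)$. 8. $\tau_0\in(1/\sqrt{17},1/4)$: one system of $(5;1)$. 9. $\tau_0=1/4$: one system of $(4;1)$. If $\tau_0\in(1/4,1/3)$, there is no nonzero system satisfying (Ang), (Com), (Ort). -/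

import Mathlib

open scoped ENNReal

universe u v w

noncomputable section

namespace SubspaceProblem

/-! ### Systems of subspaces of a complex Hilbert space -/

/-- A system `(H; (H_v))` of (closed) subspaces of a complex Hilbert space `H`, indexed by `V`. -/
structure SubspaceSystem (V : Type w) where
  carrier : Type u
  [normed : NormedAddCommGroup carrier]
  [inner : InnerProductSpace ℂ carrier]
  [complete : CompleteSpace carrier]
  space : V → Submodule ℂ carrier
  isClosed_space : ∀ i, IsClosed (space i : Set carrier)

attribute [instance] SubspaceSystem.normed SubspaceSystem.inner SubspaceSystem.complete

namespace SubspaceSystem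

variable {V : Type w}

instance (S : SubspaceSystem.{u} V) (i : V) : CompleteSpace (S.space i) :=
  (S.isClosed_space i).completeSpace_coe

/-- The orthogonal projection `P_i` of `H` onto `H_i`. -/
def proj (S : SubspaceSystem.{u} V) (i : V) : S.carrier →L[ℂ] S.carrier :=
  (S.space i).starProjection

/-- Some subspace of the system is nonzero. -/
def IsNonzero (S : SubspaceSystem.{u} V) : Prop :=
  ∃ i, S.space i ≠ ⊥

/-- Every bounded operator commuting with all the projections is scalar. -/
def IsIrreducible (S : SubspaceSystem.{u} V) : Prop :=
  ∀ A : S.carrier →L[ℂ] S.carrier, (∀ i, A * S.proj i = S.proj i * A) →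
    ∃ c : ℂ, A = c • (1 : S.carrier →L[ℂ] S.carrier)

/-- A unitary operator carries each subspace of `S` onto the corresponding subspace of `S'`. -/
def UnitarilyEquiv (S : SubspaceSystem.{u} V) (S' : SubspaceSystem.{v} V) : Prop :=
  ∃ U : S.carrier ≃ₗᵢ[ℂ] S'.carrier,
    ∀ i, (S.space i).map (U.toLinearEquiv : S.carrier →ₗ[ℂ] S'.carrier) = S'.space i

/-- Generalized dimension `(d; e)`: `dim H = d` and `dim H_i = e` for all `i`. -/
def HasGenDim (S : SubspaceSystem.{u} V) (d e : ℕ) : Prop :=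
  Module.rank ℂ S.carrier = d ∧ ∀ i, Module.rank ℂ (S.space i) = e

end SubspaceSystem

/-! ### The star with `2m + r` rays and the conditions (Ang), (Com), (Ort) -/

/-- The vertices `1, …, 2m + r + 1` of the star: the centre is the vertex `1`,
`paired k false` and `paired k true` (for `k = 0, …, m - 1`) are the vertices
`2(k + 1)` and `2(k + 1) + 1`, and `single j` (for `j = 0, …, r - 1`) is `2m + 2 + j`. -/
inductive Vertex (m r : ℕ) : Type
  | centre : Vertex m r
  | paired (k : Fin m) (b : Bool) : Vertex m r
  | single (j : Fin r) : Vertex m r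
  deriving DecidableEq, Fintype

namespace Vertex

variable {m r : ℕ}

/-- The cosine attached to the edge from the centre to a vertex: both edges to the vertices
of the `k`-th pair carry `τ_k`. (The value at the centre itself is never used.) -/
def weight (τ : Fin (m + r) → ℝ) : Vertex m r → ℝ
  | centre => 1
  | paired k _ => τ (Fin.castAdd r k)
  | single j => τ (Fin.natAdd m j)

/-- `{i, j}` is one of the pairs `{2k, 2k + 1}`. -/
def IsPair (i j : Vertex m r) : Prop :=
  ∃ k : Fin m, (i = paired k false ∧ j = paired k true) ∨ (i = paired k true ∧ j = paired k false)

end Vertex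

open Vertex

/-- The relations (Ang), (Com), (Ort) for a family of elements of a complex algebra. -/
structure AngComOrt {m r : ℕ} {𝒜 : Type*} [Ring 𝒜] [Algebra ℂ 𝒜]
    (τ : Fin (m + r) → ℝ) (p : Vertex m r → 𝒜) : Prop where
  ang_left : ∀ i, i ≠ centre →
    p centre * p i * p centre = ((weight τ i ^ 2 : ℝ) : ℂ) • p centre
  ang_right : ∀ i, i ≠ centre →
    p i * p centre * p i = ((weight τ i ^ 2 : ℝ) : ℂ) • p i
  com : ∀ i j, IsPair i j → p i * p j = p j * p i
  ort : ∀ i j, i ≠ centre → j ≠ centre → i ≠ j → ¬ IsPair i j → p i * p j = 0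

/-- The system of subspaces satisfies (Ang), (Com), (Ort). -/
def SubspaceSystem.Satisfies {m r : ℕ} (S : SubspaceSystem.{u} (Vertex m r))
    (τ : Fin (m + r) → ℝ) : Prop :=
  AngComOrt τ S.proj

/-- The family `F` is a list without repetition, up to unitary equivalence, of all nonzero
irreducible systems of subspaces satisfying (Ang), (Com), (Ort). -/
structure IsClassification {m r : ℕ} (τ : Fin (m + r) → ℝ) {I : Type*}
    (F : I → SubspaceSystem.{v} (Vertex m r)) : Prop where
  satisfies : ∀ i, (F i).Satisfies τ
  nonzero : ∀ i, (F i).IsNonzero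
  irreducible : ∀ i, (F i).IsIrreducible
  inequivalent : ∀ i j, (F i).UnitarilyEquiv (F j) → i = j
  exhaustive : ∀ S : SubspaceSystem.{u} (Vertex m r),
    S.Satisfies τ → S.IsNonzero → S.IsIrreducible → ∃ i, S.UnitarilyEquiv (F i)

/-! ### Block operators and the construction of a system from its Gram operator -/

section Block

variable {ι : Type w} [Fintype ι] {H : Type u} [NormedAddCommGroup H] [InnerProductSpace ℂ H]
  {H' : Type v} [NormedAddCommGroup H'] [InnerProductSpace ℂ H']

/-- The operator on the Hilbert sum `⊕_ι H` with block decomposition `B`. -/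
def blockOp (B : Matrix ι ι (H →L[ℂ] H)) :
    PiLp 2 (fun _ : ι => H) →L[ℂ] PiLp 2 (fun _ : ι => H) :=
  (PiLp.continuousLinearEquiv 2 ℂ (fun _ : ι => H)).symm.toContinuousLinearMap ∘L
    ContinuousLinearMap.pi (fun i => ∑ j, B i j ∘L PiLp.proj 2 (fun _ : ι => H) j)

/-- The diagonal operator `⊕_ι X : ⊕_ι H → ⊕_ι H'`. -/
def diagOp (ι : Type w) [Fintype ι] (X : H →L[ℂ] H') :
    PiLp 2 (fun _ : ι => H) →L[ℂ] PiLp 2 (fun _ : ι => H') :=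
  (PiLp.continuousLinearEquiv 2 ℂ (fun _ : ι => H')).symm.toContinuousLinearMap ∘L
    ContinuousLinearMap.pi (fun i => X ∘L PiLp.proj 2 (fun _ : ι => H) i)

/-- The vector space `⊕_ι H`, to be equipped with the form `⟨x, y⟩_B = ⟨B x, y⟩`. -/
def GramSpace (B : Matrix ι ι (H →L[ℂ] H)) (_hB : (blockOp B).IsPositive) : Type (max u w) :=
  PiLp 2 (fun _ : ι => H)

variable (B : Matrix ι ι (H →L[ℂ] H)) (hB : (blockOp B).IsPositive)

instance : AddCommGroup (GramSpace B hB) :=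
  inferInstanceAs (AddCommGroup (PiLp 2 (fun _ : ι => H)))

instance : Module ℂ (GramSpace B hB) :=
  inferInstanceAs (Module ℂ (PiLp 2 (fun _ : ι => H)))

/-- The identity map from `⊕_ι H`, with its own inner product, to `⊕_ι H` with the form
`⟨B x, y⟩`. -/
def toGramSpace : PiLp 2 (fun _ : ι => H) ≃ₗ[ℂ] GramSpace B hB :=
  LinearEquiv.refl ℂ (PiLp 2 (fun _ : ι => H))

/-- The nonnegative Hermitian form `⟨B x, y⟩`. -/
instance gramCore : PreInnerProductSpace.Core ℂ (GramSpace B hB) where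
  inner x y := inner ℂ (blockOp B ((toGramSpace B hB).symm x)) ((toGramSpace B hB).symm y)
  conj_inner_symm x y := by
    rw [inner_conj_symm]
    exact (hB.isSymmetric _ _).symm
  re_inner_nonneg x := hB.re_inner_nonneg_left _
  add_left x y z := by rw [map_add, map_add, inner_add_left]
  smul_left x y c := by rw [map_smul, map_smul, inner_smul_left]

instance : SeminormedAddCommGroup (GramSpace B hB) :=
  InnerProductSpace.Core.toSeminormedAddCommGroup (𝕜 := ℂ)

instance : InnerProductSpace ℂ (GramSpace B hB) :=
  InnerProductSpace.ofCore (gramCore B hB)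

/-- The map `ρ` of `⊕_ι H` to the completion of the quotient of `⊕_ι H` by `Ker B`
with respect to `⟨B x, y⟩`. -/
def gramMap : PiLp 2 (fun _ : ι => H) →ₗ[ℂ] UniformSpace.Completion (GramSpace B hB) :=
  (UniformSpace.Completion.toComplₗᵢ (𝕜 := ℂ) (E := GramSpace B hB)).toLinearMap ∘ₗ
    (toGramSpace B hB).toLinearMap

/-- The system `𝒢(H, …, H; B)`: its `i`-th subspace is the image under `ρ` of the `i`-th
summand of `⊕_ι H`. When the diagonal blocks of `B` are identities, as they are below,
this image is already closed. -/
def gramSystem [DecidableEq ι] : SubspaceSystem.{max u w} ι where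
  carrier := UniformSpace.Completion (GramSpace B hB)
  space i := (LinearMap.range
    (gramMap B hB ∘ₗ (PiLp.continuousLinearEquiv 2 ℂ (fun _ : ι => H)).symm.toLinearMap ∘ₗ
      LinearMap.single ℂ (fun _ : ι => H) i)).topologicalClosure
  isClosed_space _ := Submodule.isClosed_topologicalClosure _

end Block

/-- The block matrix `B(Q_1, …, Q_m)`: the blocks joining the centre to another vertex `i` are
`τ_i I`, the blocks joining the two vertices of the `k`-th pair are `Q_k`, the diagonal blocks
are `I` and the remaining ones vanish. -/
def starBlocks {m r : ℕ} {H : Type u} [NormedAddCommGroup H] [InnerProductSpace ℂ H]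
    (τ : Fin (m + r) → ℝ) (Q : Fin m → H →L[ℂ] H) :
    Matrix (Vertex m r) (Vertex m r) (H →L[ℂ] H) := fun i j =>
  match i, j with
  | centre, centre => 1
  | centre, j => ((weight τ j : ℝ) : ℂ) • 1
  | i, centre => ((weight τ i : ℝ) : ℂ) • 1
  | paired k b, paired l c => if k = l then (if b = c then 1 else Q k) else 0
  | single j, single l => if j = l then 1 else 0
  | _, _ => 0

/-- The system `S` is, up to unitary equivalence, `𝒢(H, …, H; B(Q_1, …, Q_m))` with
`Q_k = I - R_k`. -/
def CorrespondsTo {m r : ℕ} {H : Type} [NormedAddCommGroup H] [InnerProductSpace ℂ H]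
    (τ : Fin (m + r) → ℝ) (R : Fin m → H →L[ℂ] H) (S : SubspaceSystem.{u} (Vertex m r)) : Prop :=
  ∃ hB : (blockOp (starBlocks τ (fun k => 1 - R k))).IsPositive,
    S.UnitarilyEquiv (gramSystem (starBlocks τ (fun k => 1 - R k)) hB)

/-- The orthogonal projections `R_1, R_2, R_3` in `ℂ²` with parameter `φ`: `R_1` is the projection
onto the first coordinate line, `R_2` the projection onto the line at angle `φ` to it and
`R_3 = 0`. -/
def angleProjections (φ : ℝ) :
    Fin 3 → EuclideanSpace ℂ (Fin 2) →L[ℂ] EuclideanSpace ℂ (Fin 2) :=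
  ![Matrix.toEuclideanCLM (𝕜 := ℂ) !![1, 0; 0, 0],
    Matrix.toEuclideanCLM (𝕜 := ℂ)
      !![((Real.cos φ ^ 2 : ℝ) : ℂ), ((Real.cos φ * Real.sin φ : ℝ) : ℂ);
        ((Real.cos φ * Real.sin φ : ℝ) : ℂ), ((Real.sin φ ^ 2 : ℝ) : ℂ)],
    0]

/-- The system `S` corresponds to the angle `φ`. -/
def CorrespondsToAngle {r : ℕ} (τ : Fin (3 + r) → ℝ) (φ : ℝ)
    (S : SubspaceSystem.{u} (Vertex 3 r)) : Prop :=
  CorrespondsTo τ (angleProjections φ) S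

/-! ### The C*-algebra of the free group on two generators and `*`-wildness -/

/-- The Hilbert space `ℓ²(ℕ)`. -/
abbrev EllTwo : Type := lp (fun _ : ℕ => ℂ) 2

instance : Nontrivial EllTwo :=
  ⟨⟨lp.single 2 0 1, 0, fun h => by
    have := congrArg (fun f : EllTwo => f 0) h
    simp at this⟩⟩

/-- Pairs of unitary operators in `ℓ²(ℕ)`. -/
abbrev UnitaryPair : Type := unitary (EllTwo →L[ℂ] EllTwo) × unitary (EllTwo →L[ℂ] EllTwo)

/-- The C*-algebra of bounded families of operators in `ℓ²(ℕ)` indexed by all pairs of unitary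
operators. -/
def BoundedFamilies : Type := lp (fun _ : UnitaryPair => EllTwo →L[ℂ] EllTwo) ∞

/-- The C*-algebra structure: pointwise operations and the supremum norm. -/
def boundedFamiliesCStar : CStarAlgebra BoundedFamilies where
  __ := (lp.inftyNormedRing : NormedRing (lp (fun _ : UnitaryPair => EllTwo →L[ℂ] EllTwo) ∞))
  __ := (lp.inftyStarRing : StarRing (lp (fun _ : UnitaryPair => EllTwo →L[ℂ] EllTwo) ∞))
  __ := (lp.inftyCStarRing : CStarRing (lp (fun _ : UnitaryPair => EllTwo →L[ℂ] EllTwo) ∞))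
  __ := (lp.inftyNormedAlgebra :
    NormedAlgebra ℂ (lp (fun _ : UnitaryPair => EllTwo →L[ℂ] EllTwo) ∞))
  __ := (inferInstance : StarModule ℂ (lp (fun _ : UnitaryPair => EllTwo →L[ℂ] EllTwo) ∞))
  __ := (inferInstance : CompleteSpace (lp (fun _ : UnitaryPair => EllTwo →L[ℂ] EllTwo) ∞))

instance : CStarAlgebra BoundedFamilies := boundedFamiliesCStar

/-- The first of the two universal unitaries: the family `(U)_{(U, V)}`. -/
def genU : BoundedFamilies :=
  ⟨fun q => q.1, memℓp_infty ⟨1, by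
    rintro _ ⟨q, rfl⟩
    exact CStarRing.norm_of_mem_unitary q.1.2 |>.le⟩⟩

/-- The second of the two universal unitaries: the family `(V)_{(U, V)}`. -/
def genV : BoundedFamilies :=
  ⟨fun q => q.2, memℓp_infty ⟨1, by
    rintro _ ⟨q, rfl⟩
    exact CStarRing.norm_of_mem_unitary q.2.2 |>.le⟩⟩

/-- The (full) group C*-algebra `C*(F₂)` of the free group on two generators: the C*-algebra
generated by the universal pair of unitaries. Pairs of unitaries in `ℓ²(ℕ)` suffice because every
pair of unitaries is a direct sum of pairs acting in separable spaces, and each of these is,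
after taking a countable multiple, unitarily equivalent to a pair in `ℓ²(ℕ)`. -/
def FreeGroupCStar : StarSubalgebra ℂ BoundedFamilies :=
  (StarAlgebra.adjoin ℂ {genU, genV}).topologicalClosure

/-- The problem of describing, up to unitary equivalence, the systems of subspaces satisfying
(Ang), (Com), (Ort) is `*`-wild, i.e. the `*`-algebra with generators `p_i = p_i* = p_i²` and
relations (Ang), (Com), (Ort), whose representations are those systems, majorizes `C*(F₂)`.

A unital `*`-homomorphism `ψ` from that algebra to the algebra of `n × n` matrices over `C*(F₂)`
is the same as a family `p` of projections in the matrix algebra which satisfies the relations. It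
takes a representation `π` of `C*(F₂)` in `H` to the system of the ranges of the projections
`π(p_i)` in `Hⁿ`, and an intertwining operator `X` to `X ⊕ ⋯ ⊕ X`. It is required that this functor
be full (it is faithful since `n > 0`); in particular, it takes irreducible
representations to irreducible systems and inequivalent representations to inequivalent systems. -/
def IsStarWild {m r : ℕ} (τ : Fin (m + r) → ℝ) : Prop :=
  ∃ n : ℕ, 0 < n ∧ ∃ p : Vertex m r → Matrix (Fin n) (Fin n) FreeGroupCStar,
    (∀ i, IsStarProjection (p i)) ∧ AngComOrt τ p ∧
    ∀ (H H' : Type u)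
      [NormedAddCommGroup H] [InnerProductSpace ℂ H] [CompleteSpace H]
      [NormedAddCommGroup H'] [InnerProductSpace ℂ H'] [CompleteSpace H']
      (π : FreeGroupCStar →⋆ₐ[ℂ] (H →L[ℂ] H)) (π' : FreeGroupCStar →⋆ₐ[ℂ] (H' →L[ℂ] H'))
      (T : PiLp 2 (fun _ : Fin n => H) →L[ℂ] PiLp 2 (fun _ : Fin n => H')),
      (∀ i, T ∘L blockOp ((p i).map π) = blockOp ((p i).map π') ∘L T) →
      ∃ X : H →L[ℂ] H', (∀ a, X ∘L π a = π' a ∘L X) ∧ T = diagOp (Fin n) X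

/-! ### The example -/

/-- `(τ₁, τ₂, τ₃, τ₄) = (τ₀, √2 τ₀, 2 τ₀, 3 τ₀)`, with `m = 3` and `r = 1`. -/
def exampleTau (τ₀ : ℝ) : Fin (3 + 1) → ℝ :=
  ![τ₀, Real.sqrt 2 * τ₀, 2 * τ₀, 3 * τ₀]

/-- The angle `φ(τ)`. -/
def exampleAngle (τ₀ : ℝ) : ℝ :=
  Real.arccos (Real.sqrt ((1 - 17 * τ₀ ^ 2) * (1 - 18 * τ₀ ^ 2) / (2 * τ₀ ^ 4)))

/-- Systems of eight subspaces indexed by the star with seven rays, three pairs. -/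
abbrev ExampleSystem : Type 1 := SubspaceSystem.{0} (Vertex 3 1)

end SubspaceProblem

end

open SubspaceProblem

/-! Everything is reduced to the central subspace K = H₁. By (Ang), the operator P_i / t_i restricts
to a unitary from K onto H_i, so all eight subspaces become copies of K and the system is determined
by its Gram operator B on K⁸. (Com) makes the block between the two members of the k-th pair an
orthogonal projection Q_k = 1 - R_k, and (Ort) makes the other non-central off-diagonal blocks
vanish. Hence a system amounts, up to unitary equivalence, to a triple of projections (R₁, R₂, R₃)
with B ≥ 0, and irreducible systems come from irreducible triples (`exists_isRealization`,
`IsRealization.unitarilyEquiv`, `IsRealization.exists_of_unitarilyEquiv`,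
`IsRealization.isIrreducible`).

Completing squares over the non-central vertices leaves the Schur complement of the central block as
the only obstruction to positivity (`isPositive_blockOp`, `re_inner_schurOp_nonneg`). For the
weights at hand it equals τ₀² (c - R₁ - 2R₂ - 4R₃) with c = 1/τ₀² - 16, where 16 = 1 + 2 + 4 + 9. So
the question is: which irreducible triples satisfy R₁ + 2R₂ + 4R₃ ≤ c? The same computation
identifies Ker B with the kernel of the Schur complement plus the ranges of the Q_k, and
rank-nullity gives the dimensions (`IsRealization.finrank_add`).

If c < 0 there is nothing. If c ≤ 4, a vector fixed by R₃ is killed by R₁ and R₂, so an irreducible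
triple is either one-dimensional or has R₃ = 0 and is a pair of lines in ℂ² at an angle φ
(`exists_model`). One-dimensional triples are the binary digits of a number n, and the condition is
n ≤ c. For the angle φ it is c ≥ 3/2 and 2cos²φ ≤ (c - 1)(c - 2), by trace and determinant
(`angleProjections_le_iff`). Equality in either condition makes the Schur complement singular and
lowers dim H by one. The list is then read off from the position of c relative to 0, 1, 2, 3, 4.

If c > 4 there is room for a nonzero R₃ together with noncommuting R₁, R₂. On five copies of a
space, R₁ and R₂ are scalar matrices generating the diagonal matrix units and those of two
coordinate planes, and R₃ projects onto the column (1, ε, εu, ε, εv), with u, v the universal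
unitaries. Compressing R₃ by the diagonal units yields the remaining matrix units together with u
and v (`single_graphCol_mem`). For a suitable small ε the Schur complement stays positive and
invertible, so it factors as D*D inside the matrices over C*(F₂), and an explicit system with
entries in C*(F₂) can be written down. Every operator intertwining two of its representations
intertwines all matrices over C*(F₂), hence is diagonal; this is fullness
(`isStarWild_of_generating`). -/

noncomputable section

namespace SubspaceProblem

open Matrix Vertex

/-! ### Block columns over a *-ring. -/

section Stack

variable {σ ν A : Type*} {size : σ → Type*}

/-- The matrix with the row blocks `f s`. -/
def stack (f : ∀ s, Matrix (size s) ν A) : Matrix (Σ s, size s) ν A :=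
  Matrix.of fun x i => f x.1 x.2 i

variable [Fintype σ] [∀ s, Fintype (size s)] [Ring A] [StarRing A]

theorem stack_conjTranspose_mul (f g : ∀ s, Matrix (size s) ν A) :
    (stack f)ᴴ * stack g = ∑ s, (f s)ᴴ * g s := by
  ext i j
  simp [stack, Matrix.mul_apply, Matrix.sum_apply, Fintype.sum_sigma]

omit [Fintype σ] [∀ s, Fintype (size s)] [StarRing A] in
theorem stack_add (f g : ∀ s, Matrix (size s) ν A) : stack (f + g) = stack f + stack g := rfl

omit [Fintype σ] [∀ s, Fintype (size s)] [StarRing A] in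
theorem stack_mul [Fintype ν] {μ : Type*} (f : ∀ s, Matrix (size s) ν A) (a : Matrix ν μ A) :
    stack f * a = stack fun s => f s * a := rfl

variable [DecidableEq σ]

theorem stack_single_conjTranspose_mul (s : σ) (a : Matrix (size s) ν A)
    (g : ∀ s, Matrix (size s) ν A) : (stack (Pi.single s a))ᴴ * stack g = aᴴ * g s := by
  rw [stack_conjTranspose_mul, Finset.sum_eq_single s]
  · simp
  · intro t _ ht
    simp [ht]
  · simp

omit [Fintype σ] [∀ s, Fintype (size s)] [StarRing A] in
theorem stack_single_mul [Fintype ν] (s : σ) (a : Matrix (size s) ν A) (b : Matrix ν ν A) :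
    stack (Pi.single s a) * b = stack (Pi.single s (a * b)) := by
  rw [stack_mul]
  congr 1
  funext t
  by_cases h : t = s
  · subst h; simp
  · simp [h]

/-- The inclusion of a row block. -/
def blockIncl (A : Type*) [Ring A] (size : σ → Type*) [∀ s, DecidableEq (size s)] (s : σ) :
    Matrix (Σ s, size s) (size s) A :=
  stack (Pi.single s 1)

omit [StarRing A] in
theorem stack_eq_sum [∀ s, DecidableEq (size s)] (f : ∀ s, Matrix (size s) ν A) :
    stack f = ∑ s, blockIncl A size s * f s := by
  ext ⟨s, x⟩ i
  rw [Matrix.sum_apply, Finset.sum_eq_single s]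
  · rw [Matrix.mul_apply]
    simp [blockIncl, stack, Matrix.one_apply]
  · intro t _ ht
    rw [Matrix.mul_apply]
    simp [blockIncl, stack, Pi.single_eq_of_ne ht.symm]
  · simp

theorem sum_blockIncl_mul_conjTranspose [∀ s, DecidableEq (size s)] :
    ∑ s : σ, blockIncl A size s * (blockIncl A size s)ᴴ = (1 : Matrix (Σ s, size s) (Σ s, size s) A) := by
  rw [← stack_eq_sum]
  ext ⟨s, x⟩ ⟨t, y⟩
  by_cases h : s = t
  · subst h
    by_cases h : x = y <;> simp [blockIncl, stack, Matrix.one_apply, h, eq_comm]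
  · have h' : (⟨s, x⟩ : Σ s, size s) ≠ ⟨t, y⟩ := fun H => h (congrArg Sigma.fst H)
    simp [blockIncl, stack, Matrix.one_apply, h', Pi.single_eq_of_ne (Ne.symm h)]

end Stack

/-! ### Right column spans of a family of matrices. -/

section ColumnSpan

variable {ι κ ν A : Type*} [Fintype ι] [Fintype ν] [Ring A]

/-- The columns of `Z` are combinations of the columns of the matrices `G i`. -/
def InColumnSpan (G : ι → Matrix κ ν A) {μ : Type*} (Z : Matrix κ μ A) : Prop :=
  ∃ C : ι → Matrix ν μ A, ∑ i, G i * C i = Z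

namespace InColumnSpan

variable {G : ι → Matrix κ ν A} {μ : Type*} {Z Z' : Matrix κ μ A}

theorem self [DecidableEq ι] [DecidableEq ν] (i : ι) : InColumnSpan G (G i) := by
  refine ⟨Pi.single i 1, ?_⟩
  rw [Finset.sum_eq_single i]
  · simp
  · intro j _ hj
    simp [hj]
  · simp

theorem mul [Fintype μ] {μ' : Type*} (h : InColumnSpan G Z) (X : Matrix μ μ' A) :
    InColumnSpan G (Z * X) := by
  obtain ⟨C, rfl⟩ := h
  exact ⟨fun i => C i * X, by simp [Matrix.sum_mul, Matrix.mul_assoc]⟩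

theorem add (h : InColumnSpan G Z) (h' : InColumnSpan G Z') : InColumnSpan G (Z + Z') := by
  obtain ⟨C, rfl⟩ := h
  obtain ⟨C', rfl⟩ := h'
  exact ⟨fun i => C i + C' i, by simp [Matrix.mul_add, Finset.sum_add_distrib]⟩

theorem sub (h : InColumnSpan G Z) (h' : InColumnSpan G Z') : InColumnSpan G (Z - Z') := by
  obtain ⟨C, rfl⟩ := h
  obtain ⟨C', rfl⟩ := h'
  exact ⟨fun i => C i - C' i, by simp [Matrix.mul_sub, Finset.sum_sub_distrib]⟩

theorem zero : InColumnSpan G (0 : Matrix κ μ A) := ⟨0, by simp⟩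

theorem sum {α : Type*} (s : Finset α) {Z : α → Matrix κ μ A}
    (h : ∀ a ∈ s, InColumnSpan G (Z a)) : InColumnSpan G (∑ a ∈ s, Z a) := by
  classical
  induction s using Finset.induction_on with
  | empty => exact zero
  | insert a s ha ih =>
    rw [Finset.sum_insert ha]
    exact (h a (by simp)).add (ih fun b hb => h b (by simp [hb]))

end InColumnSpan

end ColumnSpan


/-! ### An explicit factorization of the Gram matrix over a *-algebra. -/

section Frame

variable {m r : ℕ} {ν : Type} {ρ : Fin m → Type}

/-- The index type of the row block at a vertex: `ρ k` at the second vertex of the `k`-th pair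
and `ν` elsewhere. -/
@[reducible] def blockSize (r : ℕ) (ν : Type) (ρ : Fin m → Type) : Vertex m r → Type
  | centre => ν
  | paired _ false => ν
  | paired k true => ρ k
  | .single _ => ν

instance blockSizeFintype [Fintype ν] [∀ k, Fintype (ρ k)] :
    ∀ v : Vertex m r, Fintype (blockSize r ν ρ v)
  | centre => inferInstanceAs (Fintype ν)
  | paired _ false => inferInstanceAs (Fintype ν)
  | paired k true => inferInstanceAs (Fintype (ρ k))
  | .single _ => inferInstanceAs (Fintype ν)

instance blockSizeDecidableEq [DecidableEq ν] [∀ k, DecidableEq (ρ k)] :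
    ∀ v : Vertex m r, DecidableEq (blockSize r ν ρ v)
  | centre => inferInstanceAs (DecidableEq ν)
  | paired _ false => inferInstanceAs (DecidableEq ν)
  | paired k true => inferInstanceAs (DecidableEq (ρ k))
  | .single _ => inferInstanceAs (DecidableEq ν)

/-- A sum over the vertices of the star. -/
theorem sum_vertex {M : Type*} [AddCommMonoid M] (f : Vertex m r → M) :
    ∑ v, f v = f centre + ∑ k, (f (paired k false) + f (paired k true)) + ∑ j, f (Vertex.single j) := by
  let e : Unit ⊕ (Fin m × Bool) ⊕ Fin r ≃ Vertex m r :=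
    { toFun := Sum.elim (fun _ => centre) (Sum.elim (fun p => paired p.1 p.2) Vertex.single)
      invFun := fun v => match v with
        | centre => Sum.inl ()
        | paired k b => Sum.inr (Sum.inl (k, b))
        | .single j => Sum.inr (Sum.inr j)
      left_inv := by rintro (_ | ⟨_, _⟩ | _) <;> rfl
      right_inv := by rintro (_ | _ | _) <;> rfl }
  rw [← e.sum_comp]
  simp [e, Fintype.sum_prod_type, add_assoc, add_comm (f (paired _ true))]

variable [Fintype ν] [DecidableEq ν] [∀ k, Fintype (ρ k)] [∀ k, DecidableEq (ρ k)]
  {A : Type*} [Ring A] [StarRing A] [Algebra ℂ A]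

/-- The blocks of the column of the centre in `starFrame`. -/
def centreBlocks (τ : Fin (m + r) → ℝ) (V : ∀ k, Matrix ν (ρ k) A) (D : Matrix ν ν A) :
    ∀ w : Vertex m r, Matrix (blockSize r ν ρ w) ν A
  | centre => D
  | paired k false => ((τ (Fin.castAdd r k) : ℝ) : ℂ) • (1 : Matrix ν ν A)
  | paired k true => ((τ (Fin.castAdd r k) : ℝ) : ℂ) • (V k)ᴴ
  | .single j => ((τ (Fin.natAdd m j) : ℝ) : ℂ) • (1 : Matrix ν ν A)

/-- The columns of a factorization of `B(Q_1, …, Q_m)`, `Q_k = 1 - V_k V_k*`, with residual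
factor `D`. -/
def starFrame (τ : Fin (m + r) → ℝ) (V : ∀ k, Matrix ν (ρ k) A) (D : Matrix ν ν A) :
    Vertex m r → Matrix (Σ w : Vertex m r, blockSize r ν ρ w) ν A
  | centre => stack (centreBlocks τ V D)
  | paired k false => stack (Pi.single (paired k false) (1 : Matrix ν ν A))
  | paired k true =>
    stack (Pi.single (paired k false) (1 - V k * (V k)ᴴ : Matrix ν ν A)
      + Pi.single (paired k true) (V k)ᴴ)
  | .single j => stack (Pi.single (Vertex.single j) (1 : Matrix ν ν A))

variable [StarModule ℂ A] {τ : Fin (m + r) → ℝ} {V : ∀ k, Matrix ν (ρ k) A} {D : Matrix ν ν A}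

theorem starFrame_conjTranspose_mul_of_not_isPair {i j : Vertex m r} (hi : i ≠ centre)
    (hj : j ≠ centre) (hij : i ≠ j) (h : ¬ IsPair i j) :
    (starFrame τ V D i)ᴴ * starFrame τ V D j = 0 := by
  rcases i with _ | ⟨k, _ | _⟩ | l <;> rcases j with _ | ⟨k', _ | _⟩ | l' <;>
  simp_all [starFrame, stack_add, Matrix.add_mul, Matrix.mul_add, stack_single_conjTranspose_mul, IsPair]
  

/-- At the second vertex of a pair the column has the blocks 1 - V V* and V*, whose contributions to
the Gram block are the complementary projections 1 - V V* and V V*. -/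
theorem starFrame_isometry (hV : ∀ k, (V k)ᴴ * V k = 1) {i : Vertex m r} (hi : i ≠ centre) :
    (starFrame τ V D i)ᴴ * starFrame τ V D i = 1 := by
  rcases i with _ | ⟨k, _ | _⟩ | l 
  · exact absurd rfl hi
  · simp [starFrame, stack_single_conjTranspose_mul]
  · simp [starFrame, stack_add, Matrix.add_mul, Matrix.mul_add, stack_single_conjTranspose_mul, IsPair]
    simp [mul_sub, sub_mul, Matrix.mul_assoc]
    simp [← Matrix.mul_assoc (V k)ᴴ, hV]
  · simp [starFrame, stack_single_conjTranspose_mul]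

theorem starFrame_pair (k : Fin m) :
    (starFrame τ V D (paired k false))ᴴ * starFrame τ V D (paired k true)
      = 1 - V k * (V k)ᴴ := by
  simp [starFrame, stack_single_conjTranspose_mul]

/-- Since V*(1 - V V*) = 0, the second column loses its own row block on the range of Q = 1 - V V*
and becomes the first one there. This coincidence is the source of (Com). -/
theorem starFrame_pair_mul (hV : ∀ k, (V k)ᴴ * V k = 1) (k : Fin m) :
    starFrame τ V D (paired k false) * (1 - V k * (V k)ᴴ) =
      starFrame τ V D (paired k true) * (1 - V k * (V k)ᴴ) := by
  have h1 : (V k)ᴴ * (1 - V k * (V k)ᴴ) = 0 := by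
    simp [mul_sub, Matrix.mul_sub, ← Matrix.mul_assoc, hV]
  have h2 : (1 - V k * (V k)ᴴ) * (1 - V k * (V k)ᴴ) = 1 - V k * (V k)ᴴ := by
    rw [sub_mul, Matrix.mul_assoc, h1]
    simp
  rw [starFrame, starFrame, stack_add, Matrix.add_mul, stack_single_mul, stack_single_mul,
    stack_single_mul, h1, Pi.single_zero, h2, Matrix.one_mul]
  exact (add_zero _).symm

theorem starFrame_centre (hV : ∀ k, (V k)ᴴ * V k = 1)  {i : Vertex m r} (hi : i ≠ centre) :
    (starFrame τ V D i)ᴴ * starFrame τ V D centre = ((weight τ i : ℝ) : ℂ) • 1 := by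
  rcases i with _ | ⟨k, _ | _⟩ | l
  · exact absurd rfl hi
  all_goals simp [starFrame, centreBlocks, weight, stack_add, Matrix.add_mul, stack_single_conjTranspose_mul, ← smul_add]

/-- The hypothesis says that `D` is a factor of the Schur complement: it supplies exactly the part
of the identity not yet covered by the other row blocks of the central column. -/
theorem starFrame_centre_isometry
    (hD : Dᴴ * D = 1 - ∑ k, ((τ (Fin.castAdd r k) ^ 2 : ℝ) : ℂ) • (1 + V k * (V k)ᴴ)
      - ∑ j, ((τ (Fin.natAdd m j) ^ 2 : ℝ) : ℂ) • (1 : Matrix ν ν A)) :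
    (starFrame τ V D centre)ᴴ * starFrame τ V D centre = 1 := by
  rw [starFrame, stack_conjTranspose_mul, sum_vertex]
  simp only [centreBlocks, hD, Matrix.conjTranspose_smul, Matrix.smul_mul, Matrix.mul_smul, smul_smul]
  simp [← pow_two]
  abel

/-- The row blocks of the vertices other than the centre are columns of the frame, up to right
multiplication by V_k at the second vertex of a pair. They clear the central column down to `D`, and
the right inverse `D'` then produces the central row block. This plays the role of density of the
sum of the subspaces. -/
theorem starFrame_range (hV : ∀ k, (V k)ᴴ * V k = 1) {D' : Matrix ν ν A} (hD' : D * D' = 1) :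
    InColumnSpan (starFrame τ V D)
      (1 : Matrix (Σ w : Vertex m r, blockSize r ν ρ w) (Σ w : Vertex m r, blockSize r ν ρ w) A) := by
  have hne : ∀ w, w ≠ centre →
      InColumnSpan (starFrame τ V D) (blockIncl A (blockSize r ν ρ) w) := by
    intro w hw
    rcases w with _ | ⟨k, _ | _⟩ | l
    · exact absurd rfl hw
    · exact InColumnSpan.self (G := starFrame τ V D) (paired k false)
    · convert (InColumnSpan.self (G := starFrame τ V D) (paired k true)).mul (V k) using 1
      have h1 : (1 - V k * (V k)ᴴ) * V k = 0 := by
        rw [Matrix.sub_mul, Matrix.mul_assoc, hV]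
        simp
      rw [starFrame, stack_add, Matrix.add_mul, stack_mul, stack_mul, blockIncl,
        ← stack_add]
      congr 1
      funext w
      by_cases hw : w = paired k false
      · subst hw
        simp [h1]
      · by_cases hw' : w = paired k true
        · subst hw'
          simp [hV]
        · simp [hw, hw']
    · exact InColumnSpan.self (G := starFrame τ V D) (.single l)
  have hc : InColumnSpan (starFrame τ V D)
      (blockIncl A (blockSize r ν ρ) centre) := by
    have h1 := InColumnSpan.self (G := starFrame τ V D) centre
    rw [starFrame, stack_eq_sum, ← Finset.add_sum_erase _ _ (Finset.mem_univ centre)] at h1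
    have h2 := h1.sub (InColumnSpan.sum (Finset.univ.erase centre) fun w hw =>
      (hne w (Finset.ne_of_mem_erase hw)).mul (centreBlocks τ V D w))
    rw [add_sub_cancel_right] at h2
    have h3 := h2.mul D'
    rw [Matrix.mul_assoc] at h3
    have h4 : centreBlocks τ V D centre * D' =
        (1 : Matrix (blockSize r ν ρ centre) (blockSize r ν ρ centre) A) := hD'
    exact Eq.mp (congrArg (InColumnSpan (starFrame τ V D))
      ((congrArg (blockIncl A (blockSize r ν ρ) centre * ·) h4).trans (Matrix.mul_one _))) h3
  rw [← sum_blockIncl_mul_conjTranspose]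
  refine InColumnSpan.sum _ fun w _ => InColumnSpan.mul ?_ _
  by_cases h : w = centre
  · subst h
    exact hc
  · exact hne w h

end Frame

/-! ### From a Gram matrix to the relations (Ang), (Com), (Ort). -/

section Relations

variable {m r : ℕ} {ν κ : Type} [Fintype ν] [DecidableEq ν] [Fintype κ] [DecidableEq κ]
  {A : Type*} [Ring A] [StarRing A] [Algebra ℂ A] [StarModule ℂ A]

/-- The range projection of an isometric matrix. -/
theorem isStarProjection_mul_conjTranspose {G : Matrix κ ν A} (hG : Gᴴ * G = 1) :
    IsStarProjection (G * Gᴴ) where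
  isIdempotentElem := by
    rw [IsIdempotentElem, Matrix.mul_assoc, ← Matrix.mul_assoc Gᴴ, hG, Matrix.one_mul]
  isSelfAdjoint := by
    rw [IsSelfAdjoint, Matrix.star_eq_conjTranspose, Matrix.conjTranspose_mul,
      Matrix.conjTranspose_conjTranspose]

theorem _root_.Matrix.mul_mul_mul_assoc {α β γ δ ε : Type*} [Fintype β] [Fintype γ] [Fintype δ]
    {A : Type*} [NonUnitalSemiring A]
    (a : Matrix α β A) (b : Matrix β γ A) (c : Matrix γ δ A) (d : Matrix δ ε A) :
    a * b * (c * d) = a * (b * c) * d := by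
  simp only [Matrix.mul_assoc]

/-- Isometric matrices whose Gram matrix is `B(Q_1, …, Q_m)` have range projections satisfying
(Ang), (Com), (Ort). -/
theorem angComOrt_of_gram {τ : Fin (m + r) → ℝ} {G : Vertex m r → Matrix κ ν A}
    {Q : Fin m → Matrix ν ν A} (hG : ∀ i, (G i)ᴴ * G i = 1)
    (hc : ∀ i, i ≠ centre → (G i)ᴴ * G centre = ((weight τ i : ℝ) : ℂ) • 1)
    (hQ : ∀ k, (G (paired k false))ᴴ * G (paired k true) = Q k)
    (hQs : ∀ k, (Q k)ᴴ = Q k)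
    (hGQ : ∀ k, G (paired k false) * Q k = G (paired k true) * Q k)
    (ho : ∀ i j, i ≠ centre → j ≠ centre → i ≠ j → ¬ IsPair i j → (G i)ᴴ * G j = 0) :
    AngComOrt τ (fun i => G i * (G i)ᴴ) := by
  have hc' : ∀ i, i ≠ centre → (G centre)ᴴ * G i = ((weight τ i : ℝ) : ℂ) • 1 := by
    intro i hi
    have := congrArg Matrix.conjTranspose (hc i hi)
    simpa using this
  have hQ' : ∀ k, (G (paired k true))ᴴ * G (paired k false) = Q k := by
    intro k
    have := congrArg Matrix.conjTranspose (hQ k)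
    simpa [hQs] using this
  -- The two products are G_f Q G_t* and G_t Q G_f*, where f and t are the two vertices of the pair;
  -- replacing G_t Q by G_f Q, and likewise for adjoints, turns both into G_f Q G_f*.
  have hcom : ∀ k, G (paired k false) * (G (paired k false))ᴴ *
      (G (paired k true) * (G (paired k true))ᴴ) = G (paired k true) * (G (paired k true))ᴴ *
      (G (paired k false) * (G (paired k false))ᴴ) := by
    intro k
    rw [Matrix.mul_mul_mul_assoc, Matrix.mul_mul_mul_assoc, hQ, hQ',
      ← hGQ]
    have := congrArg Matrix.conjTranspose (hGQ k)
    simp only [Matrix.conjTranspose_mul, hQs] at this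
    rw [Matrix.mul_assoc, Matrix.mul_assoc, this]
  refine ⟨fun i hi => ?_, fun i hi => ?_, ?_, fun i j hi hj hij h => ?_⟩
  · rw [Matrix.mul_mul_mul_assoc (G centre), hc' i hi, Matrix.mul_smul, Matrix.mul_one,
      Matrix.smul_mul, Matrix.smul_mul, Matrix.mul_mul_mul_assoc (G centre), hc i hi]
    simp only [Matrix.mul_one, Matrix.mul_smul, Matrix.smul_mul, smul_smul, pow_two,
      Complex.ofReal_mul]
  · rw [Matrix.mul_mul_mul_assoc (G i), hc i hi, Matrix.mul_smul, Matrix.mul_one,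
      Matrix.smul_mul, Matrix.smul_mul, Matrix.mul_mul_mul_assoc (G i), hc' i hi]
    simp only [Matrix.mul_one, Matrix.mul_smul, Matrix.smul_mul, smul_smul, pow_two,
      Complex.ofReal_mul]
  · rintro i j ⟨k, ⟨rfl, rfl⟩ | ⟨rfl, rfl⟩⟩
    · exact hcom k
    · exact (hcom k).symm
  · rw [Matrix.mul_mul_mul_assoc, ho i j hi hj hij h, Matrix.mul_zero,
      Matrix.zero_mul]

end Relations

end SubspaceProblem

end

noncomputable section

namespace SubspaceProblem

open Matrix Vertex

/-! ### Reduction of an algebra containing the projections to its central corner. -/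

section Corner

variable {κ ν : Type} [Fintype ν] [DecidableEq ν] [Fintype κ] [DecidableEq κ]
  {A : Type*} [Ring A] [StarRing A] [Algebra ℂ A]

/-- The elements `a` such that `G a G*` belongs to `𝒮`, where `G` is isometric with range
projection in `𝒮`. -/
def corner (𝒮 : Subalgebra ℂ (Matrix κ κ A)) (G : Matrix κ ν A) (hG : Gᴴ * G = 1)
    (h : G * Gᴴ ∈ 𝒮) : Subalgebra ℂ (Matrix ν ν A) where
  carrier := {a | G * a * Gᴴ ∈ 𝒮}
  mul_mem' {a b} ha hb := by
    have := 𝒮.mul_mem ha hb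
    rwa [Matrix.mul_mul_mul_assoc (G * a), ← Matrix.mul_assoc Gᴴ, hG,
      Matrix.one_mul, Matrix.mul_assoc G] at this
  add_mem' {a b} ha hb := by
    have := 𝒮.add_mem ha hb
    rwa [← Matrix.add_mul, ← Matrix.mul_add] at this
  algebraMap_mem' c := by
    have := 𝒮.smul_mem h c
    simpa [Algebra.algebraMap_eq_smul_one] using this

theorem mem_corner {𝒮 : Subalgebra ℂ (Matrix κ κ A)} {G : Matrix κ ν A} {hG : Gᴴ * G = 1}
    {h : G * Gᴴ ∈ 𝒮} {a : Matrix ν ν A} : a ∈ corner 𝒮 G hG h ↔ G * a * Gᴴ ∈ 𝒮 := Iff.rfl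

variable [StarModule ℂ A] {m r : ℕ} {τ : Fin (m + r) → ℝ} {G : Vertex m r → Matrix κ ν A}
  {Q : Fin m → Matrix ν ν A} {𝒮 : Subalgebra ℂ (Matrix κ κ A)}

/-- A product of the projection at `i` with the central one is `weight τ i` times G_i G_c* (c the
centre), and the weight is nonzero. So the partial isometries between the ranges belong to the
algebra and can transport the corner at the centre to any place. -/
theorem mul_centre_mem (hG : ∀ i, (G i)ᴴ * G i = 1) (hτ : ∀ j, τ j ≠ 0)
    (hc : ∀ i, i ≠ centre → (G i)ᴴ * G centre = ((weight τ i : ℝ) : ℂ) • 1)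
    (hp : ∀ i, G i * (G i)ᴴ ∈ 𝒮) (i : Vertex m r) :
    G i * (G centre)ᴴ ∈ 𝒮 ∧ G centre * (G i)ᴴ ∈ 𝒮 := by
  by_cases hi : i = centre
  · subst hi
    exact ⟨hp _, hp _⟩
  have hw : ((weight τ i : ℝ) : ℂ) ≠ 0 := by
    rcases i with _ | _ | _
    · exact absurd rfl hi
    all_goals simp [weight, hτ]
  have hc' : (G centre)ᴴ * G i = ((weight τ i : ℝ) : ℂ) • 1 := by
    have := congrArg Matrix.conjTranspose (hc i hi)
    simpa using this
  constructor
  · have := 𝒮.smul_mem (𝒮.mul_mem (hp i) (hp centre)) ((weight τ i : ℝ) : ℂ)⁻¹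
    rwa [Matrix.mul_mul_mul_assoc, hc i hi, Matrix.mul_smul, Matrix.smul_mul, smul_smul,
      inv_mul_cancel₀ hw, one_smul, Matrix.mul_one] at this
  · have := 𝒮.smul_mem (𝒮.mul_mem (hp centre) (hp i)) ((weight τ i : ℝ) : ℂ)⁻¹
    rwa [Matrix.mul_mul_mul_assoc, hc', Matrix.mul_smul, Matrix.smul_mul, smul_smul,
      inv_mul_cancel₀ hw, one_smul, Matrix.mul_one] at this

theorem gram_mem_corner (hG : ∀ i, (G i)ᴴ * G i = 1) (hτ : ∀ j, τ j ≠ 0)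
    (hc : ∀ i, i ≠ centre → (G i)ᴴ * G centre = ((weight τ i : ℝ) : ℂ) • 1)
    (hp : ∀ i, G i * (G i)ᴴ ∈ 𝒮) (i j : Vertex m r) :
    (G i)ᴴ * G j ∈ corner 𝒮 (G centre) (hG centre) (hp centre) := by
  have h := 𝒮.mul_mem (mul_centre_mem hG hτ hc hp i).2 (mul_centre_mem hG hτ hc hp j).1
  rwa [Matrix.mul_mul_mul_assoc] at h

/-- Writing 1 = ∑ G_i C_i gives a = ∑ G_i (C_i a C_j*) G_j*. Each middle factor lies in the full
central corner and is moved to the place (i, j) by the partial isometries of `mul_centre_mem`. -/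
theorem eq_top_of_corner_eq_top (hG : ∀ i, (G i)ᴴ * G i = 1) (hτ : ∀ j, τ j ≠ 0)
    (hc : ∀ i, i ≠ centre → (G i)ᴴ * G centre = ((weight τ i : ℝ) : ℂ) • 1)
    (hp : ∀ i, G i * (G i)ᴴ ∈ 𝒮) (hspan : InColumnSpan G (1 : Matrix κ κ A))
    (htop : corner 𝒮 (G centre) (hG centre) (hp centre) = ⊤) : 𝒮 = ⊤ := by
  obtain ⟨C, hC⟩ := hspan
  have hC' : ∑ i, (C i)ᴴ * (G i)ᴴ = 1 := by
    have := congrArg Matrix.conjTranspose hC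
    simpa [Matrix.conjTranspose_sum] using this
  refine eq_top_iff.2 fun a _ => ?_
  have ha : a = (∑ i, G i * C i) * a * ∑ j, (C j)ᴴ * (G j)ᴴ := by
    rw [hC, hC', Matrix.one_mul, Matrix.mul_one]
  rw [ha, Matrix.mul_sum]
  refine 𝒮.sum_mem fun j _ => ?_
  rw [Matrix.sum_mul, Matrix.sum_mul]
  refine 𝒮.sum_mem fun i _ => ?_
  have h : C i * a * (C j)ᴴ ∈ corner 𝒮 (G centre) (hG centre) (hp centre) := htop ▸ trivial
  have := 𝒮.mul_mem (𝒮.mul_mem (mul_centre_mem hG hτ hc hp i).1 (mem_corner.1 h))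
    (mul_centre_mem hG hτ hc hp j).2
  have key : G i * (G centre)ᴴ * (G centre * (C i * a * (C j)ᴴ) * (G centre)ᴴ) *
      (G centre * (G j)ᴴ) = G i * C i * a * ((C j)ᴴ * (G j)ᴴ) := by
    calc _ = G i * ((G centre)ᴴ * G centre) * (C i * a * (C j)ᴴ) *
          ((G centre)ᴴ * G centre) * (G j)ᴴ := by simp only [Matrix.mul_assoc]
      _ = _ := by
        rw [hG]
        simp only [Matrix.mul_assoc, Matrix.one_mul]
  rwa [key] at this

end Corner

end SubspaceProblem

end

noncomputable section

namespace SubspaceProblem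

open Matrix Vertex

/-! ### Block operators on Hilbert sums. -/

section BlockOp

variable {ι : Type*} [Fintype ι] {H H' : Type*} [NormedAddCommGroup H] [InnerProductSpace ℂ H]
  [NormedAddCommGroup H'] [InnerProductSpace ℂ H']

@[simp] theorem blockOp_apply (B : Matrix ι ι (H →L[ℂ] H)) (x : PiLp 2 fun _ : ι => H) (i : ι) :
    blockOp B x i = ∑ j, B i j (x j) := by
  simp [blockOp]

@[simp] theorem diagOp_apply (X : H →L[ℂ] H') (x : PiLp 2 fun _ : ι => H) (i : ι) :
    diagOp ι X x i = X (x i) := by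
  simp [diagOp]

theorem blockOp_mul (B C : Matrix ι ι (H →L[ℂ] H)) : blockOp (B * C) = blockOp B ∘L blockOp C := by
  ext x i
  simp only [blockOp_apply, Matrix.mul_apply, ContinuousLinearMap.comp_apply,
    ContinuousLinearMap.sum_apply, map_sum, ContinuousLinearMap.mul_apply]
  exact Finset.sum_comm

theorem blockOp_add (B C : Matrix ι ι (H →L[ℂ] H)) : blockOp (B + C) = blockOp B + blockOp C := by
  ext x i
  simp [Finset.sum_add_distrib]

theorem blockOp_smul_one [DecidableEq ι] (c : ℂ) :
    blockOp (c • (1 : Matrix ι ι (H →L[ℂ] H))) = c • ContinuousLinearMap.id ℂ _ := by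
  ext x i
  simp only [blockOp_apply, Matrix.smul_apply, Matrix.one_apply]
  rw [Finset.sum_eq_single i] <;> simp +contextual [eq_comm]

theorem blockOp_single_apply [DecidableEq ι] (i j : ι) (a : H →L[ℂ] H)
    (x : PiLp 2 fun _ : ι => H) : blockOp (Matrix.single i j a) x = PiLp.single 2 i (a (x j)) := by
  ext l
  rw [blockOp_apply, Finset.sum_eq_single j]
  · by_cases h : l = i
    · subst h; simp
    · simp [h, Matrix.single_apply, Ne.symm h]
  · intro k _ hk
    simp [Matrix.single_apply, hk.symm]
  · simp

end BlockOp

/-! ### The algebra of intertwined matrices and fullness. -/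

section Intertwiner

variable {ι : Type} [Fintype ι] [DecidableEq ι] {A : Type*} [Ring A] [StarRing A] [Algebra ℂ A]
  {H H' : Type*} [NormedAddCommGroup H] [InnerProductSpace ℂ H] [CompleteSpace H]
  [NormedAddCommGroup H'] [InnerProductSpace ℂ H'] [CompleteSpace H']

theorem map_algebraMap_matrix (σ : A →⋆ₐ[ℂ] (H →L[ℂ] H)) (c : ℂ) :
    (algebraMap ℂ (Matrix ι ι A) c).map σ = c • (1 : Matrix ι ι (H →L[ℂ] H)) := by
  ext i j : 1
  by_cases hij : i = j <;>
    simp [Matrix.algebraMap_matrix_apply, hij, Algebra.algebraMap_eq_smul_one]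

/-- The matrices over `A` whose images under the representations `π` and `π'` are intertwined
by `T`. -/
def intertwined (π : A →⋆ₐ[ℂ] (H →L[ℂ] H)) (π' : A →⋆ₐ[ℂ] (H' →L[ℂ] H'))
    (T : PiLp 2 (fun _ : ι => H) →L[ℂ] PiLp 2 (fun _ : ι => H')) :
    Subalgebra ℂ (Matrix ι ι A) where
  carrier := {a | T ∘L blockOp (a.map π) = blockOp (a.map π') ∘L T}
  mul_mem' {a b} ha hb := by
    simp only [Set.mem_setOf_eq, Matrix.map_mul, blockOp_mul] at *
    rw [← ContinuousLinearMap.comp_assoc, ha, ContinuousLinearMap.comp_assoc, hb,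
      ContinuousLinearMap.comp_assoc]
  add_mem' {a b} ha hb := by
    simp only [Set.mem_setOf_eq] at *
    rw [Matrix.map_add _ (map_add π), Matrix.map_add _ (map_add π'), blockOp_add, blockOp_add,
      ContinuousLinearMap.comp_add, ha, hb, ContinuousLinearMap.add_comp]
  algebraMap_mem' c := by
    simp only [Set.mem_setOf_eq]
    rw [map_algebraMap_matrix, map_algebraMap_matrix, blockOp_smul_one, blockOp_smul_one]
    ext x
    simp

variable {π : A →⋆ₐ[ℂ] (H →L[ℂ] H)} {π' : A →⋆ₐ[ℂ] (H' →L[ℂ] H')}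
  {T : PiLp 2 (fun _ : ι => H) →L[ℂ] PiLp 2 (fun _ : ι => H')}

theorem mem_intertwined {a : Matrix ι ι A} : a ∈ intertwined π π' T ↔
    T ∘L blockOp (a.map π) = blockOp (a.map π') ∘L T := Iff.rfl

/-- Intertwining the matrix units forces `T` to have equal diagonal blocks X and zero off-diagonal
ones; intertwining the matrices a ⊗ e_ii then makes X intertwine the two representations. -/
theorem exists_diagOp_of_intertwined_eq_top [Nonempty ι] (h : intertwined π π' T = ⊤) :
    ∃ X : H →L[ℂ] H', (∀ a, X ∘L π a = π' a ∘L X) ∧ T = diagOp ι X := by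
  have key : ∀ (i j : ι) (a : A) (y : H), T (PiLp.single 2 i (π a y)) =
      PiLp.single 2 i (π' a (T (PiLp.single 2 j y) j)) := by
    intro i j a y
    have h1 : Matrix.single i j a ∈ intertwined π π' T := h ▸ trivial
    have h2 := congrArg (fun F => F (PiLp.single 2 j y)) (mem_intertwined.1 h1)
    simpa [Matrix.map_single, blockOp_single_apply] using h2
  obtain ⟨i₀⟩ := ‹Nonempty ι›
  let X : H →L[ℂ] H' := PiLp.proj 2 (fun _ : ι => H') i₀ ∘L T ∘L
    (PiLp.continuousLinearEquiv 2 ℂ (fun _ : ι => H)).symm.toContinuousLinearMap ∘L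
      ContinuousLinearMap.single ℂ (fun _ : ι => H) i₀
  have hX : ∀ y, X y = T (PiLp.single 2 i₀ y) i₀ := fun y => rfl
  refine ⟨X, fun a => ?_, ?_⟩
  · ext y
    simp [hX, key i₀ i₀ a y]
  · ext x i
    have hx : x = ∑ j, PiLp.single 2 j (x j) := by
      ext l
      simp
    conv_lhs => rw [hx]
    have h1 : ∀ j, T (PiLp.single 2 j (x j)) = PiLp.single 2 j (X (x j)) := by
      intro j
      have := key j i₀ 1 (x j)
      simpa [hX] using this
    simp [h1]

open scoped CStarAlgebra in
-- A *-homomorphism between C*-algebras is automatically continuous. Continuity at each fixed vector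
-- is enough for the intertwining relation to be a closed condition.
theorem continuous_blockOp_map_apply {A : Type*} [CStarAlgebra A] (π : A →⋆ₐ[ℂ] (H →L[ℂ] H))
    {F : A → Matrix ι ι A} (hF : Continuous F) (x : PiLp 2 (fun _ : ι => H)) :
    Continuous fun a => blockOp ((F a).map π) x := by
  have hπ : Continuous π := map_continuous (π : A →⋆ₙₐ[ℂ] (H →L[ℂ] H))
  have h : Continuous fun a i => ∑ j, π (F a i j) (x j) :=
    continuous_pi fun i => continuous_finsetSum _ fun j _ =>
      (hπ.comp (hF.matrix_elem i j)).clm_apply continuous_const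
  convert (PiLp.continuous_toLp 2 (fun _ : ι => H)).comp h using 2 with a
  ext i
  simp

theorem isClosed_setOf_mem_intertwined {A : Type*} [CStarAlgebra A]
    {π : A →⋆ₐ[ℂ] (H →L[ℂ] H)} {π' : A →⋆ₐ[ℂ] (H' →L[ℂ] H')}
    {T : PiLp 2 (fun _ : ι => H) →L[ℂ] PiLp 2 (fun _ : ι => H')} {F : A → Matrix ι ι A}
    (hF : Continuous F) : IsClosed {a | F a ∈ intertwined π π' T} := by
  have hcl : {a | F a ∈ intertwined π π' T} = ⋂ (x : PiLp 2 (fun _ : ι => H)),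
      {a | T (blockOp ((F a).map π) x) = blockOp ((F a).map π') (T x)} := by
    ext a
    simp [mem_intertwined, ContinuousLinearMap.ext_iff]
  rw [hcl]
  exact isClosed_iInter fun x => isClosed_eq
    (T.continuous.comp (continuous_blockOp_map_apply π hF x))
    (continuous_blockOp_map_apply π' hF (T x))

end Intertwiner

/-! ### The generators of C*(F₂). -/

section FreeGroup

instance : IsClosed (FreeGroupCStar : Set BoundedFamilies) :=
  StarSubalgebra.isClosed_topologicalClosure _

/-- The first universal unitary in `C*(F₂)`. -/
def freeU : FreeGroupCStar :=
  ⟨genU, StarSubalgebra.le_topologicalClosure _ (StarAlgebra.subset_adjoin _ _ (by simp))⟩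

/-- The second universal unitary in `C*(F₂)`. -/
def freeV : FreeGroupCStar :=
  ⟨genV, StarSubalgebra.le_topologicalClosure _ (StarAlgebra.subset_adjoin _ _ (by simp))⟩

theorem freeU_mem_unitary : freeU ∈ unitary FreeGroupCStar := by
  refine ⟨Subtype.ext (Subtype.ext (funext fun q => ?_)),
    Subtype.ext (Subtype.ext (funext fun q => ?_))⟩
  · exact q.1.2.1
  · exact q.1.2.2

theorem freeV_mem_unitary : freeV ∈ unitary FreeGroupCStar := by
  refine ⟨Subtype.ext (Subtype.ext (funext fun q => ?_)),
    Subtype.ext (Subtype.ext (funext fun q => ?_))⟩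
  · exact q.2.2.1
  · exact q.2.2.2

/-- `J` is not assumed to be closed under the adjoint, so the adjoints of the generators are
separate hypotheses. Together the four elements generate the dense *-subalgebra, and closedness does
the rest. -/
theorem eq_top_of_generators_mem (J : Subalgebra ℂ FreeGroupCStar)
    (hJ : IsClosed (J : Set FreeGroupCStar)) (hU : freeU ∈ J) (hU' : star freeU ∈ J)
    (hV : freeV ∈ J) (hV' : star freeV ∈ J) : J = ⊤ := by
  have h1 : (StarAlgebra.adjoin ℂ {genU, genV}).toSubalgebra ≤
      J.map FreeGroupCStar.subtype.toAlgHom := by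
    rw [StarAlgebra.adjoin_toSubalgebra]
    refine Algebra.adjoin_le ?_
    rintro x (hx | hx)
    · rcases hx with rfl | rfl
      · exact ⟨freeU, hU, rfl⟩
      · exact ⟨freeV, hV, rfl⟩
    · rcases hx with hx | hx
      · exact ⟨star freeU, hU', by rw [← star_star x, hx]; rfl⟩
      · exact ⟨star freeV, hV', by rw [← star_star x, hx]; rfl⟩
  refine eq_top_iff.2 fun x _ => ?_
  rw [← SetLike.mem_coe, ← hJ.closure_eq, closure_subtype]
  exact closure_mono h1 x.2

end FreeGroup

end SubspaceProblem

end

/-! ### The criterion for *-wildness. -/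

noncomputable section

namespace SubspaceProblem

open Matrix Vertex

/-- Needed to pass from matrices indexed by the row blocks to matrices indexed by `Fin n`, as the
definition of wildness requires. -/
theorem AngComOrt.map {m r : ℕ} {𝒜 ℬ : Type*} [Ring 𝒜] [Algebra ℂ 𝒜] [Ring ℬ] [Algebra ℂ ℬ]
    {τ : Fin (m + r) → ℝ} {p : Vertex m r → 𝒜} (h : AngComOrt τ p) (f : 𝒜 →ₐ[ℂ] ℬ) :
    AngComOrt τ (fun i => f (p i)) where
  ang_left i hi := by rw [← map_mul, ← map_mul, h.ang_left i hi, map_smul]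
  ang_right i hi := by rw [← map_mul, ← map_mul, h.ang_right i hi, map_smul]
  com i j hij := by rw [← map_mul, ← map_mul, h.com i j hij]
  ort i j hi hj hij hp := by rw [← map_mul, h.ort i j hi hj hij hp, map_zero]

variable {m r : ℕ} {ν : Type} {ρ : Fin m → Type} [Fintype ν] [DecidableEq ν]
  [∀ k, Fintype (ρ k)] [∀ k, DecidableEq (ρ k)]

/-- A subalgebra of `M_ν(C*(F₂))` containing the matrix units and the two generators in one of the
corners, and closed entrywise, is everything. -/
theorem subalgebra_eq_top_of_single_mem (𝒯 : Subalgebra ℂ (Matrix ν ν FreeGroupCStar))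
    (hcl : ∀ i j, IsClosed {a | Matrix.single i j a ∈ 𝒯}) (h1 : ∀ i j, Matrix.single i j 1 ∈ 𝒯)
    {i₀ : ν} (hU : Matrix.single i₀ i₀ freeU ∈ 𝒯) (hU' : Matrix.single i₀ i₀ (star freeU) ∈ 𝒯)
    (hV : Matrix.single i₀ i₀ freeV ∈ 𝒯) (hV' : Matrix.single i₀ i₀ (star freeV) ∈ 𝒯) :
    𝒯 = ⊤ := by
  -- The coefficients allowed at the place (i₀, i₀) form a closed subalgebra containing the
  -- generators; the matrix units then carry any coefficient to any place.
  let J : Subalgebra ℂ FreeGroupCStar :=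
    { carrier := {a | Matrix.single i₀ i₀ a ∈ 𝒯}
      mul_mem' := fun {a b} ha hb => by
        have := 𝒯.mul_mem ha hb
        rwa [Matrix.single_mul_single_same] at this
      add_mem' := fun {a b} ha hb => by
        have := 𝒯.add_mem ha hb
        rwa [← Matrix.single_add] at this
      algebraMap_mem' := fun c => by
        have := 𝒯.smul_mem (h1 i₀ i₀) c
        rwa [Matrix.smul_single, ← Algebra.algebraMap_eq_smul_one] at this }
  have hJ : J = ⊤ := eq_top_of_generators_mem J (hcl i₀ i₀) hU hU' hV hV'
  refine eq_top_iff.2 fun a _ => ?_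
  rw [Matrix.matrix_eq_sum_single a]
  refine 𝒯.sum_mem fun i _ => 𝒯.sum_mem fun j _ => ?_
  have h2 : Matrix.single i₀ i₀ (a i j) ∈ 𝒯 := (hJ ▸ trivial : a i j ∈ J)
  have h3 := 𝒯.mul_mem (𝒯.mul_mem (h1 i i₀) h2) (h1 i₀ j)
  rwa [Matrix.single_mul_single_same, Matrix.single_mul_single_same, one_mul, mul_one] at h3

/-- Wildness follows from isometric matrices over `C*(F₂)` whose range projections generate the
matrix units and the generators of `C*(F₂)`, provided that the residual
`1 - ∑ τ_k² (1 + V_k V_k*) - ∑ τ_j²` has an invertible factorization. -/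
theorem isStarWild_of_generating {τ : Fin (m + r) → ℝ} (hτ : ∀ j, τ j ≠ 0)
    (V : ∀ k, Matrix ν (ρ k) FreeGroupCStar) (D D' : Matrix ν ν FreeGroupCStar)
    (hV : ∀ k, (V k)ᴴ * V k = 1)
    (hD : Dᴴ * D = 1 - ∑ k, ((τ (Fin.castAdd r k) ^ 2 : ℝ) : ℂ) • (1 + V k * (V k)ᴴ)
      - ∑ j, ((τ (Fin.natAdd m j) ^ 2 : ℝ) : ℂ) • (1 : Matrix ν ν FreeGroupCStar))
    (hD' : D * D' = 1) (i₀ : ν)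
    (hgen : ∀ 𝒯 : Subalgebra ℂ (Matrix ν ν FreeGroupCStar), (∀ k, V k * (V k)ᴴ ∈ 𝒯) →
      (∀ i j, Matrix.single i j 1 ∈ 𝒯) ∧
      Matrix.single i₀ i₀ freeU ∈ 𝒯 ∧ Matrix.single i₀ i₀ (star freeU) ∈ 𝒯 ∧
      Matrix.single i₀ i₀ freeV ∈ 𝒯 ∧ Matrix.single i₀ i₀ (star freeV) ∈ 𝒯) :
    IsStarWild.{u} τ := by
  let κ := Σ w : Vertex m r, blockSize r ν ρ w
  let G := starFrame τ V D
  have hG : ∀ i, (G i)ᴴ * G i = 1 := by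
    intro i
    by_cases hi : i = centre
    · subst hi
      exact starFrame_centre_isometry hD
    · exact starFrame_isometry hV hi
  have hc : ∀ i, i ≠ centre → (G i)ᴴ * G centre = ((weight τ i : ℝ) : ℂ) • 1 :=
    fun i hi => starFrame_centre hV hi
  have hrel : AngComOrt τ (fun i => G i * (G i)ᴴ) :=
    angComOrt_of_gram (Q := fun k => 1 - V k * (V k)ᴴ) hG hc starFrame_pair
      (fun k => by simp) (starFrame_pair_mul hV)
      fun i j hi hj hij h => starFrame_conjTranspose_mul_of_not_isPair hi hj hij h
  let e : κ ≃ Fin (Fintype.card κ) := Fintype.equivFin κ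
  let f := Matrix.reindexAlgEquiv ℂ FreeGroupCStar e
  refine ⟨Fintype.card κ, Fintype.card_pos_iff.2 ⟨⟨centre, i₀⟩⟩, fun i => f (G i * (G i)ᴴ),
    fun i => ?_, hrel.map f.toAlgHom, ?_⟩
  · have h := isStarProjection_mul_conjTranspose (hG i)
    refine ⟨?_, ?_⟩
    · have := h.isIdempotentElem
      rw [IsIdempotentElem] at *
      rw [← map_mul, this]
    · have := h.isSelfAdjoint
      rw [IsSelfAdjoint, Matrix.star_eq_conjTranspose] at *
      rw [Matrix.coe_reindexAlgEquiv, Matrix.conjTranspose_reindex, this]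
  · intro H H' _ _ _ _ _ _ π π' T hT
    have : Nonempty (Fin (Fintype.card κ)) := ⟨e ⟨centre, i₀⟩⟩
    apply exists_diagOp_of_intertwined_eq_top
    -- The matrices intertwined by `T` form an algebra, which contains the projections by
    -- hypothesis. Fullness amounts to showing that this algebra is everything.
    let 𝒮 : Subalgebra ℂ (Matrix κ κ FreeGroupCStar) := (intertwined π π' T).comap f.toAlgHom
    have hp : ∀ i, G i * (G i)ᴴ ∈ 𝒮 := hT
    have hS : 𝒮 = ⊤ := by
      refine eq_top_of_corner_eq_top hG hτ hc hp (starFrame_range hV hD') ?_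
      -- The central corner contains the Gram blocks; the block of the k-th pair is 1 - V_k V_k*, so
      -- V_k V_k* is in the corner too.
      obtain ⟨h1, hU, hU', hV', hV''⟩ := hgen (corner 𝒮 (G centre) (hG centre) (hp centre))
        fun k => by
          have h := gram_mem_corner hG hτ hc hp (paired k false) (paired k true)
          rw [starFrame_pair] at h
          have h' := Subalgebra.sub_mem _ (Subalgebra.one_mem _) h
          rwa [sub_sub_cancel] at h'
      refine subalgebra_eq_top_of_single_mem _ (fun i j => ?_) h1 hU hU' hV' hV''
      have hcont : Continuous fun a : FreeGroupCStar =>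
          f (G centre * Matrix.single i j a * (G centre)ᴴ) := by
        have h2 : Continuous fun a : FreeGroupCStar => Matrix.single i j a := by
          refine continuous_matrix fun k l => ?_
          by_cases h : i = k ∧ j = l
          · simpa only [Matrix.single_apply, if_pos h] using continuous_id'
          · simpa only [Matrix.single_apply, if_neg h] using continuous_const
        exact ((continuous_const.matrix_mul h2).matrix_mul continuous_const).matrix_reindex _ _
      exact isClosed_setOf_mem_intertwined (π := π) (π' := π') (T := T) hcont
    refine eq_top_iff.2 fun a _ => ?_
    obtain ⟨b, rfl⟩ := f.surjective a
    exact (hS ▸ trivial : b ∈ 𝒮)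

end SubspaceProblem

end

noncomputable section

namespace SubspaceProblem

open Matrix Vertex

/-! ### Factorization of the residual. -/

section Factor

variable {ν : Type} [Fintype ν] [DecidableEq ν] {A : Type*} [Ring A] [StarRing A] [Algebra ℂ A]
  [StarModule ℂ A]

/-- Factorization of a positive diagonal matrix minus a small multiple of a rank one matrix. -/
theorem exists_factor_diagonal_sub {n a : ν → ℝ} (hn : ∀ i, 0 < n i) (W : Matrix ν (Fin 1) A)
    (hW : ∀ i, star (W i 0) * W i 0 = ((a i : ℝ) : ℂ) • 1) {κ : ℝ} (hq : 0 < ∑ i, a i / n i)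
    (hκ : κ * ∑ i, a i / n i < 1) :
    ∃ D D' : Matrix ν ν A, Dᴴ * D = diagonal (fun i => ((n i : ℝ) : ℂ) • (1 : A)) -
      (κ : ℂ) • (W * Wᴴ) ∧ D * D' = 1 := by
  set q : ℝ := ∑ i, a i / n i with hqdef
  let s : ν → ℂ := fun i => ((√(n i) : ℝ) : ℂ)
  have hs : ∀ i, s i ≠ 0 := fun i => by
    simpa [s] using (Real.sqrt_pos.2 (hn i)).ne'
  have hss : ∀ i, s i * s i = ((n i : ℝ) : ℂ) := fun i => by
    simp only [s]
    rw [← Complex.ofReal_mul, Real.mul_self_sqrt (hn i).le]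
  let Y : Matrix ν (Fin 1) A := Matrix.of fun i j => (s i)⁻¹ • W i j
  let S : Matrix ν ν A := diagonal fun i => s i • (1 : A)
  let S' : Matrix ν ν A := diagonal fun i => (s i)⁻¹ • (1 : A)
  have hSS : S * S = diagonal (fun i => ((n i : ℝ) : ℂ) • (1 : A)) := by
    simp [S, Matrix.diagonal_mul_diagonal, smul_smul, hss]
  have hSS' : S * S' = 1 := by
    simp [S, S', Matrix.diagonal_mul_diagonal, smul_smul, hs]
  have hS : Sᴴ = S := by
    simp [S, Matrix.diagonal_conjTranspose, s]
  have hSY : S * Y = W := by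
    ext i j
    simp [S, Y, Matrix.diagonal_mul, smul_smul, hs]
  have hYY : Yᴴ * Y = (q : ℂ) • 1 := by
    ext i j
    fin_cases i; fin_cases j
    simp only [Y, Matrix.mul_apply, Matrix.conjTranspose_apply, Matrix.of_apply, star_smul]
    have h1 : ∀ i, star (s i)⁻¹ • star (W i 0) * (s i)⁻¹ • W i 0 =
        ((a i / n i : ℝ) : ℂ) • (1 : A) := by
      intro i
      have h2 : star (s i) = s i := by simp [s]
      rw [smul_mul_smul_comm, hW, smul_smul, star_inv₀, h2, ← mul_inv, hss]
      congr 1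
      push_cast
      ring
    simp only [Fin.zero_eta, Fin.isValue, h1, ← Finset.sum_smul, hqdef]
    simp
  -- Because Y*Y = q, the square of 1 - βYY* is 1 - (2β - β²q)YY*. The smaller root of 2β - β²q = κ
  -- makes 1 - βq = √(1 - κq), which is nonzero, so that 1 - βYY* is invertible.
  obtain ⟨β, hβ1, hβ2⟩ : ∃ β : ℝ, 2 * β - β ^ 2 * q = κ ∧ 1 - β * q ≠ 0 := by
    have h0 : 0 < 1 - κ * q := by linarith
    refine ⟨(1 - √(1 - κ * q)) / q, ?_, ?_⟩
    · field_simp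
      nlinarith [Real.sq_sqrt h0.le]
    · rw [div_mul_cancel₀ _ hq.ne']
      simpa using (Real.sqrt_pos.2 h0).ne'
  have hK : ∀ b c : ℂ, (1 + b • (Y * Yᴴ)) * (1 + c • (Y * Yᴴ)) =
      1 + (b + c + b * c * q) • (Y * Yᴴ) := by
    intro b c
    have h1 : Y * Yᴴ * (Y * Yᴴ) = (q : ℂ) • (Y * Yᴴ) := by
      rw [Matrix.mul_mul_mul_assoc, hYY]
      simp
    rw [add_mul, one_mul, mul_add, mul_one, Matrix.smul_mul, Matrix.mul_smul, h1, smul_smul,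
      smul_smul]
    module
  -- The coefficient β/(1 - βq) is that of the inverse of a rank one perturbation of the identity.
  refine ⟨(1 + (-β : ℂ) • (Y * Yᴴ)) * S, S' * (1 + ((β / (1 - β * q) : ℝ) : ℂ) • (Y * Yᴴ)),
    ?_, ?_⟩
  · have h2 : ((1 + (-β : ℂ) • (Y * Yᴴ)) * S)ᴴ = S * (1 + (-β : ℂ) • (Y * Yᴴ)) := by
      rw [Matrix.conjTranspose_mul, hS]
      simp
    rw [h2, Matrix.mul_mul_mul_assoc, hK]
    have h3 : (-β + -β + -β * -β * q : ℂ) = -(κ : ℂ) := by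
      rw [← hβ1]; push_cast; ring
    rw [h3, mul_add, add_mul, mul_one, hSS, Matrix.mul_smul, Matrix.smul_mul, ← Matrix.mul_assoc S,
      hSY, Matrix.mul_assoc, neg_smul, sub_eq_add_neg]
    congr 3
    rw [← hSY, Matrix.conjTranspose_mul, hS]
  · rw [Matrix.mul_mul_mul_assoc, hSS', mul_one, hK]
    have h3 : (-β + ((β / (1 - β * q) : ℝ) : ℂ) + -β * ((β / (1 - β * q) : ℝ) : ℂ) * q : ℂ) = 0 := by
      norm_cast
      field_simp
      ring
    rw [h3]
    simp

end Factor

/-! ### The scalar matrices used in the wild case. -/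

section RankOne

variable {n : Type} [Fintype n] [DecidableEq n] {𝒯 : Subalgebra ℂ (Matrix n n ℂ)}
  {v₁ v₂ w₁ w₂ : n → ℂ} {k₁ k₂ : ℂ}

/-- The algebra generated by two projections which are direct sums of two pairs of rank one
projections at different angles contains all rank one operators of the first component. -/
theorem vecMulVec_mem_of_generators (h₁ : vecMulVec v₁ v₁ + vecMulVec v₂ v₂ ∈ 𝒯)
    (h₂ : vecMulVec w₁ w₁ + vecMulVec w₂ w₂ ∈ 𝒯)
    (hv₁ : v₁ ⬝ᵥ v₁ = 1) (hv₂ : v₂ ⬝ᵥ v₂ = 1) (hv : v₁ ⬝ᵥ v₂ = 0)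
    (hw₁ : v₁ ⬝ᵥ w₁ = k₁) (hw₂ : v₂ ⬝ᵥ w₂ = k₂) (h12 : v₁ ⬝ᵥ w₂ = 0) (h21 : v₂ ⬝ᵥ w₁ = 0)
    (hk : k₁ ^ 2 ≠ k₂ ^ 2) (hk₁ : k₁ ≠ 0) (a b a' b' : ℂ) :
    vecMulVec (a • v₁ + b • w₁) (a' • v₁ + b' • w₁) ∈ 𝒯 := by
  have hv' : v₂ ⬝ᵥ v₁ = 0 := by rw [dotProduct_comm, hv]
  have hw₁' : w₁ ⬝ᵥ v₁ = k₁ := by rw [dotProduct_comm, hw₁]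
  have hw₂' : w₂ ⬝ᵥ v₂ = k₂ := by rw [dotProduct_comm, hw₂]
  have h12' : w₂ ⬝ᵥ v₁ = 0 := by rw [dotProduct_comm, h12]
  have h21' : w₁ ⬝ᵥ v₂ = 0 := by rw [dotProduct_comm, h21]
  -- With P, P' the two given projections, P P' P = k₁² v₁v₁ᵀ + k₂² v₂v₂ᵀ; subtracting k₂² P
  -- isolates the first component because k₁² ≠ k₂².
  have hvv : vecMulVec v₁ v₁ ∈ 𝒯 := by
    have h := 𝒯.smul_mem (𝒯.sub_mem (𝒯.mul_mem (𝒯.mul_mem h₁ h₂) h₁) (𝒯.smul_mem h₁ (k₂ ^ 2)))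
      (k₁ ^ 2 - k₂ ^ 2)⁻¹
    convert h using 1
    rw [eq_inv_smul_iff₀ (sub_ne_zero.2 hk)]
    simp only [add_mul, mul_add, vecMulVec_mul_vecMulVec, hv, hv', hw₁, hw₂, hw₁', hw₂', h12, h12',
      h21, h21', hv₁, hv₂, smul_vecMulVec, vecMulVec_smul, Matrix.smul_mul]
    module
  have hvw : vecMulVec v₁ w₁ ∈ 𝒯 := by
    have h := 𝒯.smul_mem (𝒯.mul_mem hvv h₂) k₁⁻¹
    convert h using 1
    rw [eq_inv_smul_iff₀ hk₁]
    simp [mul_add, vecMulVec_mul_vecMulVec, hw₁, h12, vecMulVec_smul]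
  have hwv : vecMulVec w₁ v₁ ∈ 𝒯 := by
    have h := 𝒯.smul_mem (𝒯.mul_mem h₂ hvv) k₁⁻¹
    convert h using 1
    rw [eq_inv_smul_iff₀ hk₁]
    simp [add_mul, vecMulVec_mul_vecMulVec, hw₁', h12', vecMulVec_smul]
  have hww : vecMulVec w₁ w₁ ∈ 𝒯 := by
    have h := 𝒯.mul_mem hwv hvw
    simpa [vecMulVec_mul_vecMulVec, hv₁] using h
  simp only [add_vecMulVec, vecMulVec_add, smul_vecMulVec, vecMulVec_smul]
  refine 𝒯.add_mem (𝒯.smul_mem ?_ _) (𝒯.smul_mem ?_ _) <;>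
    exact 𝒯.add_mem (𝒯.smul_mem ‹_› _) (𝒯.smul_mem ‹_› _)

end RankOne

section Generators

variable {A : Type*} [Ring A] [StarRing A] [Algebra ℂ A] [StarModule ℂ A]

/-- The first pair of unit vectors spanning the coordinate planes `{1, 2}` and `{3, 4}`. -/
def wildCols₁ (x y : ℝ) : Matrix (Fin 5) (Fin 2) ℂ :=
  !![0, 0; (x : ℂ) / 4, 0; -(y : ℂ) / 4, 0; 0, (y : ℂ) / 4; 0, -(x : ℂ) / 4]

/-- The second pair of unit vectors in the coordinate planes `{1, 2}` and `{3, 4}`. -/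
def wildCols₂ (x y : ℝ) : Matrix (Fin 5) (Fin 2) ℂ :=
  !![0, 0; 1 / 4, 0; (x : ℂ) * y / 8, 0; 0, 1 / 4; 0, (x : ℂ) * y / 8]

theorem wildCols₁_conjTranspose (x y : ℝ) : (wildCols₁ x y)ᴴ =
    !![0, (x : ℂ) / 4, -(y : ℂ) / 4, 0, 0; 0, 0, 0, (y : ℂ) / 4, -(x : ℂ) / 4] := by
  ext i j
  fin_cases i <;> fin_cases j <;> simp [wildCols₁, Complex.conj_ofNat]

theorem wildCols₂_conjTranspose (x y : ℝ) : (wildCols₂ x y)ᴴ =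
    !![0, 1 / 4, (x : ℂ) * y / 8, 0, 0; 0, 0, 0, 1 / 4, (x : ℂ) * y / 8] := by
  ext i j
  fin_cases i <;> fin_cases j <;> simp [wildCols₂, Complex.conj_ofNat]

variable {x y : ℝ}

/-- In each plane the unit vectors v, w give vvᵀ + 2wwᵀ of trace 3 and determinant 2(1 - (v·w)²).
The values (v·w)² = 5/32 and 3/8 yield the eigenvalue pairs 3/4, 9/4 and 1/2, 5/2, and the vectors
are written in the corresponding eigenbases. All diagonal entries are at most 5/2, well below 4,
which leaves room for the third projection; the entry 0 is the line left untouched. -/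
theorem wildCols_relations (hx : x * x = 10) (hy : y * y = 6) :
    (wildCols₁ x y)ᴴ * wildCols₁ x y = 1 ∧ (wildCols₂ x y)ᴴ * wildCols₂ x y = 1 ∧
    wildCols₁ x y * (wildCols₁ x y)ᴴ + (2 : ℂ) • (wildCols₂ x y * (wildCols₂ x y)ᴴ) =
      diagonal ![0, 3 / 4, 9 / 4, 1 / 2, 5 / 2] := by
  replace hx : (x : ℂ) * x = 10 := mod_cast hx
  replace hy : (y : ℂ) * y = 6 := mod_cast hy
  have hxy : (x : ℂ) * y * (x * y) = 60 := by
    linear_combination (y : ℂ) * y * hx + 10 * hy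
  refine ⟨?_, ?_, ?_⟩
  · rw [wildCols₁_conjTranspose, ← Matrix.ext_iff]
    simp [wildCols₁, Fin.forall_fin_two]
    constructor <;> linear_combination (1 / 16 : ℂ) * hx + (1 / 16 : ℂ) * hy
  · rw [wildCols₂_conjTranspose, ← Matrix.ext_iff]
    simp [wildCols₂, Fin.forall_fin_two]
    linear_combination (1 / 64 : ℂ) * hxy
  · rw [wildCols₁_conjTranspose, wildCols₂_conjTranspose]
    ext i j
    fin_cases i <;> fin_cases j <;>
      simp [wildCols₁, wildCols₂, Matrix.mul_apply, Fin.sum_univ_succ] 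
    all_goals first
      | linear_combination (1 / 16 : ℂ) * hx
      | linear_combination (1 / 16 : ℂ) * hy
      | linear_combination (1 / 16 : ℂ) * hx + (2 / 64 : ℂ) * hxy
      | linear_combination (1 / 16 : ℂ) * hy + (2 / 64 : ℂ) * hxy
      | ring

/-- The squared cosines 5/32 and 3/8 of the two planes differ, so the planes can be separated.
Inside each plane the two vectors are a basis, which gives all of its matrix units. -/
theorem single_mem_of_wildCols_mem (hx : x * x = 10) (hy : y * y = 6)
    (𝒯 : Subalgebra ℂ (Matrix (Fin 5) (Fin 5) ℂ))
    (h₁ : wildCols₁ x y * (wildCols₁ x y)ᴴ ∈ 𝒯) (h₂ : wildCols₂ x y * (wildCols₂ x y)ᴴ ∈ 𝒯) :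
    (∀ i, Matrix.single i i (1 : ℂ) ∈ 𝒯) ∧ Matrix.single 1 2 (1 : ℂ) ∈ 𝒯 ∧
      Matrix.single 2 1 (1 : ℂ) ∈ 𝒯 ∧ Matrix.single 3 4 (1 : ℂ) ∈ 𝒯 ∧
      Matrix.single 4 3 (1 : ℂ) ∈ 𝒯 := by
  replace hx : (x : ℂ) * x = 10 := mod_cast hx
  replace hy : (y : ℂ) * y = 6 := mod_cast hy
  have hx0 : (x : ℂ) ≠ 0 := fun h => by simp [h] at hx
  have hy0 : (y : ℂ) ≠ 0 := fun h => by simp [h] at hy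
  let v₁ : Fin 5 → ℂ := ![0, x / 4, -y / 4, 0, 0]
  let v₂ : Fin 5 → ℂ := ![0, 0, 0, y / 4, -x / 4]
  let w₁ : Fin 5 → ℂ := ![0, 1 / 4, x * y / 8, 0, 0]
  let w₂ : Fin 5 → ℂ := ![0, 0, 0, 1 / 4, x * y / 8]
  have e₁ : wildCols₁ x y * (wildCols₁ x y)ᴴ = vecMulVec v₁ v₁ + vecMulVec v₂ v₂ := by
    rw [wildCols₁_conjTranspose]
    ext i j
    fin_cases i <;> fin_cases j <;>
      simp [v₁, v₂, wildCols₁, Matrix.mul_apply, Fin.sum_univ_succ, vecMulVec_apply]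
  have e₂ : wildCols₂ x y * (wildCols₂ x y)ᴴ = vecMulVec w₁ w₁ + vecMulVec w₂ w₂ := by
    rw [wildCols₂_conjTranspose]
    ext i j
    fin_cases i <;> fin_cases j <;>
      simp [w₁, w₂, wildCols₂, Matrix.mul_apply, Fin.sum_univ_succ, vecMulVec_apply]
  rw [e₁] at h₁
  rw [e₂] at h₂
  have hv₁ : v₁ ⬝ᵥ v₁ = 1 := by
    simp [v₁, dotProduct, Fin.sum_univ_succ]
    linear_combination (1 / 16 : ℂ) * hx + (1 / 16 : ℂ) * hy
  have hv₂ : v₂ ⬝ᵥ v₂ = 1 := by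
    simp [v₂, dotProduct, Fin.sum_univ_succ]
    linear_combination (1 / 16 : ℂ) * hx + (1 / 16 : ℂ) * hy
  have hv : v₁ ⬝ᵥ v₂ = 0 := by simp [v₁, v₂, dotProduct, Fin.sum_univ_succ]
  have hw₁ : v₁ ⬝ᵥ w₁ = -x / 8 := by
    simp [v₁, w₁, dotProduct, Fin.sum_univ_succ]
    linear_combination (-x / 32 : ℂ) * hy
  have hw₂ : v₂ ⬝ᵥ w₂ = -y / 4 := by
    simp [v₂, w₂, dotProduct, Fin.sum_univ_succ]
    linear_combination (-y / 32 : ℂ) * hx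
  have h12 : v₁ ⬝ᵥ w₂ = 0 := by simp [v₁, w₂, dotProduct, Fin.sum_univ_succ]
  have h21 : v₂ ⬝ᵥ w₁ = 0 := by simp [v₂, w₁, dotProduct, Fin.sum_univ_succ]
  have hk : (-x / 8 : ℂ) ^ 2 ≠ (-y / 4) ^ 2 := by
    have h1 : (-x / 8 : ℂ) ^ 2 = 5 / 32 := by linear_combination (1 / 64 : ℂ) * hx
    have h2 : (-y / 4 : ℂ) ^ 2 = 3 / 8 := by linear_combination (1 / 16 : ℂ) * hy
    rw [h1, h2]
    norm_num
  have m₁ := vecMulVec_mem_of_generators h₁ h₂ hv₁ hv₂ hv hw₁ hw₂ h12 h21 hk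
    (by simpa using hx0)
  have m₂ := vecMulVec_mem_of_generators (by rwa [add_comm] at h₁) (by rwa [add_comm] at h₂) hv₂ hv₁
    (by rwa [dotProduct_comm]) hw₂ hw₁ h21 h12 hk.symm (by simpa using hy0)
  -- Coordinates of the standard basis vectors of the two planes in the bases v, w.
  have b₁ : (Pi.single 1 1 : Fin 5 → ℂ) = (x / 3 : ℂ) • v₁ + (2 / 3 : ℂ) • w₁ := by
    ext i
    fin_cases i <;> simp [v₁, w₁]
    · linear_combination (-1 / 12 : ℂ) * hx
    · ring
  have b₂ : (Pi.single 2 1 : Fin 5 → ℂ) = (-y / 9 : ℂ) • v₁ + (x * y / 9 : ℂ) • w₁ := by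
    ext i
    fin_cases i <;> simp [v₁, w₁]
    · ring
    · linear_combination (-1 / 36 - x * x / 72 : ℂ) * hy - (1 / 12 : ℂ) * hx
  have b₃ : (Pi.single 3 1 : Fin 5 → ℂ) = (y / 2 : ℂ) • v₂ + (1 : ℂ) • w₂ := by
    ext i
    fin_cases i <;> simp [v₂, w₂]
    · linear_combination (-1 / 8 : ℂ) * hy
    · ring
  have b₄ : (Pi.single 4 1 : Fin 5 → ℂ) = (-x / 10 : ℂ) • v₂ + (x * y / 10 : ℂ) • w₂ := by
    ext i
    fin_cases i <;> simp [v₂, w₂]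
    · ring
    · linear_combination (-1 / 40 - y * y / 80 : ℂ) * hx - (1 / 8 : ℂ) * hy
  have s₁ : Matrix.single 1 1 (1 : ℂ) ∈ 𝒯 := by
    rw [Matrix.single_eq_single_vecMulVec_single, b₁]; exact m₁ _ _ _ _
  have s₂ : Matrix.single 2 2 (1 : ℂ) ∈ 𝒯 := by
    rw [Matrix.single_eq_single_vecMulVec_single, b₂]; exact m₁ _ _ _ _
  have s₃ : Matrix.single 3 3 (1 : ℂ) ∈ 𝒯 := by
    rw [Matrix.single_eq_single_vecMulVec_single, b₃]; exact m₂ _ _ _ _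
  have s₄ : Matrix.single 4 4 (1 : ℂ) ∈ 𝒯 := by
    rw [Matrix.single_eq_single_vecMulVec_single, b₄]; exact m₂ _ _ _ _
  refine ⟨fun i => ?_, ?_, ?_, ?_, ?_⟩
  · fin_cases i
    -- Both projections vanish on the first coordinate, so its matrix unit is the complement of the
    -- four others.
    · have h := 𝒯.sub_mem (𝒯.sub_mem (𝒯.sub_mem (𝒯.sub_mem 𝒯.one_mem s₁) s₂) s₃) s₄
      convert h using 1
      ext i j
      fin_cases i <;> fin_cases j <;> simp
    exacts [s₁, s₂, s₃, s₄]
  all_goals rw [Matrix.single_eq_single_vecMulVec_single]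
  · rw [b₁, b₂]; exact m₁ _ _ _ _
  · rw [b₁, b₂]; exact m₁ _ _ _ _
  · rw [b₃, b₄]; exact m₂ _ _ _ _
  · rw [b₃, b₄]; exact m₂ _ _ _ _

end Generators

end SubspaceProblem

end

noncomputable section

namespace SubspaceProblem

open Matrix Vertex

/-! ### Wildness of the example for c > 4. -/

section Wild

variable {A : Type*} [Ring A] [StarRing A] [Algebra ℂ A] [StarModule ℂ A]

theorem map_algebraMap_conjTranspose {m n : Type*} (M : Matrix m n ℂ) :
    (M.map (algebraMap ℂ A))ᴴ = Mᴴ.map (algebraMap ℂ A) :=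
  (Matrix.conjTranspose_map _ fun c => (algebraMap_star_comm c)).symm

/-- The column `(1, ε, ε u, ε, ε v)`. -/
def graphCol (ε : ℝ) (u v : A) : Matrix (Fin 5) (Fin 1) A :=
  Matrix.of fun i _ => ![(1 : A), (ε : ℂ) • 1, (ε : ℂ) • u, (ε : ℂ) • 1, (ε : ℂ) • v] i

theorem star_graphCol_mul (ε : ℝ) {u v : A} (hu : u ∈ unitary A) (hv : v ∈ unitary A) (i : Fin 5) :
    star (graphCol ε u v i 0) * graphCol ε u v i 0 =
      ((![1, ε ^ 2, ε ^ 2, ε ^ 2, ε ^ 2] i : ℝ) : ℂ) • 1 := by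
  have hu' := hu.1
  have hv' := hv.1
  have h : ((ε ^ 2 : ℝ) : ℂ) = (ε : ℂ) * ε := by push_cast; ring
  fin_cases i <;>
    simp only [graphCol, Matrix.of_apply, star_smul, RCLike.star_def, Complex.conj_ofReal,
      Matrix.cons_val, smul_mul_smul_comm, hu', hv', h, star_one, one_mul, Complex.ofReal_one,
      one_smul, Fin.zero_eta, Fin.mk_one, Fin.reduceFinMk]

theorem graphCol_conjTranspose_mul (ε : ℝ) {u v : A} (hu : u ∈ unitary A) (hv : v ∈ unitary A) :
    (graphCol ε u v)ᴴ * graphCol ε u v = ((1 + 4 * ε ^ 2 : ℝ) : ℂ) • 1 := by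
  ext i j
  fin_cases i; fin_cases j
  simp only [Matrix.mul_apply, Matrix.conjTranspose_apply, Fin.zero_eta, Fin.isValue,
    star_graphCol_mul ε hu hv, ← Finset.sum_smul, ← Complex.ofReal_sum]
  simp only [Fin.sum_univ_succ]
  simp
  congr 1
  ring

/-- Compressing W W*, W = (1, ε, εu, ε, εv), by diagonal units gives W_i W_j* at the place (i, j).
The scalar entries 1, ε, ε of W link the coordinate 0 with one vector of each plane, and the given
units inside the planes link it with the rest. The entries εu, εv, brought back by these units,
become u and v at the place (0, 0). -/
theorem single_graphCol_mem {ε : ℝ} (hε : ε ≠ 0) {u v : A} (hu : u ∈ unitary A)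
    (hv : v ∈ unitary A) (𝒯 : Subalgebra ℂ (Matrix (Fin 5) (Fin 5) A))
    (h₀ : ∀ i, Matrix.single i i (1 : A) ∈ 𝒯)
    (h12 : Matrix.single 1 2 (1 : A) ∈ 𝒯) (h21 : Matrix.single 2 1 (1 : A) ∈ 𝒯)
    (h34 : Matrix.single 3 4 (1 : A) ∈ 𝒯) (h43 : Matrix.single 4 3 (1 : A) ∈ 𝒯)
    (hW : graphCol ε u v * (graphCol ε u v)ᴴ ∈ 𝒯) :
    (∀ i j, Matrix.single i j (1 : A) ∈ 𝒯) ∧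
      Matrix.single 0 0 u ∈ 𝒯 ∧ Matrix.single 0 0 (star u) ∈ 𝒯 ∧
      Matrix.single 0 0 v ∈ 𝒯 ∧ Matrix.single 0 0 (star v) ∈ 𝒯 := by
  have hε' : (ε : ℂ) ≠ 0 := mod_cast hε
  have key : ∀ i j, Matrix.single i j (graphCol ε u v i 0 * star (graphCol ε u v j 0)) ∈ 𝒯 := by
    intro i j
    have h := 𝒯.mul_mem (𝒯.mul_mem (h₀ i) hW) (h₀ j)
    rw [Matrix.single_mul_mul_single] at h
    simpa [Matrix.mul_apply] using h
  have mul : ∀ {i j k : Fin 5} {a b : A}, Matrix.single i j a ∈ 𝒯 → Matrix.single j k b ∈ 𝒯 →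
      Matrix.single i k (a * b) ∈ 𝒯 := by
    intro i j k a b ha hb
    have := 𝒯.mul_mem ha hb
    rwa [Matrix.single_mul_single_same] at this
  have scale : ∀ {i j : Fin 5} {a : A}, Matrix.single i j ((ε : ℂ) • a) ∈ 𝒯 →
      Matrix.single i j a ∈ 𝒯 := by
    intro i j a ha
    have := 𝒯.smul_mem ha (ε : ℂ)⁻¹
    rwa [Matrix.smul_single, smul_smul, inv_mul_cancel₀ hε', one_smul] at this
  have k01 : Matrix.single 0 1 (1 : A) ∈ 𝒯 := scale (by simpa [graphCol] using key 0 1)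
  have k10 : Matrix.single 1 0 (1 : A) ∈ 𝒯 := scale (by simpa [graphCol] using key 1 0)
  have k03 : Matrix.single 0 3 (1 : A) ∈ 𝒯 := scale (by simpa [graphCol] using key 0 3)
  have k30 : Matrix.single 3 0 (1 : A) ∈ 𝒯 := scale (by simpa [graphCol] using key 3 0)
  have k02 : Matrix.single 0 2 (star u) ∈ 𝒯 := scale (by simpa [graphCol] using key 0 2)
  have k20 : Matrix.single 2 0 u ∈ 𝒯 := scale (by simpa [graphCol] using key 2 0)
  have k04 : Matrix.single 0 4 (star v) ∈ 𝒯 := scale (by simpa [graphCol] using key 0 4)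
  have k40 : Matrix.single 4 0 v ∈ 𝒯 := scale (by simpa [graphCol] using key 4 0)
  have l02 : Matrix.single 0 2 (1 : A) ∈ 𝒯 := by simpa using mul k01 h12
  have l20 : Matrix.single 2 0 (1 : A) ∈ 𝒯 := by simpa using mul h21 k10
  have l04 : Matrix.single 0 4 (1 : A) ∈ 𝒯 := by simpa using mul k03 h34
  have l40 : Matrix.single 4 0 (1 : A) ∈ 𝒯 := by simpa using mul h43 k30
  have row : ∀ j, Matrix.single 0 j (1 : A) ∈ 𝒯 := by
    intro j
    fin_cases j
    exacts [h₀ 0, k01, l02, k03, l04]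
  have col : ∀ i, Matrix.single i 0 (1 : A) ∈ 𝒯 := by
    intro i
    fin_cases i
    exacts [h₀ 0, k10, l20, k30, l40]
  refine ⟨fun i j => by simpa using mul (col i) (row j), ?_, ?_, ?_, ?_⟩
  · simpa using mul l02 k20
  · simpa using mul k02 l20
  · simpa using mul l04 k40
  · simpa using mul k04 l40

/-- The ranks of the three projections. -/
@[reducible] def wildRank : Fin 3 → ℕ
  | 0 => 2
  | 1 => 2
  | 2 => 1

/-- Isometric matrices onto the ranges of the three projections. -/
def wildFrame (x y ω ε : ℝ) (u v : A) : ∀ k : Fin 3, Matrix (Fin 5) (Fin (wildRank k)) A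
  | 0 => (wildCols₁ x y).map (algebraMap ℂ A)
  | 1 => (wildCols₂ x y).map (algebraMap ℂ A)
  | 2 => (ω : ℂ) • graphCol ε u v

end Wild

/-- The residual is τ₀² (c - R₁ - 2R₂ - 4R₃), with c - R₁ - 2R₂ diagonal and R₃ of rank one over
C*(F₂). The inequality c > 4 is what R₃ needs along the first coordinate, and continuity in ε gives
the small coupling with the other four. -/
theorem isStarWild_exampleTau {τ₀ : ℝ} (h0 : 0 < τ₀) (h : 20 * τ₀ ^ 2 < 1) :
    IsStarWild.{u} (exampleTau τ₀) := by
  let c : ℝ := 1 / τ₀ ^ 2 - 16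
  have hτ2 : 0 < τ₀ ^ 2 := by positivity
  have hc : 4 < c := by
    have : 20 < 1 / τ₀ ^ 2 := by rw [lt_div_iff₀ hτ2]; exact h
    simp only [c]; linarith
  have hcτ : τ₀ ^ 2 * c = 1 - 16 * τ₀ ^ 2 := by simp only [c]; field_simp
  -- The choice amounts to 4/c = 1 - 16ε², a margin which absorbs the four other terms of the sum
  -- below.
  obtain ⟨ε, hε, hε2⟩ : ∃ ε : ℝ, 0 < ε ∧ ε ^ 2 = (1 - 4 / c) / 16 := by
    have : 0 < (1 - 4 / c) / 16 := by
      have : 4 / c < 1 := by rw [div_lt_one (by linarith)]; exact hc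
      linarith
    exact ⟨_, Real.sqrt_pos.2 this, Real.sq_sqrt this.le⟩
  have hpos : 0 < 1 + 4 * ε ^ 2 := by positivity
  -- The column has squared length 1 + 4ε², so ω normalizes it to an isometry.
  obtain ⟨ω, hω, hω2⟩ : ∃ ω : ℝ, 0 < ω ∧ ω ^ 2 = 1 / (1 + 4 * ε ^ 2) :=
    ⟨_, Real.sqrt_pos.2 (by positivity), Real.sq_sqrt (by positivity)⟩
  obtain ⟨x, hx⟩ : ∃ x : ℝ, x * x = 10 := ⟨√10, Real.mul_self_sqrt (by norm_num)⟩
  obtain ⟨y, hy⟩ : ∃ y : ℝ, y * y = 6 := ⟨√6, Real.mul_self_sqrt (by norm_num)⟩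
  let V := wildFrame x y ω ε freeU freeV
  let d : Fin 5 → ℝ := ![0, 3 / 4, 9 / 4, 1 / 2, 5 / 2]
  let a : Fin 5 → ℝ := ![1, ε ^ 2, ε ^ 2, ε ^ 2, ε ^ 2]
  have hn : ∀ i, 0 < τ₀ ^ 2 * (c - d i) := by
    intro i
    apply mul_pos hτ2
    fin_cases i <;> simp [d] <;> linarith
  obtain ⟨D, D', hD, hD'⟩ := exists_factor_diagonal_sub (κ := 4 * τ₀ ^ 2 * ω ^ 2) (a := a) hn
    (graphCol ε freeU freeV) (star_graphCol_mul ε freeU_mem_unitary freeV_mem_unitary)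
    (Finset.sum_pos (fun i _ => div_pos (by fin_cases i <;> simp [a] <;> positivity) (hn i))
      Finset.univ_nonempty) (by
      have h1 : 4 * τ₀ ^ 2 * ω ^ 2 * ∑ i, a i / (τ₀ ^ 2 * (c - d i)) =
          4 * ω ^ 2 * ∑ i, a i / (c - d i) := by
        rw [Finset.mul_sum, Finset.mul_sum]
        refine Finset.sum_congr rfl fun i _ => ?_
        rw [← div_div, div_div, mul_div_assoc', mul_div_assoc', mul_comm (τ₀ ^ 2) (c - d i),
          ← div_div, div_eq_iff hτ2.ne']
        ring
      -- Here c - b > 3/2. The sum to be bounded is then at most 1 - 16ε² + 4·4·(2/3)ε², which is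
      -- below 1 + 4ε².
      have h2 : ∀ b : ℝ, b ≤ 5 / 2 → ε ^ 2 / (c - b) ≤ 2 / 3 * ε ^ 2 := by
        intro b hb
        rw [div_le_iff₀ (by linarith)]
        nlinarith
      have h3 : 1 / c = (1 - 16 * ε ^ 2) / 4 := by
        rw [hε2]; ring
      rw [h1, hω2, mul_one_div, div_mul_eq_mul_div, div_lt_one hpos, Fin.sum_univ_five]
      have h4 := h2 (3 / 4) (by norm_num)
      have h5 := h2 (9 / 4) (by norm_num)
      have h6 := h2 (1 / 2) (by norm_num)
      have h7 := h2 (5 / 2) (by norm_num)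
      have h8 : 1 / (c - 0) = (1 - 16 * ε ^ 2) / 4 := by rw [sub_zero, h3]
      change 4 * (1 / (c - 0) + ε ^ 2 / (c - 3 / 4) + ε ^ 2 / (c - 9 / 4) + ε ^ 2 / (c - 1 / 2) +
        ε ^ 2 / (c - 5 / 2)) < 1 + 4 * ε ^ 2
      rw [h8]
      nlinarith [sq_pos_of_pos hε])
  obtain ⟨r1, r2, r3⟩ := wildCols_relations hx hy
  have hV0 : V 0 * (V 0)ᴴ =
      (wildCols₁ x y * (wildCols₁ x y)ᴴ).map (algebraMap ℂ FreeGroupCStar) := by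
    change (wildCols₁ x y).map (algebraMap ℂ FreeGroupCStar) *
      ((wildCols₁ x y).map (algebraMap ℂ FreeGroupCStar))ᴴ = _
    rw [map_algebraMap_conjTranspose, ← Matrix.map_mul]
  have hV1 : V 1 * (V 1)ᴴ =
      (wildCols₂ x y * (wildCols₂ x y)ᴴ).map (algebraMap ℂ FreeGroupCStar) := by
    change (wildCols₂ x y).map (algebraMap ℂ FreeGroupCStar) *
      ((wildCols₂ x y).map (algebraMap ℂ FreeGroupCStar))ᴴ = _
    rw [map_algebraMap_conjTranspose, ← Matrix.map_mul]
  have hV2 : V 2 * (V 2)ᴴ =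
      ((ω ^ 2 : ℝ) : ℂ) • (graphCol ε freeU freeV * (graphCol ε freeU freeV)ᴴ) := by
    change (ω : ℂ) • graphCol ε freeU freeV * ((ω : ℂ) • graphCol ε freeU freeV)ᴴ = _
    rw [Matrix.conjTranspose_smul, Matrix.smul_mul, Matrix.mul_smul, smul_smul]
    simp [pow_two]
  refine isStarWild_of_generating ?_ V D D' ?_ ?_ hD' 0 ?_
  · intro j
    fin_cases j <;> simp [exampleTau, h0.ne']
  · intro k
    fin_cases k
    · change ((wildCols₁ x y).map (algebraMap ℂ FreeGroupCStar))ᴴ *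
        (wildCols₁ x y).map (algebraMap ℂ FreeGroupCStar) = 1
      rw [map_algebraMap_conjTranspose, ← Matrix.map_mul, r1]
      simp
    · change ((wildCols₂ x y).map (algebraMap ℂ FreeGroupCStar))ᴴ *
        (wildCols₂ x y).map (algebraMap ℂ FreeGroupCStar) = 1
      rw [map_algebraMap_conjTranspose, ← Matrix.map_mul, r2]
      simp
    · change ((ω : ℂ) • graphCol ε freeU freeV)ᴴ * ((ω : ℂ) • graphCol ε freeU freeV) = 1
      rw [Matrix.conjTranspose_smul, Matrix.smul_mul, Matrix.mul_smul,
        graphCol_conjTranspose_mul ε freeU_mem_unitary freeV_mem_unitary, smul_smul, smul_smul]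
      have : star (ω : ℂ) * ω * ((1 + 4 * ε ^ 2 : ℝ) : ℂ) = 1 := by
        simp only [RCLike.star_def, Complex.conj_ofReal]
        norm_cast
        rw [← pow_two, hω2]
        field_simp
      rw [this, one_smul]
  · have h1 := congrArg (fun M => M.map (algebraMap ℂ FreeGroupCStar)) r3
    rw [Matrix.map_add _ (map_add (algebraMap ℂ FreeGroupCStar)), Matrix.map_smul _ _
      (fun z => by rw [smul_eq_mul, map_mul, Algebra.smul_def]), Matrix.diagonal_map (map_zero _)]
      at h1
    rw [hD, Fin.sum_univ_three, Fin.sum_univ_one, hV0, hV1, hV2]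
    -- This uses τ₀² c = 1 - 16τ₀² and the diagonal form of R₁ + 2R₂; the number 16 is the sum 1 + 2
    -- + 4 + 9 of the relative squared weights.
    have h2 : (diagonal fun i => ((τ₀ ^ 2 * (c - d i) : ℝ) : ℂ) • (1 : FreeGroupCStar)) =
        ((1 - 16 * τ₀ ^ 2 : ℝ) : ℂ) • 1 - ((τ₀ ^ 2 : ℝ) : ℂ) •
          ((wildCols₁ x y * (wildCols₁ x y)ᴴ).map (algebraMap ℂ FreeGroupCStar) +
          (2 : ℂ) • (wildCols₂ x y * (wildCols₂ x y)ᴴ).map (algebraMap ℂ FreeGroupCStar)) := by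
      rw [h1]
      ext i j
      by_cases hij : i = j
      · subst hij
        have hd : (![0, 3 / 4, 9 / 4, 1 / 2, 5 / 2] : Fin 5 → ℂ) i = ((d i : ℝ) : ℂ) := by
          fin_cases i <;> simp [d]
        simp only [Matrix.diagonal_apply_eq, Matrix.sub_apply, Matrix.smul_apply,
          Matrix.one_apply_eq, Function.comp, hd, Algebra.algebraMap_eq_smul_one, smul_smul,
          ← sub_smul, ← Complex.ofReal_mul, ← Complex.ofReal_sub]
        rw [mul_sub, hcτ]
      · simp [hij]
    rw [h2]
    have t0 : exampleTau τ₀ (Fin.castAdd 1 0) ^ 2 = τ₀ ^ 2 := rfl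
    have t1 : exampleTau τ₀ (Fin.castAdd 1 1) ^ 2 = 2 * τ₀ ^ 2 := by
      change (√2 * τ₀) ^ 2 = _
      rw [mul_pow, Real.sq_sqrt (by norm_num)]
    have t2 : exampleTau τ₀ (Fin.castAdd 1 2) ^ 2 = 4 * τ₀ ^ 2 := by
      change (2 * τ₀) ^ 2 = _
      ring
    have t3 : exampleTau τ₀ (Fin.natAdd 3 0) ^ 2 = 9 * τ₀ ^ 2 := by
      change (3 * τ₀) ^ 2 = _
      ring
    rw [t0, t1, t2, t3]
    push_cast
    module
  · intro 𝒯 hV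
    let 𝒯c : Subalgebra ℂ (Matrix (Fin 5) (Fin 5) ℂ) :=
      𝒯.comap (Algebra.ofId ℂ FreeGroupCStar).mapMatrix
    have m0 := hV 0
    have m1 := hV 1
    rw [hV0] at m0
    rw [hV1] at m1
    obtain ⟨s0, s12, s21, s34, s43⟩ := single_mem_of_wildCols_mem hx hy 𝒯c
      m0 m1
    have hs : ∀ i j, Matrix.single i j (1 : ℂ) ∈ 𝒯c →
        Matrix.single i j (1 : FreeGroupCStar) ∈ 𝒯 := by
      intro i j hij
      have h1 : (Algebra.ofId ℂ FreeGroupCStar).mapMatrix (Matrix.single i j (1 : ℂ)) ∈ 𝒯 := hij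
      simpa [Matrix.map_single] using h1
    refine single_graphCol_mem hε.ne' freeU_mem_unitary freeV_mem_unitary 𝒯
      (fun i => hs i i (s0 i)) (hs _ _ s12) (hs _ _ s21) (hs _ _ s34) (hs _ _ s43) ?_
    have h1 := 𝒯.smul_mem (hV 2) ((ω ^ 2 : ℝ) : ℂ)⁻¹
    rwa [hV2, smul_smul, inv_mul_cancel₀ (by exact_mod_cast (pow_pos hω 2).ne'), one_smul] at h1

end SubspaceProblem

end

noncomputable section

namespace SubspaceProblem

open Vertex

/-! ### Calculus of the blocks of B. -/

section StarBlocks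

variable {m r : ℕ} {K : Type*} [NormedAddCommGroup K] [InnerProductSpace ℂ K]
  {τ : Fin (m + r) → ℝ} {Q : Fin m → K →L[ℂ] K}

theorem starBlocks_self (i : Vertex m r) : starBlocks τ Q i i = 1 := by
  rcases i with _ | ⟨k, _ | _⟩ | j <;> simp [starBlocks]

theorem starBlocks_centre_left {i : Vertex m r} (hi : i ≠ centre) :
    starBlocks τ Q centre i = ((weight τ i : ℝ) : ℂ) • 1 := by
  rcases i with _ | ⟨k, _ | _⟩ | j <;> simp_all [starBlocks]

theorem starBlocks_centre_right {i : Vertex m r} (hi : i ≠ centre) :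
    starBlocks τ Q i centre = ((weight τ i : ℝ) : ℂ) • 1 := by
  rcases i with _ | ⟨k, _ | _⟩ | j <;> simp_all [starBlocks]

theorem starBlocks_pair (k : Fin m) (b : Bool) :
    starBlocks (r := r) τ Q (paired k b) (paired k !b) = Q k := by
  cases b <;> simp [starBlocks]

theorem starBlocks_of_not_isPair {i j : Vertex m r} (hi : i ≠ centre)
    (hj : j ≠ centre) (hij : i ≠ j) (h : ¬ IsPair i j) : starBlocks τ Q i j = 0 := by
  rcases i with _ | ⟨k, _ | _⟩ | l <;> rcases j with _ | ⟨k', _ | _⟩ | l' <;>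
    simp_all [starBlocks, IsPair, eq_comm]

theorem weight_ne_zero (hτ : ∀ j, τ j ≠ 0) (i : Vertex m r) : weight τ i ≠ 0 := by
  rcases i with _ | _ | _ <;> simp [weight, hτ]

/-- Any property which holds for `0`, `1`, `Q_k` and is stable under scalar multiples holds for the
blocks. -/
theorem starBlocks_induction {p : (K →L[ℂ] K) → Prop} (h0 : p 0) (h1 : p 1)
    (hs : ∀ (c : ℝ), p ((c : ℂ) • 1)) (hQ : ∀ k, p (Q k)) (i j : Vertex m r) :
    p (starBlocks τ Q i j) := by
  rcases i with _ | ⟨k, _ | _⟩ | l <;> rcases j with _ | ⟨k', _ | _⟩ | l' <;>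
    simp only [starBlocks] <;> (try split_ifs) <;> first | exact h0 | exact h1 | exact hs _ | exact hQ _

end StarBlocks

section IsStarProjection

variable {K : Type*} [NormedAddCommGroup K] [InnerProductSpace ℂ K] [CompleteSpace K]
  {Q : K →L[ℂ] K}

theorem _root_.IsStarProjection.apply_apply (h : IsStarProjection Q) (x : K) : Q (Q x) = Q x :=
  congrArg (fun F : K →L[ℂ] K => F x) h.isIdempotentElem

theorem _root_.IsStarProjection.inner_left (h : IsStarProjection Q) (x y : K) :
    inner ℂ (Q x) y = inner ℂ x (Q y) := by
  have := h.isSelfAdjoint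
  rw [ContinuousLinearMap.isSelfAdjoint_iff'] at this
  conv_lhs => rw [← this]
  rw [ContinuousLinearMap.adjoint_inner_left]

end IsStarProjection

/-! ### Systems given by isometries with prescribed Gram operator. -/

section Realization

variable {m r : ℕ} {K : Type v} [NormedAddCommGroup K] [InnerProductSpace ℂ K]

/-- The sum of the maps `g i`. -/
def synth {V : Type w} [Fintype V] {E : Type*} [AddCommGroup E] [Module ℂ E] [TopologicalSpace E]
    (g : V → K →L[ℂ] E) : (V → K) →ₗ[ℂ] E :=
  ∑ i, (g i).toLinearMap ∘ₗ LinearMap.proj i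

theorem synth_apply {V : Type w} [Fintype V] {E : Type*} [AddCommGroup E] [Module ℂ E]
    [TopologicalSpace E] (g : V → K →L[ℂ] E) (x : V → K) : synth g x = ∑ i, g i (x i) := by
  simp [synth]

theorem synth_single {V : Type w} [Fintype V] [DecidableEq V] {E : Type*} [AddCommGroup E]
    [Module ℂ E] [TopologicalSpace E] (g : V → K →L[ℂ] E) (i : V) (x : K) :
    synth g (Pi.single i x) = g i x := by
  rw [synth_apply, Finset.sum_eq_single i] <;> simp +contextual

/-- Maps from a space `K` onto the subspaces of `S` with Gram operator `B(Q_1, …, Q_m)`. -/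
structure IsRealization (S : SubspaceSystem.{u} (Vertex m r)) (τ : Fin (m + r) → ℝ)
    (Q : Fin m → K →L[ℂ] K) (g : Vertex m r → K →L[ℂ] S.carrier) : Prop where
  mem_iff : ∀ i x, x ∈ S.space i ↔ ∃ y, g i y = x
  gram : ∀ i j x y, inner ℂ (g i x) (g j y) = inner ℂ (starBlocks τ Q j i x) y
  dense : DenseRange (synth g)

namespace IsRealization

variable {S : SubspaceSystem.{u} (Vertex m r)} {τ : Fin (m + r) → ℝ}
  {Q : Fin m → K →L[ℂ] K} {g : Vertex m r → K →L[ℂ] S.carrier}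

theorem ext_of_dense (h : DenseRange (synth g)) {E : Type*} [NormedAddCommGroup E]
    [InnerProductSpace ℂ E] {F F' : S.carrier →L[ℂ] E} (hF : ∀ i x, F (g i x) = F' (g i x)) :
    F = F' := by
  refine DFunLike.coe_injective (h.equalizer F.continuous F'.continuous (funext fun x => ?_))
  simp [synth_apply, hF]

theorem norm_map (h : IsRealization S τ Q g) (i : Vertex m r) (x : K) : ‖g i x‖ = ‖x‖ := by
  have h1 := h.gram i i x x
  rw [starBlocks_self, one_apply_eq_self, inner_self_eq_norm_sq_to_K,
    inner_self_eq_norm_sq_to_K] at h1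
  have h2 : ‖g i x‖ ^ 2 = ‖x‖ ^ 2 := by exact_mod_cast h1
  exact (pow_left_inj₀ (norm_nonneg _) (norm_nonneg _) two_ne_zero).1 h2

theorem injective (h : IsRealization S τ Q g) (i : Vertex m r) : Function.Injective (g i) :=
  (injective_iff_map_eq_zero (g i)).2 fun x hx => by
    rw [← norm_eq_zero, ← h.norm_map i, hx, norm_zero]

/-- The difference g_j x - g_i B_ij x is orthogonal to the range of g_i, by the Gram relation. All
identities between projections thereby become identities between blocks. -/
theorem proj_apply (h : IsRealization S τ Q g) (i j : Vertex m r) (x : K) :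
    S.proj i (g j x) = g i (starBlocks τ Q i j x) := by
  refine (Submodule.eq_starProjection_of_mem_of_inner_eq_zero ((h.mem_iff i _).2 ⟨_, rfl⟩) ?_)
  intro w hw
  obtain ⟨y, rfl⟩ := (h.mem_iff i w).1 hw
  rw [inner_sub_left, h.gram, h.gram, starBlocks_self, one_apply_eq_self, sub_self]

theorem proj_centre_apply (h : IsRealization S τ Q g) {i : Vertex m r} (hi : i ≠ centre) (x : K) :
    S.proj i (g centre x) = ((weight τ i : ℝ) : ℂ) • g i x := by
  rw [h.proj_apply, starBlocks_centre_right hi]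
  simp

/-- As the weights do not vanish, the central map and the projections determine all the maps;
operators compatible with both need to be examined on the centre only. -/
theorem apply_eq_smul_proj (h : IsRealization S τ Q g) (hτ : ∀ j, τ j ≠ 0) {i : Vertex m r}
    (hi : i ≠ centre) (x : K) :
    g i x = ((weight τ i : ℝ) : ℂ)⁻¹ • S.proj i (g centre x) := by
  rw [h.proj_centre_apply hi, inv_smul_smul₀]
  exact_mod_cast weight_ne_zero hτ i

/-- By the Gram relation and Q² = Q, the squared norm of the difference is ‖Qx‖² - ‖Qx‖² - ‖Qx‖² +
‖Qx‖² = 0. -/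
theorem apply_pair [CompleteSpace K] (h : IsRealization S τ Q g) (hQ : ∀ k, IsStarProjection (Q k))
    (k : Fin m) (x : K) : g (paired k false) (Q k x) = g (paired k true) (Q k x) := by
  rw [← sub_eq_zero, ← inner_self_eq_zero (𝕜 := ℂ)]
  simp only [inner_sub_left, inner_sub_right, h.gram]
  have h1 : starBlocks (r := r) τ Q (paired k false) (paired k true) = Q k :=
    starBlocks_pair k false
  have h2 : starBlocks (r := r) τ Q (paired k true) (paired k false) = Q k :=
    starBlocks_pair k true
  simp [h1, h2, starBlocks_self, (hQ k).apply_apply]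

theorem satisfies [CompleteSpace K] (h : IsRealization S τ Q g)
    (hQ : ∀ k, IsStarProjection (Q k)) : S.Satisfies τ where
  ang_left i hi := ext_of_dense h.dense fun j x => by
    simp only [ContinuousLinearMap.mul_apply, ContinuousLinearMap.smul_apply, h.proj_apply,
      starBlocks_centre_left hi, starBlocks_centre_right hi, one_apply_eq_self, map_smul,
      smul_smul, pow_two, Complex.ofReal_mul]
  ang_right i hi := ext_of_dense h.dense fun j x => by
    simp only [ContinuousLinearMap.mul_apply, ContinuousLinearMap.smul_apply, h.proj_apply,
      starBlocks_centre_left hi, starBlocks_centre_right hi, one_apply_eq_self, map_smul,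
      smul_smul, pow_two, Complex.ofReal_mul]
  com i j hij := ext_of_dense h.dense fun l x => by
    -- Q_k erases the difference between the rows of the two vertices of the pair, and `apply_pair`
    -- exchanges the two maps on the range of Q_k.
    have key : ∀ k, g (paired k false) (Q k (starBlocks τ Q (paired k true) l x)) =
        g (paired k true) (Q k (starBlocks τ Q (paired k false) l x)) := by
      intro k
      have h3 : Q k (starBlocks τ Q (paired k true) l x) =
          Q k (starBlocks τ Q (paired k false) l x) := by
        rcases l with _ | ⟨k', _ | _⟩ | l'
        · rw [starBlocks_centre_right (by simp), starBlocks_centre_right (by simp)]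
          rfl
        · by_cases hk : k = k' <;> simp [starBlocks, hk, (hQ _).apply_apply]
        · by_cases hk : k = k' <;> simp [starBlocks, hk, (hQ _).apply_apply]
        · simp [starBlocks]
      rw [h3, h.apply_pair hQ]
    obtain ⟨k, ⟨rfl, rfl⟩ | ⟨rfl, rfl⟩⟩ := hij
    · simpa [h.proj_apply, starBlocks] using key k
    · simpa [h.proj_apply, starBlocks] using (key k).symm
  ort i j hi hj hij hp := ext_of_dense h.dense fun l x => by
    simp [h.proj_apply, starBlocks_of_not_isPair hi hj hij hp]

/-- An operator A in the commutant preserves the central subspace and induces A₀ on K. Then A g_i =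
g_i A₀ for all i, since g_i comes from g_c through a projection, and A₀ commutes with Q_k because
Q_k is read off from P_f g_t, f and t being the vertices of the k-th pair. So A₀, and by density A,
is scalar. -/
theorem isIrreducible [CompleteSpace K] (h : IsRealization S τ Q g) (hτ : ∀ j, τ j ≠ 0)
    (hirr : ∀ A : K →L[ℂ] K, (∀ k x, A (Q k x) = Q k (A x)) →
      ∃ c : ℂ, A = c • (1 : K →L[ℂ] K)) : S.IsIrreducible := by
  intro A hA
  have hA' : ∀ i x, A (S.proj i x) = S.proj i (A x) := fun i x =>
    congrArg (fun F : S.carrier →L[ℂ] S.carrier => F x) (hA i)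
  let A₀ : K →L[ℂ] K := (g centre).adjoint ∘L A ∘L g centre
  have hcc : ∀ x, (g centre).adjoint (g centre x) = x := fun x =>
    ext_inner_right ℂ fun y => by
      rw [ContinuousLinearMap.adjoint_inner_left, h.gram, starBlocks_self,
        one_apply_eq_self]
  have hc : ∀ x, A (g centre x) = g centre (A₀ x) := by
    intro x
    have h1 : A (g centre x) ∈ S.space centre := by
      have h2 := hA' centre (g centre x)
      rw [h.proj_apply, starBlocks_self, one_apply_eq_self] at h2
      rw [h2]
      exact Submodule.starProjection_apply_mem _ _
    obtain ⟨y, hy⟩ := (h.mem_iff _ _).1 h1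
    simp only [A₀, ContinuousLinearMap.comp_apply]
    rw [← hy, hcc]
  have hi : ∀ i x, A (g i x) = g i (A₀ x) := by
    intro i x
    by_cases hic : i = centre
    · subst hic
      exact hc x
    · rw [h.apply_eq_smul_proj hτ hic, map_smul, hA', hc, h.apply_eq_smul_proj hτ hic]
  obtain ⟨c, hc'⟩ := hirr A₀ fun k x => h.injective (paired k false) (by
    have e : ∀ y, g (paired k false) (Q k y) = S.proj (paired k false) (g (paired k true) y) := by
      intro y
      simp [h.proj_apply, starBlocks]
    rw [← hi, e, hA', hi, ← e])
  refine ⟨c, ext_of_dense h.dense fun i x => ?_⟩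
  rw [hi, hc']
  simp

variable {K' : Type*} [NormedAddCommGroup K'] [InnerProductSpace ℂ K']
  {S' : SubspaceSystem (Vertex m r)} {Q' : Fin m → K' →L[ℂ] K'}
  {g' : Vertex m r → K' →L[ℂ] S'.carrier}

theorem map_starBlocks (W : K ≃ₗᵢ[ℂ] K') (hW : ∀ k x, W (Q k x) = Q' k (W x)) (i j : Vertex m r)
    (x : K) : W (starBlocks τ Q i j x) = starBlocks τ Q' i j (W x) := by
  rcases i with _ | ⟨k, _ | _⟩ | l <;> rcases j with _ | ⟨k', _ | _⟩ | l' <;>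
    simp only [starBlocks] <;> (try split_ifs) <;>
    simp only [ContinuousLinearMap.smul_apply, one_apply_eq_self,
      ContinuousLinearMap.zero_apply, map_smul, map_zero, hW]

theorem inner_synth (h : IsRealization S τ Q g) (x y : Vertex m r → K) :
    inner ℂ (synth g x) (synth g y) = ∑ i, ∑ j, inner ℂ (starBlocks τ Q j i (x i)) (y j) := by
  simp only [synth_apply, sum_inner, inner_sum, h.gram]
  exact Finset.sum_comm

/-- Realizations with unitarily equivalent data give unitarily equivalent systems. -/
theorem unitarilyEquiv (h : IsRealization S τ Q g) (h' : IsRealization S' τ Q' g')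
    (W : K ≃ₗᵢ[ℂ] K') (hW : ∀ k x, W (Q k x) = Q' k (W x)) : S.UnitarilyEquiv S' := by
  let F : (Vertex m r → K) ≃ₗ[ℂ] (Vertex m r → K') := LinearEquiv.piCongrRight fun _ => W.toLinearEquiv
  have hF : ∀ x i, F x i = W (x i) := fun _ _ => rfl
  -- Norms of synthesized vectors depend on the Gram blocks only, and `W` intertwines these; hence
  -- the correspondence extends to a unitary.
  have hnorm : ∀ x, ‖synth g' (F x)‖ = ‖synth g x‖ := by
    intro x
    rw [@norm_eq_sqrt_re_inner ℂ, @norm_eq_sqrt_re_inner ℂ, h.inner_synth, h'.inner_synth]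
    simp only [hF, ← map_starBlocks W hW, W.inner_map_map]
  let U := F.extendOfIsometry (synth g) (synth g') h.dense h'.dense hnorm
  have hU : ∀ i x, U (g i x) = g' i (W x) := by
    intro i x
    rw [← synth_single g, ← synth_single g']
    simp only [U, LinearEquiv.extendOfIsometry_eq]
    congr 1
    ext j
    rw [hF]
    by_cases hj : j = i
    · subst hj; simp
    · simp [hj]
  refine ⟨U, fun i => le_antisymm ?_ ?_⟩
  · rintro _ ⟨x, hx, rfl⟩
    obtain ⟨y, rfl⟩ := (h.mem_iff i x).1 hx
    exact (h'.mem_iff i _).2 ⟨W y, (hU i y).symm⟩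
  · intro x hx
    obtain ⟨y, rfl⟩ := (h'.mem_iff i x).1 hx
    exact ⟨g i (W.symm y), (h.mem_iff i _).2 ⟨_, rfl⟩, by
      simpa using hU i (W.symm y)⟩

/-- Unitarily equivalent systems have unitarily equivalent data. -/
theorem exists_of_unitarilyEquiv (h : IsRealization S τ Q g) (h' : IsRealization S' τ Q' g')
    (hτ : ∀ j, τ j ≠ 0) (hU : S.UnitarilyEquiv S') :
    ∃ W : K ≃ₗᵢ[ℂ] K', ∀ k x, W (Q k x) = Q' k (W x) := by
  obtain ⟨U, hU⟩ := hU
  have hP : ∀ i x, U (S.proj i x) = S'.proj i (U x) := by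
    intro i x
    have h1 := Submodule.starProjection_map_apply U (S.space i) (U x)
    rw [U.symm_apply_apply] at h1
    simp only [hU] at h1
    exact h1.symm
  -- The unitary between the systems maps central subspace onto central subspace; read through the
  -- isometries `g centre`, `g' centre`, it is the required `W`.
  have h1 : ∀ x, ∃ y, g' centre y = U (g centre x) := fun x =>
    (h'.mem_iff _ _).1 (hU centre ▸ ⟨g centre x, (h.mem_iff _ _).2 ⟨x, rfl⟩, rfl⟩)
  choose w hw using h1
  let W₀ : K →ₗᵢ[ℂ] K' :=
    { toFun := w
      map_add' := fun x y => h'.injective centre (by simp [hw])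
      map_smul' := fun c x => h'.injective centre (by simp [hw])
      norm_map' := fun x => by
        change ‖w x‖ = ‖x‖
        rw [← h'.norm_map centre, hw, U.norm_map, h.norm_map] }
  have hsurj : Function.Surjective W₀ := by
    intro y
    have h2 : g' centre y ∈ S'.space centre := (h'.mem_iff _ _).2 ⟨y, rfl⟩
    rw [← hU centre] at h2
    obtain ⟨z, hz, hz'⟩ := h2
    obtain ⟨x, rfl⟩ := (h.mem_iff _ _).1 hz
    exact ⟨x, h'.injective centre ((hw x).trans hz')⟩
  let W := LinearIsometryEquiv.ofSurjective W₀ hsurj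
  have hWc : ∀ x, g' centre (W x) = U (g centre x) := hw
  have hWi : ∀ i x, g' i (W x) = U (g i x) := by
    intro i x
    by_cases hic : i = centre
    · subst hic
      exact hWc x
    · rw [h.apply_eq_smul_proj hτ hic, map_smul, hP, ← hWc, h'.apply_eq_smul_proj hτ hic]
  refine ⟨W, fun k x => h'.injective (paired k false) ?_⟩
  have e : ∀ y, g (paired k false) (Q k y) = S.proj (paired k false) (g (paired k true) y) := by
    intro y
    simp [h.proj_apply, starBlocks]
  have e' : ∀ y, g' (paired k false) (Q' k y) = S'.proj (paired k false) (g' (paired k true) y) := by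
    intro y
    simp [h'.proj_apply, starBlocks]
  rw [hWi, e, hP, ← hWi, ← e']

end IsRealization

end Realization

end SubspaceProblem

end

noncomputable section

namespace SubspaceProblem

open Vertex

/-! ### Every system satisfying the relations has a realization on its central subspace. -/

section Existence

variable {m r : ℕ} {S : SubspaceSystem.{u} (Vertex m r)} {τ : Fin (m + r) → ℝ}

/-- The normalized restriction of `P_i` to the central subspace. -/
def normalizedProj (S : SubspaceSystem.{u} (Vertex m r)) (τ : Fin (m + r) → ℝ) (i : Vertex m r) :
    S.space centre →L[ℂ] S.carrier :=
  ((weight τ i : ℝ) : ℂ)⁻¹ • (S.proj i ∘L (S.space centre).subtypeL)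

/-- The operators `Q_k` on the central subspace. -/
def pairOperator (S : SubspaceSystem.{u} (Vertex m r)) (τ : Fin (m + r) → ℝ) (k : Fin m) :
    S.space centre →L[ℂ] S.space centre :=
  (normalizedProj S τ (paired k false)).adjoint ∘L normalizedProj S τ (paired k true)

theorem proj_mul_self (S : SubspaceSystem.{u} (Vertex m r)) (i : Vertex m r) :
    S.proj i * S.proj i = S.proj i :=
  (S.space i).isIdempotentElem_starProjection

theorem proj_inner_left (S : SubspaceSystem.{u} (Vertex m r)) (i : Vertex m r) (x y : S.carrier) :
    inner ℂ (S.proj i x) y = inner ℂ x (S.proj i y) :=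
  Submodule.inner_starProjection_left_eq_right _ x y

theorem proj_adjoint (S : SubspaceSystem.{u} (Vertex m r)) (i : Vertex m r) :
    (S.proj i).adjoint = S.proj i :=
  ContinuousLinearMap.isSelfAdjoint_iff'.1 (isSelfAdjoint_starProjection _)

theorem subtypeL_comp_adjoint (S : SubspaceSystem.{u} (Vertex m r)) :
    (S.space centre).subtypeL ∘L (S.space centre).subtypeL.adjoint = S.proj centre := by
  rw [Submodule.adjoint_subtypeL]
  rfl

theorem normalizedProj_centre : normalizedProj S τ centre = (S.space centre).subtypeL := by
  ext x
  simp [normalizedProj, weight, SubspaceSystem.proj]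

theorem normalizedProj_adjoint (i : Vertex m r) : (normalizedProj S τ i).adjoint =
    ((weight τ i : ℝ) : ℂ)⁻¹ • ((S.space centre).subtypeL.adjoint ∘L S.proj i) := by
  rw [normalizedProj, map_smulₛₗ, ContinuousLinearMap.adjoint_comp, proj_adjoint]
  simp

variable (hS : S.Satisfies τ) (hτ : ∀ j, τ j ≠ 0)
include hS hτ

/-- For i ≠ c (the centre) this is the relation P_i P_c P_i = t_i² P_i divided by t_i². It is what
makes the normalized restriction onto the i-th subspace surjective. -/
theorem normalizedProj_comp_adjoint (i : Vertex m r) :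
    normalizedProj S τ i ∘L (normalizedProj S τ i).adjoint = S.proj i := by
  by_cases hi : i = centre
  · subst hi
    rw [normalizedProj_centre, subtypeL_comp_adjoint]
  · have hw : ((weight τ i : ℝ) : ℂ) ≠ 0 := mod_cast weight_ne_zero hτ i
    have h := hS.ang_right i hi
    simp only [ContinuousLinearMap.mul_def] at h
    rw [normalizedProj_adjoint, normalizedProj, ContinuousLinearMap.smul_comp,
      ContinuousLinearMap.comp_smul, smul_smul, ← ContinuousLinearMap.comp_assoc,
      ContinuousLinearMap.comp_assoc (S.proj i), subtypeL_comp_adjoint, h, smul_smul]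
    have : ((weight τ i : ℝ) : ℂ)⁻¹ * ((weight τ i : ℝ) : ℂ)⁻¹ * ((weight τ i ^ 2 : ℝ) : ℂ) = 1 := by
      push_cast; field_simp
    rw [this, one_smul]

theorem normalizedProj_mem_iff (i : Vertex m r) (x : S.carrier) :
    x ∈ S.space i ↔ ∃ y, normalizedProj S τ i y = x := by
  constructor
  · intro hx
    refine ⟨(normalizedProj S τ i).adjoint x, ?_⟩
    have h := congrArg (fun F => F x) (normalizedProj_comp_adjoint hS hτ i)
    exact h.trans (Submodule.starProjection_eq_self_iff.2 hx)
  · rintro ⟨y, rfl⟩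
    exact (S.space i).smul_mem _ (Submodule.starProjection_apply_mem _ _)

omit hS hτ in
theorem inner_normalizedProj (i j : Vertex m r) (x y : S.space centre) :
    inner ℂ (normalizedProj S τ i x) (normalizedProj S τ j y) =
      ((weight τ i : ℝ) : ℂ)⁻¹ * ((weight τ j : ℝ) : ℂ)⁻¹ *
        inner ℂ (x : S.carrier) (S.proj i (S.proj j y)) := by
  simp only [normalizedProj, ContinuousLinearMap.smul_apply, ContinuousLinearMap.comp_apply,
    inner_smul_left, inner_smul_right, map_inv₀, Complex.conj_ofReal, proj_inner_left, mul_assoc,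
    Submodule.subtypeL_apply]
  ring

omit hS hτ in
theorem proj_centre_coe (x : S.space centre) : S.proj centre (x : S.carrier) = x :=
  Submodule.starProjection_eq_self_iff.2 x.2

omit hτ in
theorem inner_proj_coe {i : Vertex m r} (hi : i ≠ centre) (x y : S.space centre) :
    inner ℂ (x : S.carrier) (S.proj i y) = ((weight τ i ^ 2 : ℝ) : ℂ) * inner ℂ x y := by
  have h := congrArg (fun F => F (y : S.carrier)) (hS.ang_left i hi)
  simp only [ContinuousLinearMap.mul_apply, ContinuousLinearMap.smul_apply, proj_centre_coe] at h
  calc inner ℂ (x : S.carrier) (S.proj i y)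
      = inner ℂ (S.proj centre (x : S.carrier)) (S.proj i y) := by rw [proj_centre_coe]
    _ = inner ℂ (x : S.carrier) (S.proj centre (S.proj i y)) := proj_inner_left _ _ _ _
    _ = _ := by rw [h, inner_smul_right]; rfl

omit hS hτ in
theorem proj_proj (i : Vertex m r) (x : S.carrier) : S.proj i (S.proj i x) = S.proj i x :=
  congrArg (fun F : S.carrier →L[ℂ] S.carrier => F x) (proj_mul_self S i)

omit hτ in
theorem proj_comm {i j : Vertex m r} (h : IsPair i j) (x : S.carrier) :
    S.proj i (S.proj j x) = S.proj j (S.proj i x) :=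
  congrArg (fun F : S.carrier →L[ℂ] S.carrier => F x) (hS.com i j h)

omit hτ in
-- The commutation of the two projections of a pair is exactly the self-adjointness of the block
-- between them.
theorem inner_normalizedProj_pair (k : Fin m) (x y : S.space centre) :
    inner ℂ (normalizedProj S τ (paired k true) x) (normalizedProj S τ (paired k false) y) =
    inner ℂ (normalizedProj S τ (paired k false) x) (normalizedProj S τ (paired k true) y) := by
  rw [inner_normalizedProj, inner_normalizedProj, proj_comm hS ⟨k, Or.inr ⟨rfl, rfl⟩⟩]
  rfl

omit hτ in
theorem pairOperator_eq (k : Fin m) : pairOperator S τ k =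
    (normalizedProj S τ (paired k true)).adjoint ∘L normalizedProj S τ (paired k false) := by
  ext1 x
  refine ext_inner_right ℂ fun y => ?_
  simp only [pairOperator, ContinuousLinearMap.comp_apply, ContinuousLinearMap.adjoint_inner_left]
  exact inner_normalizedProj_pair hS k x y

/-- For Q = g_f* g_t = g_t* g_f one has Q² = g_f* P_t g_f. By commutation P_t g_f = P_f g_t, and
g_f* P_f = g_f*, whence Q² = Q. -/
theorem isStarProjection_pairOperator (k : Fin m) : IsStarProjection (pairOperator S τ k) where
  isSelfAdjoint := by
    rw [ContinuousLinearMap.isSelfAdjoint_iff', pairOperator_eq hS,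
      ContinuousLinearMap.adjoint_comp, ContinuousLinearMap.adjoint_adjoint, ← pairOperator_eq hS]
    rfl
  isIdempotentElem := by
    have h1 : pairOperator S τ k * pairOperator S τ k =
        (normalizedProj S τ (paired k false)).adjoint ∘L S.proj (paired k true) ∘L
          normalizedProj S τ (paired k false) := by
      rw [← normalizedProj_comp_adjoint hS hτ]
      conv_lhs =>
        enter [2]
        rw [pairOperator_eq hS k]
      rfl
    rw [IsIdempotentElem, h1]
    ext1 x
    refine ext_inner_right ℂ fun y => ?_
    simp only [pairOperator, ContinuousLinearMap.comp_apply, ContinuousLinearMap.adjoint_inner_left]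
    have e : S.proj (paired k true) (normalizedProj S τ (paired k false) x) =
        S.proj (paired k false) (normalizedProj S τ (paired k true) x) := by
      simp only [normalizedProj, ContinuousLinearMap.smul_apply, ContinuousLinearMap.comp_apply,
        map_smul, Submodule.subtypeL_apply]
      rw [proj_comm hS ⟨k, Or.inr ⟨rfl, rfl⟩⟩]
      rfl
    have e' : S.proj (paired k false) (normalizedProj S τ (paired k false) y) =
        normalizedProj S τ (paired k false) y := by
      simp only [normalizedProj, ContinuousLinearMap.smul_apply, ContinuousLinearMap.comp_apply,
        map_smul, proj_proj]
    rw [e, proj_inner_left, e']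

theorem normalizedProj_gram (i j : Vertex m r) (x y : S.space centre) :
    inner ℂ (normalizedProj S τ i x) (normalizedProj S τ j y) =
      inner ℂ (starBlocks τ (pairOperator S τ) j i x) y := by
  by_cases hij : i = j
  · subst hij
    rw [starBlocks_self, one_apply_eq_self, inner_normalizedProj, proj_proj]
    by_cases hi : i = centre
    · subst hi
      simp [weight, proj_centre_coe]
    · have hw : ((weight τ i : ℝ) : ℂ) ≠ 0 := mod_cast weight_ne_zero hτ i
      rw [inner_proj_coe hS hi]
      push_cast
      field_simp
  by_cases hi : i = centre
  · subst hi
    have hj : j ≠ centre := Ne.symm hij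
    have hw : ((weight τ j : ℝ) : ℂ) ≠ 0 := mod_cast weight_ne_zero hτ j
    rw [starBlocks_centre_right hj, inner_normalizedProj, ← proj_inner_left, proj_centre_coe,
      inner_proj_coe hS hj]
    simp only [weight, ContinuousLinearMap.smul_apply, one_apply_eq_self,
      inner_smul_left, Complex.conj_ofReal]
    push_cast
    field_simp
  by_cases hj : j = centre
  · subst hj
    have hw : ((weight τ i : ℝ) : ℂ) ≠ 0 := mod_cast weight_ne_zero hτ i
    rw [starBlocks_centre_left hi, inner_normalizedProj, proj_centre_coe,
      inner_proj_coe hS hi]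
    simp only [weight, ContinuousLinearMap.smul_apply, one_apply_eq_self,
      inner_smul_left, Complex.conj_ofReal]
    push_cast
    field_simp
  by_cases hp : IsPair i j
  · obtain ⟨k, ⟨rfl, rfl⟩ | ⟨rfl, rfl⟩⟩ := hp
    · have e : starBlocks (r := r) τ (pairOperator S τ) (paired k true) (paired k false) =
          pairOperator S τ k := starBlocks_pair k true
      rw [e, pairOperator_eq hS, ContinuousLinearMap.comp_apply,
        ContinuousLinearMap.adjoint_inner_left]
    · have e : starBlocks (r := r) τ (pairOperator S τ) (paired k false) (paired k true) =
          pairOperator S τ k := starBlocks_pair k false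
      rw [e, pairOperator, ContinuousLinearMap.comp_apply, ContinuousLinearMap.adjoint_inner_left]
  · have hp' : ¬ IsPair j i := by
      rintro ⟨k, h | h⟩
      · exact hp ⟨k, Or.inr ⟨h.2, h.1⟩⟩
      · exact hp ⟨k, Or.inl ⟨h.2, h.1⟩⟩
    have h := congrArg (fun F => F (y : S.carrier)) (hS.ort i j hi hj hij hp)
    rw [starBlocks_of_not_isPair hj hi (Ne.symm hij) hp', inner_normalizedProj]
    simp only [ContinuousLinearMap.mul_apply, ContinuousLinearMap.zero_apply] at h
    rw [h]
    simp

end Existence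

/-! ### Irreducibility passes to the triple of projections. -/

section Reducing

variable {m r : ℕ} {S : SubspaceSystem.{u} (Vertex m r)}

/-- In an irreducible system, the only nonzero closed subspace invariant under all projections is
the whole space. -/
theorem eq_top_of_invariant (hirr : S.IsIrreducible) (M : Submodule ℂ S.carrier)
    (hM : IsClosed (M : Set S.carrier)) (hne : M ≠ ⊥) (hinv : ∀ i, ∀ x ∈ M, S.proj i x ∈ M) :
    M = ⊤ := by
  have : CompleteSpace M := hM.completeSpace_coe
  -- A closed subspace invariant under self-adjoint operators reduces them, so its projection is in
  -- the commutant and hence scalar; fixing a nonzero vector, it is the identity.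
  obtain ⟨c, hc⟩ := hirr M.starProjection fun i => by
    ext1 x
    simp only [ContinuousLinearMap.mul_apply]
    refine Submodule.eq_starProjection_of_mem_of_inner_eq_zero (K := M) (u := S.proj i x)
      (hinv i _ (Submodule.starProjection_apply_mem _ _)) fun w hw => ?_
    rw [← map_sub, proj_inner_left]
    exact Submodule.starProjection_inner_eq_zero _ _ (hinv i w hw)
  obtain ⟨x, hx, hx0⟩ := Submodule.exists_mem_ne_zero_of_ne_bot hne
  have h1 : c = 1 := by
    have h2 := Submodule.starProjection_eq_self_iff.2 hx
    rw [hc] at h2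
    have h3 : (c - 1) • x = 0 := by
      rw [sub_smul, one_smul, sub_eq_zero]
      exact h2
    exact sub_eq_zero.1 ((smul_eq_zero.1 h3).resolve_right hx0)
  refine eq_top_iff.2 fun y _ => Submodule.starProjection_eq_self_iff.1 ?_
  rw [hc, h1, one_smul]
  rfl

/-- A nonzero irreducible system satisfying the relations is realized by projections without common
nontrivial invariant closed subspaces. -/
theorem exists_isRealization {τ : Fin (m + r) → ℝ} (hS : S.Satisfies τ) (hτ : ∀ j, τ j ≠ 0)
    (hne : S.IsNonzero) (hirr : S.IsIrreducible) :
    ∃ (Q : Fin m → S.space centre →L[ℂ] S.space centre)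
      (g : Vertex m r → S.space centre →L[ℂ] S.carrier),
      (∀ k, IsStarProjection (Q k)) ∧ IsRealization S τ Q g ∧ Nontrivial (S.space centre) ∧
      ∀ M : Submodule ℂ (S.space centre), IsClosed (M : Set (S.space centre)) → M ≠ ⊥ →
        (∀ k, ∀ x ∈ M, Q k x ∈ M) → M = ⊤ := by
  set Q := pairOperator S τ
  set g := normalizedProj S τ
  have hmem := normalizedProj_mem_iff hS hτ
  have hgram := normalizedProj_gram hS hτ
  have hproj : ∀ i j x, S.proj i (g j x) = g i (starBlocks τ Q i j x) := by
    intro i j x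
    refine (Submodule.eq_starProjection_of_mem_of_inner_eq_zero ((hmem i _).2 ⟨_, rfl⟩) ?_)
    intro w hw
    obtain ⟨y, rfl⟩ := (hmem i w).1 hw
    rw [inner_sub_left, hgram, hgram, starBlocks_self, one_apply_eq_self, sub_self]
  have hc : ∀ x, g centre x = x := fun x => by
    simp only [g, normalizedProj_centre]
    rfl
  have hB : ∀ M : Submodule ℂ (S.space centre), (∀ k, ∀ x ∈ M, Q k x ∈ M) →
      ∀ i j, ∀ x ∈ M, starBlocks τ Q i j x ∈ M := by
    intro M hinv i j
    refine starBlocks_induction (p := fun B : S.space centre →L[ℂ] S.space centre =>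
      ∀ x ∈ M, B x ∈ M) ?_ ?_ ?_ hinv i j
    · intro x _
      exact M.zero_mem
    · intro x hx
      exact hx
    · intro c x hx
      exact M.smul_mem _ hx
  -- An invariant subspace M of the centre generates the closed span of all g_i M, invariant under
  -- every projection because P_i g_j = g_i B_ij.
  have htop : ∀ M : Submodule ℂ (S.space centre), M ≠ ⊥ → (∀ k, ∀ x ∈ M, Q k x ∈ M) →
      (⨆ i, M.map (g i).toLinearMap).topologicalClosure = ⊤ := by
    intro M hM hinv
    have hB := hB M hinv
    refine eq_top_of_invariant hirr _ (Submodule.isClosed_topologicalClosure _) ?_ ?_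
    · obtain ⟨x, hx, hx0⟩ := Submodule.exists_mem_ne_zero_of_ne_bot hM
      refine (Submodule.ne_bot_iff _).2 ⟨g centre x, Submodule.le_topologicalClosure _
        (Submodule.mem_iSup_of_mem centre ⟨x, hx, rfl⟩), ?_⟩
      rw [hc]
      simpa using hx0
    · intro i x hx
      refine map_mem_closure (S.proj i).continuous hx fun z hz => ?_
      have hle : (⨆ i, M.map (g i).toLinearMap) ≤
          (⨆ i, M.map (g i).toLinearMap).comap (S.proj i).toLinearMap := by
        refine iSup_le fun j => ?_
        rintro _ ⟨y, hy, rfl⟩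
        exact Submodule.mem_iSup_of_mem i ⟨_, hB i j y hy, (hproj i j y).symm⟩
      exact hle hz
  have hnt : Nontrivial (S.space centre) := by
    by_contra h
    rw [not_nontrivial_iff_subsingleton] at h
    obtain ⟨i, hi⟩ := hne
    obtain ⟨x, hx, hx0⟩ := Submodule.exists_mem_ne_zero_of_ne_bot hi
    obtain ⟨y, rfl⟩ := (hmem i x).1 hx
    exact hx0 (by rw [Subsingleton.elim y 0, map_zero])
  refine ⟨Q, g, isStarProjection_pairOperator hS hτ, ⟨hmem, hgram, ?_⟩, hnt, ?_⟩
  · have h1 := htop ⊤ top_ne_bot fun _ _ _ => trivial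
    have h2 : (⨆ i, (⊤ : Submodule ℂ (S.space centre)).map (g i).toLinearMap) ≤
        LinearMap.range (synth g) := by
      refine iSup_le fun i => ?_
      rintro _ ⟨y, _, rfl⟩
      exact ⟨Pi.single i y, synth_single g i y⟩
    change Dense ((LinearMap.range (synth g) : Submodule ℂ S.carrier) : Set S.carrier)
    rw [Submodule.dense_iff_topologicalClosure_eq_top, eq_top_iff, ← h1]
    exact Submodule.topologicalClosure_mono h2
  · intro M hM hM0 hinv
    have h1 := htop M hM0 hinv
    refine eq_top_iff.2 fun x _ => ?_
    have h2 : (x : S.carrier) ∈ (⨆ i, M.map (g i).toLinearMap).topologicalClosure := h1 ▸ trivial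
    -- The adjoint of the central map takes g_i y to the block B_ci y (c the centre), which stays in
    -- M; it therefore sends the dense sum back into M.
    have hle : (⨆ i, M.map (g i).toLinearMap) ≤ M.comap (g centre).adjoint.toLinearMap := by
      refine iSup_le fun i => ?_
      rintro _ ⟨y, hy, rfl⟩
      have h4 : (g centre).adjoint (g i y) = starBlocks τ Q centre i y :=
        ext_inner_right ℂ fun z => by
          rw [ContinuousLinearMap.adjoint_inner_left]
          exact hgram i centre y z
      change (g centre).adjoint (g i y) ∈ M
      rw [h4]
      exact hB M hinv centre i y hy
    have h3 : (g centre).adjoint (x : S.carrier) ∈ closure (M : Set (S.space centre)) :=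
      map_mem_closure (g centre).adjoint.continuous h2 fun z hz => hle hz
    rw [hM.closure_eq] at h3
    have h5 : (g centre).adjoint (x : S.carrier) = x := ext_inner_right ℂ fun z => by
      rw [ContinuousLinearMap.adjoint_inner_left, hc]
      rfl
    rwa [h5] at h3

end Reducing

end SubspaceProblem

end

noncomputable section

namespace SubspaceProblem

open Vertex

/-! ### Positivity and kernel of B through the Schur complement. -/

section SchurComplement

variable {m r : ℕ} {K : Type*} [NormedAddCommGroup K] [InnerProductSpace ℂ K]
  {τ : Fin (m + r) → ℝ} {Q : Fin m → K →L[ℂ] K}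

/-- The Schur complement of the central block in `B(Q_1, …, Q_m)`. -/
def schurOp (τ : Fin (m + r) → ℝ) (Q : Fin m → K →L[ℂ] K) : K →L[ℂ] K :=
  1 - ∑ k, ((τ (Fin.castAdd r k) ^ 2 : ℝ) : ℂ) • (2 - Q k) -
    ∑ j, ((τ (Fin.natAdd m j) ^ 2 : ℝ) : ℂ) • 1

theorem schurOp_apply (x : K) : schurOp τ Q x =
    x - ∑ k, ((τ (Fin.castAdd r k) ^ 2 : ℝ) : ℂ) • (x + x - Q k x) -
      ∑ j, ((τ (Fin.natAdd m j) ^ 2 : ℝ) : ℂ) • x := by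
  have h2 : ∀ y : K, (2 : K →L[ℂ] K) y = y + y := fun y => by
    rw [← one_add_one_eq_two]; rfl
  simp only [schurOp, ContinuousLinearMap.sub_apply, ContinuousLinearMap.sum_apply,
    ContinuousLinearMap.smul_apply, one_apply_eq_self, h2]

theorem sum_starBlocks_centre (x : Vertex m r → K) :
    ∑ j, starBlocks τ Q centre j (x j) = x centre +
      ∑ k, ((τ (Fin.castAdd r k) : ℝ) : ℂ) • (x (paired k false) + x (paired k true)) +
      ∑ j, ((τ (Fin.natAdd m j) : ℝ) : ℂ) • x (single j) := by
  rw [sum_vertex]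
  simp only [starBlocks, weight, ContinuousLinearMap.smul_apply, one_apply_eq_self,
    smul_add]

theorem sum_starBlocks_paired (x : Vertex m r → K) (k : Fin m) (b : Bool) :
    ∑ j, starBlocks τ Q (paired k b) j (x j) = ((τ (Fin.castAdd r k) : ℝ) : ℂ) • x centre +
      (x (paired k b) + Q k (x (paired k !b))) := by
  rw [sum_vertex, Finset.sum_eq_single k]
  · cases b
    · simp [starBlocks, weight, -Complex.coe_smul]
    · simp [starBlocks, weight, -Complex.coe_smul, add_comm]
  · intro l _ hl
    simp [starBlocks, Ne.symm hl]
  · simp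

theorem sum_starBlocks_single (x : Vertex m r → K) (l : Fin r) :
    ∑ j, starBlocks τ Q (single l) j (x j) = ((τ (Fin.natAdd m l) : ℝ) : ℂ) • x centre +
      x (single l) := by
  rw [sum_vertex, Finset.sum_eq_single l]
  · simp [starBlocks, weight, -Complex.coe_smul]
  · intro l _ hl
    simp [starBlocks, Ne.symm hl]
  · simp

/-- The point of the fibre over `c` at which the quadratic form of `B(Q_1, …, Q_m)` is minimal,
shifted by `w`. -/
def schurLift (τ : Fin (m + r) → ℝ) (Q : Fin m → K →L[ℂ] K) (c : K) (w : Fin m → K) :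
    Vertex m r → K
  | centre => c
  | paired k true => w k - ((τ (Fin.castAdd r k) : ℝ) : ℂ) • c
  | paired k false => Q k (((τ (Fin.castAdd r k) : ℝ) : ℂ) • c - w k) -
      ((τ (Fin.castAdd r k) : ℝ) : ℂ) • c
  | single j => -(((τ (Fin.natAdd m j) : ℝ) : ℂ) • c)

variable [CompleteSpace K]

/-- The lift solves all non-central rows, so only the Schur complement survives, in the central row.
The free parameters w_k in the range of Q_k enter the k-th pair as (-w_k, w_k), a null vector since
the two maps coincide there. -/
theorem sum_starBlocks_schurLift (hQ : ∀ k, IsStarProjection (Q k)) (c : K) (w : Fin m → K)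
    (hw : ∀ k, Q k (w k) = w k) (i : Vertex m r) :
    ∑ j, starBlocks τ Q i j (schurLift τ Q c w j) = if i = centre then schurOp τ Q c else 0 := by
  rcases i with _ | ⟨k, _ | _⟩ | l
  · rw [sum_starBlocks_centre, schurOp_apply, if_pos rfl, sub_eq_add_neg, sub_eq_add_neg,
      ← Finset.sum_neg_distrib, ← Finset.sum_neg_distrib]
    refine congrArg₂ _ (congrArg₂ _ rfl (Finset.sum_congr rfl fun k _ => ?_))
      (Finset.sum_congr rfl fun k _ => ?_)
    · simp only [schurLift, map_sub, map_smul, hw]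
      push_cast
      module
    · simp only [schurLift]
      push_cast
      module
  · rw [sum_starBlocks_paired]
    simp only [schurLift, map_sub, map_smul, hw, Bool.not_false, reduceCtorEq, if_false]
    module
  · rw [sum_starBlocks_paired]
    simp only [schurLift, map_sub, map_smul, hw, Bool.not_true, reduceCtorEq, if_false,
      (hQ k).apply_apply]
    module
  · rw [sum_starBlocks_single]
    simp only [schurLift, reduceCtorEq, if_false]
    module

theorem eq_schurLift (hQ : ∀ k, IsStarProjection (Q k)) {x : Vertex m r → K}
    (hx : ∀ i, ∑ j, starBlocks τ Q i j (x j) = 0) :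
    ∃ w : Fin m → K, (∀ k, Q k (w k) = w k) ∧ schurOp τ Q (x centre) = 0 ∧
      x = schurLift τ Q (x centre) w := by
  have hf := fun k => (sum_starBlocks_paired x k false).symm.trans (hx _)
  have ht := fun k => (sum_starBlocks_paired x k true).symm.trans (hx _)
  have hs := fun l => (sum_starBlocks_single x l).symm.trans (hx _)
  simp only [Bool.not_false, Bool.not_true] at hf ht
  -- Applying Q_k to the row of the first vertex of the pair and subtracting the row of the second
  -- shows that this vector is fixed by Q_k.
  have hw : ∀ k, Q k (x (paired k true) + ((τ (Fin.castAdd r k) : ℝ) : ℂ) • x centre) =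
      x (paired k true) + ((τ (Fin.castAdd r k) : ℝ) : ℂ) • x centre := by
    intro k
    have h1 := congrArg (Q k) (hf k)
    rw [map_add, map_add, (hQ k).apply_apply, map_zero] at h1
    rw [map_add, ← sub_eq_zero, ← sub_eq_zero.2 (h1.trans (ht k).symm)]
    abel
  have hl : x = schurLift τ Q (x centre)
      (fun k => x (paired k true) + ((τ (Fin.castAdd r k) : ℝ) : ℂ) • x centre) := by
    funext i
    rcases i with _ | ⟨k, _ | _⟩ | l
    · rfl
    · simp only [schurLift]
      rw [← sub_eq_zero, ← hf k, map_sub, map_add]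
      abel
    · simp only [schurLift]
      abel
    · simp only [schurLift]
      rw [← sub_eq_zero, ← hs l]
      abel
  refine ⟨_, hw, ?_, hl⟩
  have h := sum_starBlocks_schurLift (τ := τ) hQ (x centre) _ hw centre
  rw [← hl, hx, if_pos rfl] at h
  exact h.symm

theorem schurLift_injective {c c' : K} {w w' : Fin m → K}
    (h : schurLift τ Q c w = schurLift τ Q c' w') : c = c' ∧ w = w' := by
  have hc : c = c' := congrFun h centre
  subst hc
  exact ⟨rfl, funext fun k => sub_left_injective (congrFun h (paired k true))⟩

/-- Completing the square in the `k`-th pair. -/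
theorem re_inner_pair {Q : K →L[ℂ] K} (hQ : IsStarProjection Q) (t : ℝ) (c u w : K) :
    RCLike.re (inner ℂ ((t : ℂ) • (u + w)) c) + (RCLike.re (inner ℂ ((t : ℂ) • c + (u + Q w)) u) +
      RCLike.re (inner ℂ ((t : ℂ) • c + (w + Q u)) w)) =
    ‖u + Q w + (t : ℂ) • c‖ ^ 2 + ‖w + (t : ℂ) • c - Q (w + (t : ℂ) • c)‖ ^ 2 -
      RCLike.re (inner ℂ (((t ^ 2 : ℝ) : ℂ) • (c + c - Q c)) c) := by
  have s1 : ∀ x y : K, (inner ℂ x y).re = (inner ℂ y x).re := fun x y => inner_re_symm (𝕜 := ℂ) x y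
  simp only [@norm_sq_eq_re_inner ℂ, inner_add_left, inner_add_right, inner_sub_left,
    inner_sub_right, inner_smul_left, inner_smul_right, map_add, map_sub, map_smul,
    Complex.conj_ofReal, RCLike.re_to_complex, Complex.add_re, Complex.sub_re, Complex.re_ofReal_mul, hQ.inner_left,
    hQ.apply_apply]
  have e1 := s1 w u
  have e2 := s1 c u
  have e3 := s1 c w
  have e4 : (inner ℂ w (Q u)).re = (inner ℂ u (Q w)).re := by
    rw [← hQ.inner_left, s1]
  have e5 : (inner ℂ c (Q u)).re = (inner ℂ u (Q c)).re := by
    rw [← hQ.inner_left, s1]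
  have e6 : (inner ℂ c (Q w)).re = (inner ℂ w (Q c)).re := by
    rw [← hQ.inner_left, s1]
  rw [e2, e3, e4, e6]
  ring

/-- Completing the square at every non-central vertex leaves squares and the quadratic form of the
Schur complement in the central coordinate. -/
theorem re_inner_blockOp (hQ : ∀ k, IsStarProjection (Q k)) (x : PiLp 2 fun _ : Vertex m r => K) :
    RCLike.re (inner ℂ (blockOp (starBlocks τ Q) x) x) =
      ∑ k, (‖x (paired k false) + Q k (x (paired k true)) +
          ((τ (Fin.castAdd r k) : ℝ) : ℂ) • x centre‖ ^ 2 +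
        ‖x (paired k true) + ((τ (Fin.castAdd r k) : ℝ) : ℂ) • x centre -
          Q k (x (paired k true) + ((τ (Fin.castAdd r k) : ℝ) : ℂ) • x centre)‖ ^ 2) +
      ∑ j, ‖((τ (Fin.natAdd m j) : ℝ) : ℂ) • x centre + x (single j)‖ ^ 2 +
      RCLike.re (inner ℂ (schurOp τ Q (x centre)) (x centre)) := by
  have hp := Finset.sum_congr rfl fun (k : Fin m) (_ : k ∈ Finset.univ) =>
    re_inner_pair (hQ k) (τ (Fin.castAdd r k)) (x centre) (x (paired k false)) (x (paired k true))
  have hs : ∀ j : Fin r, RCLike.re (inner ℂ (((τ (Fin.natAdd m j) : ℝ) : ℂ) • x (single j)) (x centre)) +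
      RCLike.re (inner ℂ (((τ (Fin.natAdd m j) : ℝ) : ℂ) • x centre + x (single j)) (x (single j))) =
      ‖((τ (Fin.natAdd m j) : ℝ) : ℂ) • x centre + x (single j)‖ ^ 2 -
        RCLike.re (inner ℂ (((τ (Fin.natAdd m j) ^ 2 : ℝ) : ℂ) • x centre) (x centre)) := by
    intro j
    simp only [@norm_sq_eq_re_inner ℂ, inner_add_left, inner_add_right, inner_smul_left,
      inner_smul_right, map_add, Complex.conj_ofReal, RCLike.re_to_complex, Complex.add_re, Complex.sub_re, Complex.re_ofReal_mul]
    ring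
  have hs := Finset.sum_congr rfl fun (j : Fin r) (_ : j ∈ Finset.univ) => hs j
  simp only [Finset.sum_add_distrib, Finset.sum_sub_distrib] at hp hs
  rw [PiLp.inner_apply, map_sum, sum_vertex]
  simp only [blockOp_apply, sum_starBlocks_centre, sum_starBlocks_paired, sum_starBlocks_single,
    Bool.not_false, Bool.not_true, schurOp_apply, Finset.sum_add_distrib]
  simp only [inner_add_left (𝕜 := ℂ) (x centre + _), inner_add_left (𝕜 := ℂ) (x centre),
    inner_sub_left (𝕜 := ℂ) (x centre - _), inner_sub_left (𝕜 := ℂ) (x centre), sum_inner, map_add,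
    map_sub, map_sum]
  simp only [map_add] at hp
  linarith

theorem isPositive_blockOp (hQ : ∀ k, IsStarProjection (Q k))
    (hM : ∀ x, 0 ≤ RCLike.re (inner ℂ (schurOp τ Q x) x)) :
    (blockOp (starBlocks τ Q)).IsPositive := by
  have hsymm : ∀ i j x y, inner ℂ (starBlocks τ Q i j x) y = inner ℂ x (starBlocks τ Q j i y) := by
    intro i j x y
    rcases i with _ | ⟨k, _ | _⟩ | l <;> rcases j with _ | ⟨k', _ | _⟩ | l' <;>
      simp only [starBlocks] <;> (try split_ifs) <;> (try subst_vars) <;>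
      first
        | exact (hQ _).inner_left x y
        | contradiction
        | simp [inner_smul_left, inner_smul_right, -Complex.coe_smul, mul_comm]
  refine ⟨fun x y => ?_, fun x => ?_⟩
  · simp only [ContinuousLinearMap.coe_coe, PiLp.inner_apply, blockOp_apply, sum_inner, inner_sum,
      hsymm]
    exact Finset.sum_comm
  · rw [ContinuousLinearMap.reApplyInnerSelf_apply, re_inner_blockOp hQ]
    have := hM (x centre)
    positivity

section Gram

variable {E : Type*} [NormedAddCommGroup E] [InnerProductSpace ℂ E]
  {g : Vertex m r → K →L[ℂ] E}

omit [CompleteSpace K] in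
theorem inner_synth_of_gram
    (hg : ∀ i j x y, inner ℂ (g i x) (g j y) = inner ℂ (starBlocks τ Q j i x) y)
    (x y : Vertex m r → K) :
    inner ℂ (synth g x) (synth g y) = ∑ i, inner ℂ (∑ j, starBlocks τ Q i j (x j)) (y i) := by
  simp only [synth_apply, sum_inner, inner_sum, hg]

/-- At the minimizing lift of c all squares vanish, so the value is the squared norm of the vector
synthesized from that lift. This is the converse of `isPositive_blockOp`. -/
theorem re_inner_schurOp_nonneg (hQ : ∀ k, IsStarProjection (Q k))
    (hg : ∀ i j x y, inner ℂ (g i x) (g j y) = inner ℂ (starBlocks τ Q j i x) y) (c : K) :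
    0 ≤ RCLike.re (inner ℂ (schurOp τ Q c) c) := by
  have h := inner_synth_of_gram hg (schurLift τ Q c 0) (schurLift τ Q c 0)
  simp only [sum_starBlocks_schurLift hQ c 0 (by simp)] at h
  rw [Finset.sum_eq_single centre (by simp +contextual) (by simp), if_pos rfl] at h
  have h2 : schurLift τ Q c 0 centre = c := rfl
  rw [h2] at h
  rw [← h]
  exact inner_self_nonneg

theorem synth_eq_zero_iff (hQ : ∀ k, IsStarProjection (Q k))
    (hg : ∀ i j x y, inner ℂ (g i x) (g j y) = inner ℂ (starBlocks τ Q j i x) y)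
    (x : Vertex m r → K) :
    synth g x = 0 ↔ ∃ c w, schurOp τ Q c = 0 ∧ (∀ k, Q k (w k) = w k) ∧ schurLift τ Q c w = x := by
  constructor
  · intro h
    obtain ⟨w, hw, hM, hx⟩ := eq_schurLift (τ := τ) hQ (x := x) fun i =>
      ext_inner_right ℂ fun y => by
        have h1 := inner_synth_of_gram hg x (Pi.single i y)
        rw [h, inner_zero_left, Finset.sum_eq_single i (fun j _ hj => by simp [hj]) (by simp),
          Pi.single_eq_same] at h1
        rw [← h1, inner_zero_left]
    exact ⟨_, w, hM, hw, hx.symm⟩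
  · rintro ⟨c, w, hM, hw, rfl⟩
    rw [← inner_self_eq_zero (𝕜 := ℂ), inner_synth_of_gram hg]
    refine Finset.sum_eq_zero fun i _ => ?_
    rw [sum_starBlocks_schurLift hQ c w hw, hM, ite_self, inner_zero_left]

end Gram

/-- `schurLift` as a linear map. -/
def schurLiftₗ (τ : Fin (m + r) → ℝ) (Q : Fin m → K →L[ℂ] K) :
    (K × (Fin m → K)) →ₗ[ℂ] (Vertex m r → K) where
  toFun p := schurLift τ Q p.1 p.2
  map_add' p q := by
    funext i
    rcases i with _ | ⟨k, _ | _⟩ | l <;> simp [schurLift, -Complex.coe_smul] <;> abel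
  map_smul' a p := by
    funext i
    rcases i with _ | ⟨k, _ | _⟩ | l <;>
      simp [schurLift, -Complex.coe_smul, smul_sub, smul_comm a]

/-- The linear parametrization of the kernel of `B(Q_1, …, Q_m)`. -/
def kernelParam (τ : Fin (m + r) → ℝ) (Q : Fin m → K →L[ℂ] K) :
    (LinearMap.ker (schurOp τ Q).toLinearMap × (∀ k, LinearMap.ker (1 - Q k).toLinearMap)) →ₗ[ℂ]
      (Vertex m r → K) :=
  schurLiftₗ τ Q ∘ₗ LinearMap.prodMap (Submodule.subtype _)
    (LinearMap.pi fun k => Submodule.subtype _ ∘ₗ LinearMap.proj k)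

/-- Rank-nullity for the synthesis map: in finite dimension its dense range is the whole space, and
its kernel is parametrized injectively by the kernel of the Schur complement and the ranges of the
Q_k. -/
theorem IsRealization.finrank_add {S : SubspaceSystem.{u} (Vertex m r)}
    {g : Vertex m r → K →L[ℂ] S.carrier} (h : IsRealization S τ Q g)
    (hQ : ∀ k, IsStarProjection (Q k)) [FiniteDimensional ℂ K] :
    FiniteDimensional ℂ S.carrier ∧ Module.finrank ℂ S.carrier +
      (Module.finrank ℂ (LinearMap.ker (schurOp τ Q).toLinearMap) +
        ∑ k, Module.finrank ℂ (LinearMap.ker (1 - Q k).toLinearMap)) =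
      Fintype.card (Vertex m r) * Module.finrank ℂ K := by
  have hr : LinearMap.range (synth g) = ⊤ := by
    rw [← (LinearMap.range (synth g)).closed_of_finiteDimensional.submodule_topologicalClosure_eq,
      ← Submodule.dense_iff_topologicalClosure_eq_top]
    exact h.dense
  have hk : LinearMap.ker (synth g) = LinearMap.range (kernelParam τ Q) := by
    ext x
    rw [LinearMap.mem_ker, synth_eq_zero_iff hQ h.gram, LinearMap.mem_range]
    constructor
    · rintro ⟨c, w, hM, hw, rfl⟩
      exact ⟨(⟨c, hM⟩, fun k => ⟨w k, by simp [hw]⟩), rfl⟩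
    · rintro ⟨⟨c, w⟩, rfl⟩
      exact ⟨c, fun k => w k, c.2, fun k => (sub_eq_zero.1 (w k).2).symm, rfl⟩
  have hi : Function.Injective (kernelParam τ Q) := by
    rintro ⟨c, w⟩ ⟨c', w'⟩ hp
    obtain ⟨h1, h2⟩ := schurLift_injective hp
    exact Prod.ext (Subtype.ext h1) (funext fun k => Subtype.ext (congrFun h2 k))
  have hfin : FiniteDimensional ℂ S.carrier :=
    Module.Finite.of_surjective (synth g) (LinearMap.range_eq_top.1 hr)
  refine ⟨hfin, ?_⟩
  have h1 := LinearMap.finrank_range_add_finrank_ker (synth g)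
  rw [hr, finrank_top, hk, LinearMap.finrank_range_of_inj hi, Module.finrank_prod,
    Module.finrank_pi_fintype, Module.finrank_pi_fintype, Finset.sum_const, Finset.card_univ,
    smul_eq_mul] at h1
  exact h1

theorem IsRealization.rank_space {S : SubspaceSystem.{u} (Vertex m r)}
    {g : Vertex m r → K →L[ℂ] S.carrier} (h : IsRealization S τ Q g) [FiniteDimensional ℂ K]
    (i : Vertex m r) : Module.rank ℂ (S.space i) = Module.finrank ℂ K := by
  have hs : S.space i = LinearMap.range (g i).toLinearMap := by
    ext x
    rw [h.mem_iff]
    rfl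
  rw [hs, ← Module.finrank_eq_rank, LinearMap.finrank_range_of_inj (h.injective i)]

end SchurComplement

end SubspaceProblem

end

noncomputable section

namespace SubspaceProblem

open Vertex

/-! ### The system 𝒢(B) is a realization. -/

section GramSystem

variable {ι : Type w} [Fintype ι] {K : Type u} [NormedAddCommGroup K] [InnerProductSpace ℂ K]
  (B : Matrix ι ι (K →L[ℂ] K)) (hB : (blockOp B).IsPositive)

theorem inner_gramMap (x y : PiLp 2 fun _ : ι => K) :
    inner ℂ (gramMap B hB x) (gramMap B hB y) = inner ℂ (blockOp B x) y :=
  UniformSpace.Completion.inner_coe (𝕜 := ℂ) (toGramSpace B hB x) (toGramSpace B hB y)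

theorem denseRange_gramMap : DenseRange (gramMap B hB) :=
  (UniformSpace.Completion.denseRange_coe (α := GramSpace B hB)).comp
    (toGramSpace B hB).surjective.denseRange (UniformSpace.Completion.continuous_coe _)

variable [DecidableEq ι]

/-- `gramMap` with values in the system. -/
def gramMap' : (PiLp 2 fun _ : ι => K) →ₗ[ℂ] (gramSystem B hB).carrier :=
  gramMap B hB

/-- The restriction of `gramMap` to the `i`-th summand. -/
def gramComponent [FiniteDimensional ℂ K] (i : ι) : K →L[ℂ] (gramSystem B hB).carrier :=
  LinearMap.toContinuousLinearMap
    (gramMap' B hB ∘ₗ (PiLp.continuousLinearEquiv 2 ℂ (fun _ : ι => K)).symm.toLinearMap ∘ₗ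
      LinearMap.single ℂ (fun _ : ι => K) i)

theorem gramComponent_apply [FiniteDimensional ℂ K] (i : ι) (x : K) :
    gramComponent B hB i x = gramMap' B hB (WithLp.toLp 2 (Pi.single i x)) := rfl

theorem inner_gramComponent [FiniteDimensional ℂ K] (i j : ι) (x y : K) :
    inner ℂ (gramComponent B hB i x) (gramComponent B hB j y) = inner ℂ (B j i x) y := by
  refine (inner_gramMap B hB _ _).trans ?_
  rw [PiLp.inner_apply, Finset.sum_eq_single j, blockOp_apply, Finset.sum_eq_single i]
  · simp
  · simp +contextual
  · simp
  · simp +contextual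
  · simp

end GramSystem

variable {m r : ℕ} {K : Type u} [NormedAddCommGroup K] [InnerProductSpace ℂ K]
  [FiniteDimensional ℂ K] {τ : Fin (m + r) → ℝ} {Q : Fin m → K →L[ℂ] K}

/-- Finite dimensionality of K makes the images of the summands closed, so the closure in the
definition of the subspaces changes nothing. -/
theorem isRealization_gramSystem (hB : (blockOp (starBlocks τ Q)).IsPositive) :
    IsRealization (gramSystem (starBlocks τ Q) hB) τ Q (gramComponent (starBlocks τ Q) hB) where
  mem_iff i x := by
    have h : (gramSystem (starBlocks τ Q) hB).space i =
        LinearMap.range (gramComponent (starBlocks τ Q) hB i).toLinearMap :=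
      (Submodule.closed_of_finiteDimensional _).submodule_topologicalClosure_eq
    rw [h]
    rfl
  gram i j x y := inner_gramComponent _ hB i j x y
  dense := by
    have h := denseRange_gramMap (starBlocks τ Q) hB
    refine h.mono ?_
    rintro _ ⟨x, rfl⟩
    refine ⟨x.ofLp, ?_⟩
    rw [synth_apply]
    simp only [gramComponent_apply]
    refine (map_sum (gramMap' (starBlocks τ Q) hB) _ _).symm.trans ?_
    congr 1
    ext j
    simp [WithLp.ofLp_sum, Finset.sum_apply, Finset.sum_pi_single]

end SubspaceProblem

end

noncomputable section

namespace SubspaceProblem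

/-! ### A Schur lemma for self-adjoint operators. -/

section Scalar

variable {K : Type*} [NormedAddCommGroup K] [InnerProductSpace ℂ K] [CompleteSpace K]

/-- A self-adjoint operator commuting with a family of operators which has no common nontrivial
closed invariant subspace is scalar. -/
theorem exists_eq_smul_of_commute {ι : Type*} {R : ι → K →L[ℂ] K} [Nontrivial K]
    (hirr : ∀ M : Submodule ℂ K, IsClosed (M : Set K) → M ≠ ⊥ → (∀ k, ∀ x ∈ M, R k x ∈ M) → M = ⊤)
    {C : K →L[ℂ] K} (hC : IsSelfAdjoint C) (hcomm : ∀ k, Commute C (R k)) :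
    ∃ a : ℝ, ∀ x, C x = (a : ℂ) • x := by
  -- The kernel of f(C) is closed and invariant, so it is trivial or everything.
  have hker : ∀ f : ℝ → ℝ, LinearMap.ker (cfc f C).toLinearMap ≠ ⊥ → cfc f C = 0 := by
    intro f hf
    have h1 := hirr _ (cfc f C).isClosed_ker hf fun k x hx => by
      have h2 := congrArg (fun F : K →L[ℂ] K => F x) ((hcomm k).cfc_real f).eq
      simp only [ContinuousLinearMap.mul_apply] at h2
      have h3 : cfc f C x = 0 := hx
      change cfc f C (R k x) = 0
      rw [h2, h3, map_zero]
    ext x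
    have h4 : x ∈ LinearMap.ker (cfc f C).toLinearMap := h1 ▸ trivial
    exact h4
  obtain ⟨a, ha⟩ := ContinuousFunctionalCalculus.spectrum_nonempty (R := ℝ) C hC
  refine ⟨a, ?_⟩
  have hs : spectrum ℝ C ⊆ {a} := by
    -- Two spectral points would be separated by functions f, g with fg = 0 and f(C), g(C) ≠ 0; then
    -- f(C) has a nontrivial kernel, containing the range of g(C), and must vanish.
    have key : ∀ a b, a ∈ spectrum ℝ C → b ∈ spectrum ℝ C → ¬ a < b := by
      intro a b ha hb hab
      have hne : ∀ f : ℝ → ℝ, Continuous f → ∀ t ∈ spectrum ℝ C, f t ≠ 0 → cfc f C ≠ 0 := by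
        intro f hf t ht hft h0
        have h1 := cfc_map_spectrum f C hC hf.continuousOn
        rw [h0, spectrum.zero_eq] at h1
        exact hft (h1.symm ▸ Set.mem_image_of_mem f ht : f t ∈ ({0} : Set ℝ))
      let f : ℝ → ℝ := fun t => max 0 ((a + b) / 2 - t)
      let g : ℝ → ℝ := fun t => max 0 (t - (a + b) / 2)
      have hf : Continuous f := by fun_prop
      have hg : Continuous g := by fun_prop
      have hfg : cfc f C * cfc g C = 0 := by
        rw [← cfc_mul f g C hf.continuousOn hg.continuousOn]
        have : (fun x => f x * g x) = fun _ => 0 := by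
          funext t
          simp only [f, g]
          rcases le_total t ((a + b) / 2) with h | h
          · rw [max_eq_left (b := t - (a + b) / 2) (by linarith), mul_zero]
          · rw [max_eq_left (b := (a + b) / 2 - t) (by linarith), zero_mul]
        rw [this, cfc_const_zero]
      refine hne f hf a ha (by simp only [f]; rw [max_eq_right] <;> linarith) (hker f ?_)
      have hg0 := hne g hg b hb (by simp only [g]; rw [max_eq_right] <;> linarith)
      obtain ⟨x, hx⟩ : ∃ x, cfc g C x ≠ 0 := by
        by_contra! h
        exact hg0 (ContinuousLinearMap.ext h)
      exact (Submodule.ne_bot_iff _).2 ⟨_, congrArg (fun F : K →L[ℂ] K => F x) hfg, hx⟩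
    intro b hb
    rcases lt_trichotomy a b with h | h | h
    · exact absurd h (key _ _ ha hb)
    · exact h.symm
    · exact absurd h (key _ _ hb ha)
  intro x
  rw [CFC.eq_algebraMap_of_spectrum_subset_singleton C a hs]
  rfl

end Scalar

/-- The projections `0` or `1` in `ℂ` given by the binary digits of `n`. -/
def charProjections (n : Fin 8) : Fin 3 → EuclideanSpace ℂ (Fin 1) →L[ℂ] EuclideanSpace ℂ (Fin 1) :=
  fun k => if (n : ℕ).testBit k then 1 else 0

theorem angleProjections_zero (φ : ℝ) (v : EuclideanSpace ℂ (Fin 2)) :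
    angleProjections φ 0 v = !₂[v 0, 0] := by
  ext i
  fin_cases i <;> simp [angleProjections, Matrix.ofLp_toEuclideanCLM, Matrix.mulVec, dotProduct]

theorem angleProjections_one (φ : ℝ) (v : EuclideanSpace ℂ (Fin 2)) :
    angleProjections φ 1 v = !₂[((Real.cos φ ^ 2 : ℝ) : ℂ) * v 0 +
      ((Real.cos φ * Real.sin φ : ℝ) : ℂ) * v 1, ((Real.cos φ * Real.sin φ : ℝ) : ℂ) * v 0 +
      ((Real.sin φ ^ 2 : ℝ) : ℂ) * v 1] := by
  ext i
  fin_cases i <;> simp [angleProjections, Matrix.ofLp_toEuclideanCLM, Matrix.mulVec, dotProduct]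

theorem angleProjections_two (φ : ℝ) : angleProjections φ 2 = 0 := rfl

/-! ### Irreducible triples with R₁ + 2R₂ + 4R₃ ≤ c ≤ 4. -/

section Model

variable {K : Type*} [NormedAddCommGroup K] [InnerProductSpace ℂ K] [CompleteSpace K]
  {R : Fin 3 → K →L[ℂ] K}

/-- A common eigenvector spans an invariant line, hence the whole space, and the eigenvalues of
projections are 0 or 1. -/
theorem exists_charProjections (hR : ∀ k, IsStarProjection (R k))
    (hirr : ∀ M : Submodule ℂ K, IsClosed (M : Set K) → M ≠ ⊥ → (∀ k, ∀ x ∈ M, R k x ∈ M) → M = ⊤)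
    {x : K} (hx : x ≠ 0) (hRx : ∀ k, ∃ a : ℂ, R k x = a • x) :
    ∃ (n : Fin 8) (W : K ≃ₗᵢ[ℂ] EuclideanSpace ℂ (Fin 1)),
      ∀ k y, W (R k y) = charProjections n k (W y) := by
  have htop : Submodule.span ℂ {x} = ⊤ := by
    refine hirr _ (Submodule.closed_of_finiteDimensional _) ?_ fun k y hy => ?_
    · rwa [Ne, Submodule.span_singleton_eq_bot]
    · obtain ⟨b, rfl⟩ := Submodule.mem_span_singleton.1 hy
      obtain ⟨a, ha⟩ := hRx k
      rw [map_smul, ha]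
      exact Submodule.smul_mem _ _ (Submodule.smul_mem _ _ (Submodule.mem_span_singleton_self x))
  have hfr : Module.finrank ℂ K = 1 := by
    rw [← finrank_top, ← htop, finrank_span_singleton hx]
  have : FiniteDimensional ℂ K := Module.finite_of_finrank_eq_succ hfr
  have h01 : ∀ k, ∃ b : Bool, R k = if b then 1 else 0 := by
    intro k
    obtain ⟨a, ha⟩ := hRx k
    have h1 := (hR k).apply_apply x
    rw [ha, map_smul, ha, smul_smul, ← sub_eq_zero, ← sub_smul] at h1
    have h2 : a * (a - 1) = 0 := by
      rw [mul_sub, mul_one]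
      exact (smul_eq_zero.1 h1).resolve_right hx
    have h3 : ∀ y, R k y = a • y := by
      intro y
      obtain ⟨b, rfl⟩ := Submodule.mem_span_singleton.1 (htop ▸ trivial : y ∈ Submodule.span ℂ {x})
      rw [map_smul, ha, smul_comm]
    rcases mul_eq_zero.1 h2 with h | h
    · exact ⟨false, by ext y; simp [h3, h]⟩
    · exact ⟨true, by ext y; simp [h3, sub_eq_zero.1 h]⟩
  choose b hb using h01
  have hn : ∀ b : Fin 3 → Bool, ∃ n : Fin 8, ∀ k : Fin 3, (n : ℕ).testBit k = b k := by decide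
  obtain ⟨n, hn⟩ := hn b
  refine ⟨n, ((stdOrthonormalBasis ℂ K).reindex (finCongr hfr)).repr, fun k y => ?_⟩
  rw [charProjections, hn, hb]
  cases b k <;> simp

/-- The vector x and the normalized component of `R 1 x` orthogonal to x span an invariant plane, on
which the matrices are those of two lines with cos²φ = γ. -/
theorem exists_angleProjections (hR : ∀ k, IsStarProjection (R k))
    (hirr : ∀ M : Submodule ℂ K, IsClosed (M : Set K) → M ≠ ⊥ → (∀ k, ∀ x ∈ M, R k x ∈ M) → M = ⊤)
    {x : K} {γ : ℝ} (hx : ‖x‖ = 1) (h0 : R 0 x = x) (h01 : R 0 (R 1 x) = (γ : ℂ) • x)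
    (h2 : R 2 = 0) (hγ0 : 0 < γ) (hγ1 : γ < 1) :
    ∃ φ ∈ Set.Ioo 0 (Real.pi / 2), ∃ W : K ≃ₗᵢ[ℂ] EuclideanSpace ℂ (Fin 2),
      ∀ k y, W (R k y) = angleProjections φ k (W y) := by
  set φ := Real.arccos (√γ) with hφ
  have hs0 : 0 < √γ := Real.sqrt_pos.2 hγ0
  have hs1 : √γ < 1 := by rw [Real.sqrt_lt' one_pos]; simpa using hγ1
  have hφ0 : 0 < φ := Real.arccos_pos.2 hs1
  have hφ1 : φ < Real.pi / 2 := Real.arccos_lt_pi_div_two.2 hs0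
  have hcos : Real.cos φ = √γ := Real.cos_arccos (by linarith) hs1.le
  have hc2 : Real.cos φ ^ 2 = γ := by rw [hcos, Real.sq_sqrt hγ0.le]
  have hc : 0 < Real.cos φ := hcos ▸ hs0
  have hs : 0 < Real.sin φ := Real.sin_pos_of_pos_of_lt_pi hφ0 (by linarith [Real.pi_pos])
  have hs2 : Real.sin φ ^ 2 = 1 - γ := by rw [← hc2, Real.sin_sq]
  set c := Real.cos φ
  set s := Real.sin φ
  have hcs : ((c * s : ℝ) : ℂ) ≠ 0 := by exact_mod_cast (mul_pos hc hs).ne'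
  set y : K := ((c * s : ℝ) : ℂ)⁻¹ • (R 1 x - (γ : ℂ) • x) with hy
  have hxx : inner ℂ x x = (1 : ℂ) := by rw [inner_self_eq_norm_sq_to_K, hx]; simp
  have hx1 : inner ℂ x (R 1 x) = (γ : ℂ) := by
    calc inner ℂ x (R 1 x) = inner ℂ (R 0 x) (R 1 x) := by rw [h0]
      _ = inner ℂ x (R 0 (R 1 x)) := (hR 0).inner_left _ _
      _ = (γ : ℂ) := by rw [h01, inner_smul_right, hxx, mul_one]
  have h1x : inner ℂ (R 1 x) x = (γ : ℂ) := by rw [(hR 1).inner_left, hx1]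
  have h11 : inner ℂ (R 1 x) (R 1 x) = (γ : ℂ) := by
    rw [(hR 1).inner_left, (hR 1).apply_apply, hx1]
  have hRx : R 1 x = ((c ^ 2 : ℝ) : ℂ) • x + ((c * s : ℝ) : ℂ) • y := by
    rw [hy, smul_inv_smul₀ hcs, hc2]
    abel
  have hR0y : R 0 y = 0 := by
    rw [hy, map_smul, map_sub, h01, map_smul, h0, sub_self, smul_zero]
  have hR1y : R 1 y = ((c * s : ℝ) : ℂ) • x + ((s ^ 2 : ℝ) : ℂ) • y := by
    have e1 : R 1 y = (((c * s : ℝ) : ℂ)⁻¹ * ((s ^ 2 : ℝ) : ℂ)) • R 1 x := by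
      conv_lhs => rw [hy, map_smul, map_sub, (hR 1).apply_apply, map_smul]
      rw [hs2]
      push_cast
      module
    rw [e1, hRx, smul_add, smul_smul, smul_smul]
    have hc' : (c : ℂ) ≠ 0 := by exact_mod_cast hc.ne'
    have hs' : (s : ℂ) ≠ 0 := by exact_mod_cast hs.ne'
    congr 2
    · push_cast; field_simp
    · push_cast; field_simp
  have hxy : inner ℂ x y = (0 : ℂ) := by
    rw [hy, inner_smul_right, inner_sub_right, inner_smul_right, hx1, hxx]
    simp
  have hyy : inner ℂ y y = (1 : ℂ) := by
    have hc' : (c : ℂ) ≠ 0 := by exact_mod_cast hc.ne'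
    have hs' : (s : ℂ) ≠ 0 := by exact_mod_cast hs.ne'
    have e2 : (γ : ℂ) = (c : ℂ) ^ 2 := by exact_mod_cast hc2.symm
    have e3 : 1 - (c : ℂ) ^ 2 = (s : ℂ) ^ 2 := by rw [← e2]; exact_mod_cast hs2.symm
    rw [hy]
    simp only [inner_smul_left, inner_smul_right, inner_sub_left, inner_sub_right, map_inv₀,
      Complex.conj_ofReal, hx1, h1x, h11, hxx, e2]
    push_cast
    field_simp
    linear_combination e3
  have hon : Orthonormal ℂ ![x, y] := by
    rw [orthonormal_iff_ite]
    intro i j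
    have hyx : inner ℂ y x = (0 : ℂ) := by rw [← inner_conj_symm, hxy, map_zero]
    fin_cases i <;> fin_cases j <;> simp [hxx, hxy, hyy, hyx, -inner_self_eq_norm_sq_to_K]
  have hxm : x ∈ Submodule.span ℂ (Set.range ![x, y]) := Submodule.subset_span ⟨0, rfl⟩
  have hym : y ∈ Submodule.span ℂ (Set.range ![x, y]) := Submodule.subset_span ⟨1, rfl⟩
  have hsp : Submodule.span ℂ (Set.range ![x, y]) = ⊤ := by
    have : FiniteDimensional ℂ (Submodule.span ℂ (Set.range ![x, y])) :=
      FiniteDimensional.span_of_finite ℂ (Set.finite_range _)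
    refine hirr _ (Submodule.closed_of_finiteDimensional _) ?_ fun k => ?_
    · exact (Submodule.ne_bot_iff _).2 ⟨x, hxm, fun h => by simp [h] at hx⟩
    · have hle : Submodule.span ℂ (Set.range ![x, y]) ≤
          (Submodule.span ℂ (Set.range ![x, y])).comap (R k).toLinearMap := by
        rw [Submodule.span_le]
        rintro _ ⟨i, rfl⟩
        change R k _ ∈ Submodule.span ℂ (Set.range ![x, y])
        fin_cases k <;> fin_cases i
        · change R 0 x ∈ _
          rwa [h0]
        · change R 0 y ∈ _
          rw [hR0y]
          exact Submodule.zero_mem _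
        · change R 1 x ∈ _
          rw [hRx]
          exact Submodule.add_mem _ (Submodule.smul_mem _ _ hxm) (Submodule.smul_mem _ _ hym)
        · change R 1 y ∈ _
          rw [hR1y]
          exact Submodule.add_mem _ (Submodule.smul_mem _ _ hxm) (Submodule.smul_mem _ _ hym)
        · change R 2 x ∈ _
          rw [h2]
          exact Submodule.zero_mem _
        · change R 2 y ∈ _
          rw [h2]
          exact Submodule.zero_mem _
      exact fun z hz => hle hz
  let b := OrthonormalBasis.mk hon hsp.ge
  have hb0 : b 0 = x := by simp [b]
  have hb1 : b 1 = y := by simp [b]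
  have hWx : b.repr x = !₂[1, 0] := by
    rw [← hb0, b.repr_self]
    ext i
    fin_cases i <;> simp
  have hWy : b.repr y = !₂[0, 1] := by
    rw [← hb1, b.repr_self]
    ext i
    fin_cases i <;> simp
  refine ⟨φ, ⟨hφ0, hφ1⟩, b.repr, fun k z => ?_⟩
  have hext : b.repr.toLinearEquiv.toLinearMap ∘ₗ (R k).toLinearMap =
      (angleProjections φ k).toLinearMap ∘ₗ b.repr.toLinearEquiv.toLinearMap := by
    refine b.toBasis.ext fun i => ?_
    change b.repr (R k (b.toBasis i)) = angleProjections φ k (b.repr (b.toBasis i))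
    rw [b.coe_toBasis]
    have hv : ∀ p q : ℂ, p • (!₂[1, 0] : EuclideanSpace ℂ (Fin 2)) + q • !₂[0, 1] = !₂[p, q] := by
      intro p q
      ext i
      fin_cases i <;> simp
    fin_cases k <;> fin_cases i
    · change b.repr (R 0 (b 0)) = angleProjections φ 0 (b.repr (b 0))
      rw [hb0, h0, hWx, angleProjections_zero]
      rfl
    · change b.repr (R 0 (b 1)) = angleProjections φ 0 (b.repr (b 1))
      rw [hb1, hR0y, hWy, angleProjections_zero, map_zero]
      ext i
      fin_cases i <;> simp
    · change b.repr (R 1 (b 0)) = angleProjections φ 1 (b.repr (b 0))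
      rw [hb0, hRx, map_add, map_smul, map_smul, hWx, hWy, hv, angleProjections_one]
      simp [c, s]
    · change b.repr (R 1 (b 1)) = angleProjections φ 1 (b.repr (b 1))
      rw [hb1, hR1y, map_add, map_smul, map_smul, hWx, hWy, hv, angleProjections_one]
      simp [c, s]
    · change b.repr (R 2 (b 0)) = 0
      rw [h2]
      simp
    · change b.repr (R 2 (b 1)) = 0
      rw [h2]
      simp
  exact congrArg (fun F => F z) hext

/-- The irreducible triples of projections with `R₁ + 2 R₂ + 4 R₃ ≤ c ≤ 4`. -/
theorem exists_model [Nontrivial K] (hR : ∀ k, IsStarProjection (R k))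
    (hirr : ∀ M : Submodule ℂ K, IsClosed (M : Set K) → M ≠ ⊥ → (∀ k, ∀ x ∈ M, R k x ∈ M) → M = ⊤)
    {c : ℝ} (hc : c ≤ 4)
    (hpos : ∀ x, ‖R 0 x‖ ^ 2 + 2 * ‖R 1 x‖ ^ 2 + 4 * ‖R 2 x‖ ^ 2 ≤ c * ‖x‖ ^ 2) :
    (∃ (n : Fin 8) (W : K ≃ₗᵢ[ℂ] EuclideanSpace ℂ (Fin 1)),
      ∀ k y, W (R k y) = charProjections n k (W y)) ∨
    ∃ φ ∈ Set.Ioo 0 (Real.pi / 2), ∃ W : K ≃ₗᵢ[ℂ] EuclideanSpace ℂ (Fin 2),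
      ∀ k y, W (R k y) = angleProjections φ k (W y) := by
  have hex : ∀ k, R k ≠ 0 → ∃ x, x ≠ 0 ∧ R k x = x := by
    intro k hk
    obtain ⟨z, hz⟩ : ∃ z, R k z ≠ 0 := by
      by_contra! h
      exact hk (ContinuousLinearMap.ext h)
    exact ⟨_, hz, (hR k).apply_apply z⟩
  have one : ∀ x : K, ∃ a : ℂ, x = a • x := fun x => ⟨1, (one_smul _ _).symm⟩
  have zero : ∀ x : K, ∃ a : ℂ, (0 : K) = a • x := fun x => ⟨0, (zero_smul _ _).symm⟩
  by_cases h2 : R 2 = 0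
  swap
  -- A vector fixed by `R 2` already uses up 4‖x‖² ≥ c‖x‖², so `R 0` and `R 1` must kill it.
  · obtain ⟨x, hx0, hx⟩ := hex 2 h2
    have h := hpos x
    rw [hx] at h
    have h3 : 0 ≤ (4 - c) * ‖x‖ ^ 2 := mul_nonneg (by linarith) (sq_nonneg _)
    have h4 : ‖R 0 x‖ ^ 2 = 0 := le_antisymm (by nlinarith [sq_nonneg ‖R 1 x‖]) (sq_nonneg _)
    have h5 : ‖R 1 x‖ ^ 2 = 0 := le_antisymm (by nlinarith) (sq_nonneg _)
    rw [sq_eq_zero_iff, norm_eq_zero] at h4 h5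
    refine Or.inl (exists_charProjections hR hirr hx0 fun k => ?_)
    fin_cases k
    · exact h4 ▸ zero x
    · exact h5 ▸ zero x
    · exact ⟨1, hx.trans (one_smul _ _).symm⟩
  have h2' : ∀ x, ∃ a : ℂ, R 2 x = a • x := fun x => ⟨0, by rw [h2, zero_smul]; rfl⟩
  by_cases h0 : R 0 = 0
  · have h0' : ∀ x, ∃ a : ℂ, R 0 x = a • x := fun x => ⟨0, by rw [h0, zero_smul]; rfl⟩
    by_cases h1 : R 1 = 0
    · obtain ⟨x, hx⟩ := exists_ne (0 : K)
      refine Or.inl (exists_charProjections hR hirr hx fun k => ?_)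
      fin_cases k
      · exact h0' x
      · exact ⟨0, by rw [zero_smul]; exact congrArg (fun F : K →L[ℂ] K => F x) h1⟩
      · exact h2' x
    · obtain ⟨x, hx0, hx⟩ := hex 1 h1
      refine Or.inl (exists_charProjections hR hirr hx0 fun k => ?_)
      fin_cases k
      · exact h0' x
      · exact ⟨1, hx.trans (one_smul _ _).symm⟩
      · exact h2' x
  obtain ⟨z, hz0, hz⟩ := hex 0 h0
  obtain ⟨x, hx1, hx⟩ : ∃ x : K, ‖x‖ = 1 ∧ R 0 x = x :=
    ⟨((‖z‖⁻¹ : ℝ) : ℂ) • z, by simp [norm_smul, hz0, -Complex.ofReal_inv, -Complex.coe_smul],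
      by rw [map_smul, hz]⟩
  have hx0 : x ≠ 0 := fun h => by simp [h] at hx1
  -- The operator is (1 - R 0 - R 1)², which commutes with both projections. On a vector fixed by `R
  -- 0` it acts as R 0 R 1, so a will be the squared cosine of the angle.
  obtain ⟨a, ha⟩ := exists_eq_smul_of_commute hirr
    (C := 1 - R 0 - R 1 + (R 0 * R 1 + R 1 * R 0)) (by
      rw [IsSelfAdjoint]
      simp only [star_add, star_sub, star_mul, star_one, (hR _).isSelfAdjoint.star_eq]
      abel) (by
      have i0 := (hR 0).isIdempotentElem.eq
      have i1 := (hR 1).isIdempotentElem.eq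
      intro k
      fin_cases k
      · change _ * R 0 = R 0 * _
        simp only [mul_add, add_mul, mul_sub, sub_mul, mul_one, one_mul, mul_assoc, i0]
        simp only [← mul_assoc, i0]
        abel
      · change _ * R 1 = R 1 * _
        simp only [mul_add, add_mul, mul_sub, sub_mul, mul_one, one_mul, mul_assoc, i1]
        simp only [← mul_assoc, i1]
        abel
      · change Commute _ (R 2)
        rw [h2]
        exact Commute.zero_right _)
  have h01 : R 0 (R 1 x) = (a : ℂ) • x := by
    rw [← ha x]
    simp only [ContinuousLinearMap.add_apply, ContinuousLinearMap.sub_apply,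
      ContinuousLinearMap.mul_apply, one_apply_eq_self, hx]
    abel
  have hinner : inner ℂ (R 1 x) x = (a : ℂ) := by
    calc inner ℂ (R 1 x) x = inner ℂ (R 1 x) (R 0 x) := by rw [hx]
      _ = inner ℂ (R 0 (R 1 x)) x := ((hR 0).inner_left _ _).symm
      _ = (a : ℂ) := by
        rw [h01, inner_smul_left, inner_self_eq_norm_sq_to_K, hx1]
        simp
  have hn1 : ‖R 1 x‖ ^ 2 = a := by
    have h : inner ℂ (R 1 x) (R 1 x) = (a : ℂ) := by
      rw [← hinner, ← (hR 1).inner_left, (hR 1).apply_apply]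
    rw [@norm_sq_eq_re_inner ℂ, h]
    simp
  have hn2 : ‖x - R 1 x‖ ^ 2 = 1 - a := by
    rw [@norm_sub_sq ℂ, hn1, hx1, ← inner_conj_symm, hinner]
    simp
    ring
  -- Here a = ‖R 1 x‖² lies in [0, 1]; at either endpoint x is an eigenvector of `R 1` as well and
  -- the space is one-dimensional.
  rcases (hn1 ▸ sq_nonneg ‖R 1 x‖ : 0 ≤ a).eq_or_lt with ha0 | ha0
  · rw [← ha0, sq_eq_zero_iff, norm_eq_zero] at hn1
    refine Or.inl (exists_charProjections hR hirr hx0 fun k => ?_)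
    fin_cases k
    · exact ⟨1, hx.trans (one_smul _ _).symm⟩
    · exact hn1 ▸ zero x
    · exact h2' x
  rcases (sub_nonneg.1 (hn2 ▸ sq_nonneg ‖x - R 1 x‖) : a ≤ 1).eq_or_lt with ha1 | ha1
  · rw [ha1, sub_self, sq_eq_zero_iff, norm_eq_zero, sub_eq_zero] at hn2
    refine Or.inl (exists_charProjections hR hirr hx0 fun k => ?_)
    fin_cases k
    · exact ⟨1, hx.trans (one_smul _ _).symm⟩
    · exact ⟨1, hn2.symm.trans (one_smul _ _).symm⟩
    · exact h2' x
  exact Or.inr (exists_angleProjections hR hirr hx1 hx h01 h2 ha0 ha1)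

end Model

end SubspaceProblem

end

noncomputable section

namespace SubspaceProblem

open Vertex

/-- Transport of a realization along a unitary operator. -/
theorem IsRealization.congr {m r : ℕ} {τ : Fin (m + r) → ℝ} {S : SubspaceSystem.{u} (Vertex m r)}
    {K K' : Type*} [NormedAddCommGroup K] [InnerProductSpace ℂ K] [NormedAddCommGroup K']
    [InnerProductSpace ℂ K'] {Q : Fin m → K →L[ℂ] K} {Q' : Fin m → K' →L[ℂ] K'}
    {g : Vertex m r → K →L[ℂ] S.carrier} (h : IsRealization S τ Q g) (W : K ≃ₗᵢ[ℂ] K')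
    (hW : ∀ k x, W (Q k x) = Q' k (W x)) :
    IsRealization S τ Q' fun i => g i ∘L (W.symm.toContinuousLinearEquiv : K' →L[ℂ] K) where
  mem_iff i x := by
    rw [h.mem_iff]
    constructor
    · rintro ⟨y, rfl⟩
      exact ⟨W y, congrArg (g i) (W.symm_apply_apply y)⟩
    · rintro ⟨y, rfl⟩
      exact ⟨_, rfl⟩
  gram i j x y := by
    refine (h.gram i j _ _).trans ?_
    rw [← W.inner_map_map, IsRealization.map_starBlocks W hW]
    change inner ℂ (starBlocks τ Q' j i (W (W.symm x))) (W (W.symm y)) = _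
    rw [W.apply_symm_apply, W.apply_symm_apply]
  dense := by
    refine h.dense.mono ?_
    rintro _ ⟨x, rfl⟩
    refine ⟨fun i => W (x i), ?_⟩
    simp [synth_apply]

/-! ### The Schur complement for the given weights. -/

section Example

variable {τ₀ : ℝ} {K : Type*} [NormedAddCommGroup K] [InnerProductSpace ℂ K]
  {R : Fin 3 → K →L[ℂ] K}

theorem exampleTau_ne_zero (h : τ₀ ≠ 0) (j : Fin (3 + 1)) : exampleTau τ₀ j ≠ 0 := by
  fin_cases j <;> simp [exampleTau, h]

/-- The squared weights are τ₀² times 1, 2, 4 and 9, and the coefficient at pair k is 2 - Q_k = 1 +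
R_k; the constant parts add up to 16. -/
theorem schurOp_exampleTau (h : τ₀ ≠ 0) (x : K) :
    schurOp (exampleTau τ₀) (fun k => 1 - R k) x =
      ((τ₀ ^ 2 : ℝ) : ℂ) • (((1 / τ₀ ^ 2 - 16 : ℝ) : ℂ) • x - R 0 x - (2 : ℂ) • R 1 x -
        (4 : ℂ) • R 2 x) := by
  have e0 : exampleTau τ₀ (Fin.castAdd 1 0) ^ 2 = τ₀ ^ 2 := rfl
  have e1 : exampleTau τ₀ (Fin.castAdd 1 1) ^ 2 = 2 * τ₀ ^ 2 := by
    change (√2 * τ₀) ^ 2 = _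
    rw [mul_pow, Real.sq_sqrt (by norm_num)]
  have e2 : exampleTau τ₀ (Fin.castAdd 1 2) ^ 2 = 4 * τ₀ ^ 2 := by
    change (2 * τ₀) ^ 2 = _
    ring
  have e3 : exampleTau τ₀ (Fin.natAdd 3 0) ^ 2 = 9 * τ₀ ^ 2 := by
    change (3 * τ₀) ^ 2 = _
    ring
  have h' : (τ₀ : ℂ) ≠ 0 := by exact_mod_cast h
  have e4 : ((τ₀ ^ 2 : ℝ) : ℂ) * ((1 / τ₀ ^ 2 - 16 : ℝ) : ℂ) = 1 - 16 * ((τ₀ ^ 2 : ℝ) : ℂ) := by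
    push_cast
    field_simp
  simp only [schurOp_apply, Fin.sum_univ_three, Finset.univ_unique, Finset.sum_singleton,
    Fin.default_eq_zero, e0, e1, e2, e3, ContinuousLinearMap.sub_apply,
    one_apply_eq_self, smul_sub, smul_smul, e4]
  push_cast
  module

theorem re_inner_schurOp_exampleTau [CompleteSpace K] (hR : ∀ k, IsStarProjection (R k))
    (h : τ₀ ≠ 0) (x : K) :
    RCLike.re (inner ℂ (schurOp (exampleTau τ₀) (fun k => 1 - R k) x) x) =
      τ₀ ^ 2 * ((1 / τ₀ ^ 2 - 16) * ‖x‖ ^ 2 -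
        (‖R 0 x‖ ^ 2 + 2 * ‖R 1 x‖ ^ 2 + 4 * ‖R 2 x‖ ^ 2)) := by
  have hn : ∀ k, inner ℂ (R k x) x = ((‖R k x‖ ^ 2 : ℝ) : ℂ) := by
    intro k
    have := inner_self_eq_norm_sq_to_K (𝕜 := ℂ) (R k x)
    rw [(hR k).inner_left, (hR k).apply_apply, ← (hR k).inner_left] at this
    rw [this]
    push_cast
    rfl
  have hx : inner ℂ x x = ((‖x‖ ^ 2 : ℝ) : ℂ) := by
    rw [inner_self_eq_norm_sq_to_K]
    push_cast
    rfl
  rw [schurOp_exampleTau h, inner_smul_left, inner_sub_left, inner_sub_left, inner_sub_left,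
    inner_smul_left, inner_smul_left, inner_smul_left, hn, hn, hn, hx, Complex.conj_ofReal,
    Complex.conj_ofReal, Complex.conj_ofNat, Complex.conj_ofNat]
  have : ((τ₀ ^ 2 : ℝ) : ℂ) * (((1 / τ₀ ^ 2 - 16 : ℝ) : ℂ) * ((‖x‖ ^ 2 : ℝ) : ℂ) -
      ((‖R 0 x‖ ^ 2 : ℝ) : ℂ) - 2 * ((‖R 1 x‖ ^ 2 : ℝ) : ℂ) - 4 * ((‖R 2 x‖ ^ 2 : ℝ) : ℂ)) =
      ((τ₀ ^ 2 * ((1 / τ₀ ^ 2 - 16) * ‖x‖ ^ 2 -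
        (‖R 0 x‖ ^ 2 + 2 * ‖R 1 x‖ ^ 2 + 4 * ‖R 2 x‖ ^ 2)) : ℝ) : ℂ) := by
    push_cast
    ring
  rw [this]
  exact Complex.ofReal_re _

theorem re_inner_schurOp_exampleTau_nonneg_iff [CompleteSpace K] (hR : ∀ k, IsStarProjection (R k))
    (h : τ₀ ≠ 0) (x : K) :
    0 ≤ RCLike.re (inner ℂ (schurOp (exampleTau τ₀) (fun k => 1 - R k) x) x) ↔
      ‖R 0 x‖ ^ 2 + 2 * ‖R 1 x‖ ^ 2 + 4 * ‖R 2 x‖ ^ 2 ≤ (1 / τ₀ ^ 2 - 16) * ‖x‖ ^ 2 := by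
  rw [re_inner_schurOp_exampleTau hR h, mul_nonneg_iff_of_pos_left (by positivity), sub_nonneg]

end Example

/-! ### One-dimensional triples. -/

section CharModel

theorem isStarProjection_charProjections (n : Fin 8) (k : Fin 3) :
    IsStarProjection (charProjections n k) := by
  rw [charProjections]
  split_ifs
  · exact .one _
  · exact .zero _

/-- The coefficients 1, 2, 4 are the binary place values, so the operator R₁ + 2R₂ + 4R₃ is
multiplication by n. -/
theorem charProjections_norm (n : Fin 8) (x : EuclideanSpace ℂ (Fin 1)) :
    ‖charProjections n 0 x‖ ^ 2 + 2 * ‖charProjections n 1 x‖ ^ 2 +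
      4 * ‖charProjections n 2 x‖ ^ 2 = (n : ℕ) * ‖x‖ ^ 2 := by
  have e : ∀ k : Fin 3, ‖charProjections n k x‖ ^ 2 =
      (if (n : ℕ).testBit k then 1 else 0) * ‖x‖ ^ 2 := by
    intro k
    rw [charProjections]
    split_ifs <;> simp
  have hn : ∀ n : Fin 8, (if (n : ℕ).testBit (0 : Fin 3) then 1 else 0) +
      2 * (if (n : ℕ).testBit (1 : Fin 3) then 1 else 0) +
      4 * (if (n : ℕ).testBit (2 : Fin 3) then 1 else 0) = (n : ℕ) := by decide
  rw [e, e, e]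
  conv_rhs => rw [← hn n]
  push_cast
  ring

theorem charProjections_sum (n : Fin 8) (x : EuclideanSpace ℂ (Fin 1)) :
    charProjections n 0 x + (2 : ℂ) • charProjections n 1 x + (4 : ℂ) • charProjections n 2 x =
      ((n : ℕ) : ℂ) • x := by
  have e : ∀ k : Fin 3, charProjections n k x =
      ((if (n : ℕ).testBit k then 1 else 0 : ℕ) : ℂ) • x := by
    intro k
    rw [charProjections]
    split_ifs <;> simp
  have hn : ∀ n : Fin 8, (if (n : ℕ).testBit (0 : Fin 3) then 1 else 0) +
      2 * (if (n : ℕ).testBit (1 : Fin 3) then 1 else 0) +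
      4 * (if (n : ℕ).testBit (2 : Fin 3) then 1 else 0) = (n : ℕ) := by decide
  rw [e, e, e]
  conv_rhs => rw [← hn n]
  push_cast
  module

theorem charProjections_injective {n n' : Fin 8} (h : ∀ k, charProjections n k = charProjections n' k) :
    n = n' := by
  have h1 : ∀ k : Fin 3, (n : ℕ).testBit k = (n' : ℕ).testBit k := by
    intro k
    have h2 := h k
    rw [charProjections, charProjections] at h2
    cases e : (n : ℕ).testBit k <;> cases e' : (n' : ℕ).testBit k <;> simp [e, e'] at h2 ⊢
  clear h
  revert n n'
  decide

theorem finrank_ker_charProjections (n : Fin 8) (k : Fin 3) :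
    Module.finrank ℂ (LinearMap.ker (charProjections n k).toLinearMap) =
      if (n : ℕ).testBit k then 0 else 1 := by
  by_cases h : (n : ℕ).testBit k
  · have h1 : LinearMap.ker (charProjections n k).toLinearMap = ⊥ := by
      ext x
      simp [charProjections, h]
    rw [h1, finrank_bot, if_pos h]
  · have h1 : LinearMap.ker (charProjections n k).toLinearMap = ⊤ := by
      ext x
      simp [charProjections, h]
    rw [h1, finrank_top, if_neg h]
    simp

theorem exists_eq_smul_fin_one (A : EuclideanSpace ℂ (Fin 1) →L[ℂ] EuclideanSpace ℂ (Fin 1)) :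
    ∃ c : ℂ, A = c • (1 : EuclideanSpace ℂ (Fin 1) →L[ℂ] EuclideanSpace ℂ (Fin 1)) := by
  refine ⟨A (EuclideanSpace.single 0 1) 0, ?_⟩
  ext x i
  have hx : x = x 0 • EuclideanSpace.single 0 1 := by
    ext i
    fin_cases i
    simp
  fin_cases i
  conv_lhs => rw [hx, map_smul]
  simp [mul_comm]

end CharModel

end SubspaceProblem

end

noncomputable section

namespace SubspaceProblem

open Vertex

/-! ### Triples with parameter φ in ℂ². -/

section AngleModel

theorem isStarProjection_angleProjections (φ : ℝ) (k : Fin 3) :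
    IsStarProjection (angleProjections φ k) := by
  have h := Real.sin_sq_add_cos_sq φ
  have h' : ((Real.sin φ : ℝ) : ℂ) ^ 2 + ((Real.cos φ : ℝ) : ℂ) ^ 2 = 1 := by exact_mod_cast h
  have key : ∀ A : Matrix (Fin 2) (Fin 2) ℂ, IsStarProjection A →
      IsStarProjection (Matrix.toEuclideanCLM (𝕜 := ℂ) A) := fun A hA =>
    ⟨hA.isIdempotentElem.map (Matrix.toEuclideanCLM (𝕜 := ℂ) (n := Fin 2)),
      hA.isSelfAdjoint.map (Matrix.toEuclideanCLM (𝕜 := ℂ) (n := Fin 2))⟩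
  fin_cases k
  · refine key _ ⟨?_, ?_⟩
    · rw [IsIdempotentElem]
      ext i j
      fin_cases i <;> fin_cases j <;> simp [Matrix.mul_apply]
    · rw [IsSelfAdjoint]
      ext i j
      fin_cases i <;> fin_cases j <;> simp
  · refine key _ ⟨?_, ?_⟩
    · rw [IsIdempotentElem]
      ext i j
      generalize Real.cos φ = c at *
      generalize Real.sin φ = s at *
      fin_cases i <;> fin_cases j <;> simp [Matrix.mul_apply]
      · linear_combination (c : ℂ) ^ 2 * h'
      · linear_combination (c : ℂ) * s * h'
      · linear_combination (c : ℂ) * s * h'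
      · linear_combination (s : ℂ) ^ 2 * h'
    · rw [IsSelfAdjoint]
      ext i j
      generalize Real.cos φ = c at *
      generalize Real.sin φ = s at *
      fin_cases i <;> fin_cases j <;> simp
  · exact .zero _

theorem angleProjections_norm (φ : ℝ) (v : EuclideanSpace ℂ (Fin 2)) :
    ‖angleProjections φ 0 v‖ ^ 2 + 2 * ‖angleProjections φ 1 v‖ ^ 2 +
      4 * ‖angleProjections φ 2 v‖ ^ 2 = ‖v 0‖ ^ 2 +
        2 * ‖(Real.cos φ : ℂ) * v 0 + (Real.sin φ : ℂ) * v 1‖ ^ 2 := by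
  have h := Real.sin_sq_add_cos_sq φ
  have e : ∀ a : ℂ, ‖(Real.cos φ : ℂ) * a‖ ^ 2 + ‖(Real.sin φ : ℂ) * a‖ ^ 2 = ‖a‖ ^ 2 := by
    intro a
    rw [norm_mul, norm_mul, Complex.norm_real, Complex.norm_real, mul_pow, mul_pow,
      Real.norm_eq_abs, Real.norm_eq_abs, sq_abs, sq_abs]
    linear_combination ‖a‖ ^ 2 * h
  rw [angleProjections_zero, angleProjections_one, angleProjections_two, EuclideanSpace.norm_sq_eq,
    EuclideanSpace.norm_sq_eq, ← e ((Real.cos φ : ℂ) * v 0 + (Real.sin φ : ℂ) * v 1)]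
  simp only [Fin.sum_univ_two, ContinuousLinearMap.zero_apply, norm_zero, PiLp.toLp_apply,
    Matrix.cons_val_zero, Matrix.cons_val_one]
  have e1 : ((Real.cos φ ^ 2 : ℝ) : ℂ) * v 0 + ((Real.cos φ * Real.sin φ : ℝ) : ℂ) * v 1 =
      (Real.cos φ : ℂ) * ((Real.cos φ : ℂ) * v 0 + (Real.sin φ : ℂ) * v 1) := by
    push_cast; ring
  have e2 : ((Real.cos φ * Real.sin φ : ℝ) : ℂ) * v 0 + ((Real.sin φ ^ 2 : ℝ) : ℂ) * v 1 =
      (Real.sin φ : ℂ) * ((Real.cos φ : ℂ) * v 0 + (Real.sin φ : ℂ) * v 1) := by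
    push_cast; ring
  rw [e1, e2]
  ring

theorem cos_pos_of_mem {φ : ℝ} (h : φ ∈ Set.Ioo 0 (Real.pi / 2)) : 0 < Real.cos φ :=
  Real.cos_pos_of_mem_Ioo ⟨by linarith [h.1, Real.pi_pos], h.2⟩

theorem sin_pos_of_mem {φ : ℝ} (h : φ ∈ Set.Ioo 0 (Real.pi / 2)) : 0 < Real.sin φ :=
  Real.sin_pos_of_pos_of_lt_pi h.1 (by linarith [h.2, Real.pi_pos])

/-- The left side is the determinant of c - R₁ - 2R₂. -/
theorem angle_det (φ c : ℝ) : (c - 1 - 2 * Real.cos φ ^ 2) * (c - 2 * Real.sin φ ^ 2) -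
    4 * (Real.cos φ * Real.sin φ) ^ 2 = (c - 1) * (c - 2) - 2 * Real.cos φ ^ 2 := by
  have h := Real.sin_sq_add_cos_sq φ
  rw [mul_pow]
  linear_combination (2 - 2 * c) * h

/-- The condition `R₁ + 2 R₂ ≤ c` for the projections with parameter `φ`. -/
theorem angleProjections_le_iff {φ c : ℝ} (hφ : φ ∈ Set.Ioo 0 (Real.pi / 2)) :
    (∀ v, ‖angleProjections φ 0 v‖ ^ 2 + 2 * ‖angleProjections φ 1 v‖ ^ 2 +
      4 * ‖angleProjections φ 2 v‖ ^ 2 ≤ c * ‖v‖ ^ 2) ↔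
      3 / 2 ≤ c ∧ 2 * Real.cos φ ^ 2 ≤ (c - 1) * (c - 2) := by
  have hc := cos_pos_of_mem hφ
  have hs := sin_pos_of_mem hφ
  have h := Real.sin_sq_add_cos_sq φ
  have hdet := angle_det φ c
  simp only [angleProjections_norm]
  simp only [EuclideanSpace.norm_sq_eq, Fin.sum_univ_two]
  generalize Real.cos φ = p at *
  generalize Real.sin φ = q at *
  have hpq := mul_pos hc hs
  constructor
  · intro H
    -- Real vectors suffice for necessity: this is the quadratic form of the matrix of c - R₁ - 2R₂,
    -- with diagonal entries A, D and off-diagonal entry -2pq. Its trace 2c - 3 gives the first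
    -- condition.
    have H' : ∀ a b : ℝ, 0 ≤ (c - 1 - 2 * p ^ 2) * a ^ 2 - 4 * (p * q) * (a * b) +
        (c - 2 * q ^ 2) * b ^ 2 := by
      intro a b
      have h1 := H !₂[(a : ℂ), (b : ℂ)]
      have h2 : (p : ℂ) * a + q * b = ((p * a + q * b : ℝ) : ℂ) := by push_cast; rfl
      simp only [PiLp.toLp_apply, Matrix.cons_val_zero, Matrix.cons_val_one, h2,
        Complex.norm_real, Real.norm_eq_abs, sq_abs] at h1
      linarith
    have hA := H' 1 0
    have hD := H' 0 1
    simp only [one_pow, mul_one, mul_zero, ne_eq, OfNat.ofNat_ne_zero, not_false_eq_true, zero_pow,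
      sub_zero, add_zero, zero_add, zero_mul] at hA hD
    refine ⟨by linarith, ?_⟩
    set A := c - 1 - 2 * p ^ 2
    set D := c - 2 * q ^ 2
    -- On these vectors the form takes the values A·det and D·det. A negative determinant would
    -- force A = D = 0, and then the vector (1, 1) gives -4pq < 0.
    have h3 := H' (2 * (p * q)) A
    have h4 := H' D (2 * (p * q))
    have h5 := H' 1 1
    by_contra! h6
    have h7 : A * D - 4 * (p * q) ^ 2 < 0 := by linarith
    have h8 : A * (A * D - 4 * (p * q) ^ 2) = A * (2 * (p * q)) ^ 2 - 4 * (p * q) * (2 * (p * q) * A)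
      + D * A ^ 2 := by ring
    have h9 : D * (A * D - 4 * (p * q) ^ 2) = A * D ^ 2 - 4 * (p * q) * (D * (2 * (p * q)))
      + D * (2 * (p * q)) ^ 2 := by ring
    have hA0 : A = 0 := le_antisymm (not_lt.1 fun h0 => by nlinarith) hA
    have hD0 : D = 0 := le_antisymm (not_lt.1 fun h0 => by nlinarith) hD
    rw [hA0, hD0] at h5
    linarith
  · rintro ⟨h1, h2⟩ v
    set A := c - 1 - 2 * p ^ 2 with hA
    set D := c - 2 * q ^ 2 with hD
    have h3 : 0 ≤ A * D - 4 * (p * q) ^ 2 := by linarith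
    have h4 : 0 ≤ A + D := by linarith
    -- The product AD is at least 4(pq)² > 0 and the trace is nonnegative, so A > 0 and the square
    -- can be completed in the first variable.
    have h5 : 0 < A * D := by nlinarith
    have h6 : 0 < A := by
      by_contra! h6
      nlinarith
    have h7 : A * (A * ‖v 0‖ ^ 2 + D * ‖v 1‖ ^ 2 - 4 * (p * q) * (inner ℝ (v 0) (v 1))) =
        ‖A • v 0 - (2 * (p * q)) • v 1‖ ^ 2 + (A * D - 4 * (p * q) ^ 2) * ‖v 1‖ ^ 2 := by
      rw [@norm_sub_sq ℝ, norm_smul, norm_smul, inner_smul_left, inner_smul_right, mul_pow, mul_pow,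
        Real.norm_eq_abs, Real.norm_eq_abs, sq_abs, sq_abs]
      simp only [conj_trivial, RCLike.re_to_real]
      ring
    have h8 : 0 ≤ A * ‖v 0‖ ^ 2 + D * ‖v 1‖ ^ 2 - 4 * (p * q) * (inner ℝ (v 0) (v 1)) :=
      nonneg_of_mul_nonneg_right (h7 ▸ add_nonneg (sq_nonneg _) (mul_nonneg h3 (sq_nonneg _))) h6
    have h9 : ‖(p : ℂ) * v 0 + q * v 1‖ ^ 2 = p ^ 2 * ‖v 0‖ ^ 2 + q ^ 2 * ‖v 1‖ ^ 2 +
        2 * (p * q) * (inner ℝ (v 0) (v 1)) := by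
      rw [← Complex.real_smul, ← Complex.real_smul, @norm_add_sq ℝ, norm_smul, norm_smul,
        inner_smul_left, inner_smul_right, mul_pow, mul_pow, Real.norm_eq_abs, Real.norm_eq_abs,
        sq_abs, sq_abs]
      simp only [conj_trivial, RCLike.re_to_real]
      ring
    rw [h9]
    linarith

theorem finrank_ker_angleProjections {φ : ℝ} (hφ : φ ∈ Set.Ioo 0 (Real.pi / 2)) (k : Fin 3) :
    Module.finrank ℂ (LinearMap.ker (angleProjections φ k).toLinearMap) =
      if k = 2 then 2 else 1 := by
  have hc : ((Real.cos φ : ℝ) : ℂ) ≠ 0 := by exact_mod_cast (cos_pos_of_mem hφ).ne'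
  have hs : ((Real.sin φ : ℝ) : ℂ) ≠ 0 := by exact_mod_cast (sin_pos_of_mem hφ).ne'
  fin_cases k
  · have h : LinearMap.ker (angleProjections φ 0).toLinearMap =
        Submodule.span ℂ {!₂[(0 : ℂ), 1]} := by
      ext v
      rw [LinearMap.mem_ker, Submodule.mem_span_singleton]
      change angleProjections φ 0 v = 0 ↔ _
      rw [angleProjections_zero]
      constructor
      · intro h
        have h0 : v 0 = 0 := congrArg (fun w : EuclideanSpace ℂ (Fin 2) => w 0) h
        refine ⟨v 1, ?_⟩
        ext i
        fin_cases i <;> simp [h0]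
      · rintro ⟨a, rfl⟩
        ext i
        fin_cases i <;> simp
    change Module.finrank ℂ (LinearMap.ker (angleProjections φ 0).toLinearMap) = 1
    rw [h]
    refine finrank_span_singleton fun h => ?_
    have := congrArg (fun w : EuclideanSpace ℂ (Fin 2) => w 1) h
    simp at this
  · have h : LinearMap.ker (angleProjections φ 1).toLinearMap =
        Submodule.span ℂ {!₂[-((Real.sin φ : ℝ) : ℂ), ((Real.cos φ : ℝ) : ℂ)]} := by
      ext v
      rw [LinearMap.mem_ker, Submodule.mem_span_singleton]
      change angleProjections φ 1 v = 0 ↔ _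
      rw [angleProjections_one]
      constructor
      · intro h
        have h0 : ((Real.cos φ ^ 2 : ℝ) : ℂ) * v 0 +
            ((Real.cos φ * Real.sin φ : ℝ) : ℂ) * v 1 = 0 :=
          congrArg (fun w : EuclideanSpace ℂ (Fin 2) => w 0) h
        push_cast at h0
        have h1 : (Real.cos φ : ℂ) * v 0 + (Real.sin φ : ℂ) * v 1 = 0 := by
          refine (mul_eq_zero.1 ?_).resolve_left hc
          rw [← h0]
          push_cast
          ring
        have h2 : v 0 = -((Real.sin φ : ℝ) : ℂ) * (v 1 / (Real.cos φ : ℂ)) := by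
          field_simp
          linear_combination h1
        refine ⟨v 1 / (Real.cos φ : ℂ), ?_⟩
        ext i
        fin_cases i
        · simp only [Fin.zero_eta, PiLp.smul_apply, PiLp.toLp_apply, Matrix.cons_val_zero,
            smul_eq_mul]
          rw [h2]
          ring
        · simp only [Fin.mk_one, PiLp.smul_apply, PiLp.toLp_apply, Matrix.cons_val_one,
            smul_eq_mul]
          exact div_mul_cancel₀ _ hc
      · rintro ⟨a, rfl⟩
        ext i
        fin_cases i <;> simp <;> ring
    change Module.finrank ℂ (LinearMap.ker (angleProjections φ 1).toLinearMap) = 1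
    rw [h]
    refine finrank_span_singleton fun h => hc ?_
    exact congrArg (fun w : EuclideanSpace ℂ (Fin 2) => w 1) h
  · have h : LinearMap.ker (angleProjections φ 2).toLinearMap = ⊤ := by
      rw [angleProjections_two]
      ext v
      simp
    change Module.finrank ℂ (LinearMap.ker (angleProjections φ 2).toLinearMap) = 2
    rw [h, finrank_top]
    simp

/-- The coordinates of `c - R₁ - 2 R₂ - 4 R₃`. -/
theorem angleProjections_combination (φ c : ℝ) (v : EuclideanSpace ℂ (Fin 2)) :
    ((c : ℂ) • v - angleProjections φ 0 v - (2 : ℂ) • angleProjections φ 1 v -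
      (4 : ℂ) • angleProjections φ 2 v) =
    !₂[((c - 1 - 2 * Real.cos φ ^ 2 : ℝ) : ℂ) * v 0 -
        ((2 * (Real.cos φ * Real.sin φ) : ℝ) : ℂ) * v 1,
      ((c - 2 * Real.sin φ ^ 2 : ℝ) : ℂ) * v 1 -
        ((2 * (Real.cos φ * Real.sin φ) : ℝ) : ℂ) * v 0] := by
  rw [angleProjections_zero, angleProjections_one, angleProjections_two]
  ext i
  fin_cases i
  · simp
    ring
  · simp
    ring

/-- The dimension of the kernel of `c - R₁ - 2 R₂`. -/
theorem finrank_ker_combination {φ c : ℝ} (hφ : φ ∈ Set.Ioo 0 (Real.pi / 2)) {τ₀ : ℝ}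
    (h : τ₀ ≠ 0) (hc : c = 1 / τ₀ ^ 2 - 16) :
    Module.finrank ℂ (LinearMap.ker
      (schurOp (exampleTau τ₀) fun k => 1 - angleProjections φ k).toLinearMap) =
      if 2 * Real.cos φ ^ 2 = (c - 1) * (c - 2) then 1 else 0 := by
  have hp := cos_pos_of_mem hφ
  have hs := sin_pos_of_mem hφ
  have hdet := angle_det φ c
  have hker : ∀ v, v ∈ LinearMap.ker
      (schurOp (exampleTau τ₀) fun k => 1 - angleProjections φ k).toLinearMap ↔
      ((c - 1 - 2 * Real.cos φ ^ 2 : ℝ) : ℂ) * v 0 =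
        ((2 * (Real.cos φ * Real.sin φ) : ℝ) : ℂ) * v 1 ∧
      ((c - 2 * Real.sin φ ^ 2 : ℝ) : ℂ) * v 1 =
        ((2 * (Real.cos φ * Real.sin φ) : ℝ) : ℂ) * v 0 := by
    intro v
    have hτ : ((τ₀ ^ 2 : ℝ) : ℂ) ≠ 0 := by exact_mod_cast pow_ne_zero 2 h
    rw [LinearMap.mem_ker]
    change schurOp (exampleTau τ₀) (fun k => 1 - angleProjections φ k) v = 0 ↔ _
    rw [schurOp_exampleTau h, smul_eq_zero_iff_right hτ, ← hc, angleProjections_combination]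
    constructor
    · intro h
      exact ⟨sub_eq_zero.1 (congrArg (fun w : EuclideanSpace ℂ (Fin 2) => w 0) h),
        sub_eq_zero.1 (congrArg (fun w : EuclideanSpace ℂ (Fin 2) => w 1) h)⟩
    · rintro ⟨h1, h2⟩
      rw [h1, h2, sub_self, sub_self]
      ext i
      fin_cases i <;> rfl
  set A := c - 1 - 2 * Real.cos φ ^ 2
  set D := c - 2 * Real.sin φ ^ 2
  have hpq : 0 < 2 * (Real.cos φ * Real.sin φ) := by positivity
  have hd : A * D = (2 * (Real.cos φ * Real.sin φ)) ^ 2 + ((c - 1) * (c - 2) -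
      2 * Real.cos φ ^ 2) := by linarith
  set e := 2 * (Real.cos φ * Real.sin φ)
  have he : (e : ℂ) ≠ 0 := by exact_mod_cast hpq.ne'
  split_ifs with h1
  · rw [h1, sub_self, add_zero] at hd
    have hd' : (A : ℂ) * D = (e : ℂ) ^ 2 := by exact_mod_cast hd
    have hspan : LinearMap.ker
        (schurOp (exampleTau τ₀) fun k => 1 - angleProjections φ k).toLinearMap =
        Submodule.span ℂ {!₂[(e : ℂ), (A : ℂ)]} := by
      ext v
      rw [hker, Submodule.mem_span_singleton]
      constructor
      · rintro ⟨h2, h3⟩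
        refine ⟨v 0 / e, ?_⟩
        ext i
        fin_cases i
        · exact div_mul_cancel₀ _ he
        · change v 0 / e * A = v 1
          field_simp
          linear_combination h2
      · rintro ⟨a, rfl⟩
        simp only [PiLp.smul_apply, PiLp.toLp_apply, Matrix.cons_val_zero, Matrix.cons_val_one,
          smul_eq_mul]
        refine ⟨by ring, ?_⟩
        linear_combination a * hd'
    rw [hspan]
    refine finrank_span_singleton fun h => he ?_
    exact congrArg (fun w : EuclideanSpace ℂ (Fin 2) => w 0) h
  · have hne : A * D - e ^ 2 ≠ 0 := fun h => h1 (by linarith)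
    have hne' : (A : ℂ) * D - (e : ℂ) ^ 2 ≠ 0 := by exact_mod_cast hne
    have hbot : LinearMap.ker
        (schurOp (exampleTau τ₀) fun k => 1 - angleProjections φ k).toLinearMap = ⊥ := by
      refine (Submodule.eq_bot_iff _).2 fun v hv => ?_
      obtain ⟨h2, h3⟩ := (hker v).1 hv
      have h4 : v 0 = 0 := by
        refine (mul_eq_zero.1 ?_).resolve_left hne'
        linear_combination (D : ℂ) * h2 + (e : ℂ) * h3
      have h5 : v 1 = 0 := by
        refine (mul_eq_zero.1 ?_).resolve_left he
        rw [← h2, h4, mul_zero]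
      ext i
      fin_cases i
      · exact h4
      · exact h5
    rw [hbot, finrank_bot]

/-- Commuting with R₁ makes the matrix diagonal; commuting with R₂, whose off-diagonal entry is
nonzero, makes its diagonal entries equal. -/
theorem angleProjections_irreducible {φ : ℝ} (hφ : φ ∈ Set.Ioo 0 (Real.pi / 2))
    (A : EuclideanSpace ℂ (Fin 2) →L[ℂ] EuclideanSpace ℂ (Fin 2))
    (hA : ∀ k x, A (angleProjections φ k x) = angleProjections φ k (A x)) :
    ∃ c : ℂ, A = c • (1 : EuclideanSpace ℂ (Fin 2) →L[ℂ] EuclideanSpace ℂ (Fin 2)) := by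
  have hcs : ((Real.cos φ * Real.sin φ : ℝ) : ℂ) ≠ 0 := by
    exact_mod_cast (mul_pos (cos_pos_of_mem hφ) (sin_pos_of_mem hφ)).ne'
  have hv : ∀ v : EuclideanSpace ℂ (Fin 2), v = v 0 • !₂[(1 : ℂ), 0] + v 1 • !₂[(0 : ℂ), 1] := by
    intro v
    ext i
    fin_cases i <;> simp
  have h0 := hA 0 !₂[(1 : ℂ), 0]
  have h1 := hA 0 !₂[(0 : ℂ), 1]
  have h2 := hA 1 !₂[(1 : ℂ), 0]
  rw [angleProjections_zero, angleProjections_zero] at h0 h1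
  have e0 : !₂[(!₂[(1 : ℂ), 0] : EuclideanSpace ℂ (Fin 2)) 0, 0] = !₂[(1 : ℂ), 0] := rfl
  have e1 : !₂[(!₂[(0 : ℂ), 1] : EuclideanSpace ℂ (Fin 2)) 0, 0] =
      (0 : EuclideanSpace ℂ (Fin 2)) := by
    ext i
    fin_cases i <;> rfl
  rw [e0] at h0
  rw [e1, map_zero] at h1
  have a01 : A !₂[(1 : ℂ), 0] 1 = 0 := congrArg (fun w : EuclideanSpace ℂ (Fin 2) => w 1) h0
  have a10 : A !₂[(0 : ℂ), 1] 0 = 0 := (congrArg (fun w : EuclideanSpace ℂ (Fin 2) => w 0) h1).symm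
  rw [hv (angleProjections φ 1 _), map_add, map_smul, map_smul] at h2
  have h3 := congrArg (fun w : EuclideanSpace ℂ (Fin 2) => w 1) h2
  simp only [angleProjections_one, PiLp.add_apply, PiLp.smul_apply, PiLp.toLp_apply,
    Matrix.cons_val_zero, Matrix.cons_val_one, smul_eq_mul, a01] at h3
  have h4 : A !₂[(0 : ℂ), 1] 1 = A !₂[(1 : ℂ), 0] 0 := by
    refine mul_left_cancel₀ hcs ?_
    linear_combination h3
  refine ⟨A !₂[(1 : ℂ), 0] 0, ?_⟩
  ext v i
  conv_lhs => rw [hv v, map_add, map_smul, map_smul]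
  fin_cases i
  · simp [a10, mul_comm]
  · simp [a01, h4, mul_comm]

/-- The identity R₁R₂R₁ = cos²φ · R₁ shows that cos²φ is a unitary invariant, and cosine is
injective on the interval. -/
theorem angleProjections_inj {φ φ' : ℝ} (hφ : φ ∈ Set.Ioo 0 (Real.pi / 2))
    (hφ' : φ' ∈ Set.Ioo 0 (Real.pi / 2))
    (W : EuclideanSpace ℂ (Fin 2) ≃ₗᵢ[ℂ] EuclideanSpace ℂ (Fin 2))
    (hW : ∀ k x, W (angleProjections φ k x) = angleProjections φ' k (W x)) : φ = φ' := by
  have key : ∀ (φ : ℝ) (v : EuclideanSpace ℂ (Fin 2)),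
      angleProjections φ 0 (angleProjections φ 1 (angleProjections φ 0 v)) =
        ((Real.cos φ ^ 2 : ℝ) : ℂ) • angleProjections φ 0 v := by
    intro φ v
    simp only [angleProjections_zero, angleProjections_one]
    ext i
    fin_cases i <;> simp
  have h1 := congrArg W (key φ !₂[(1 : ℂ), 0])
  rw [map_smul, hW, hW, hW, key, ← sub_eq_zero, ← sub_smul, ← hW] at h1
  have h2 : angleProjections φ 0 !₂[(1 : ℂ), 0] ≠ 0 := by
    rw [angleProjections_zero]
    intro h
    have := congrArg (fun w : EuclideanSpace ℂ (Fin 2) => w 0) h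
    simp at this
  have h3 := (smul_eq_zero.1 h1).resolve_right fun h => h2 (W.map_eq_zero_iff.1 h)
  have h4 : Real.cos φ' ^ 2 = Real.cos φ ^ 2 := by exact_mod_cast sub_eq_zero.1 h3
  have h5 : Real.cos φ = Real.cos φ' :=
    ((pow_left_inj₀ (cos_pos_of_mem hφ').le (cos_pos_of_mem hφ).le two_ne_zero).1 h4).symm
  exact Real.injOn_cos ⟨hφ.1.le, by linarith [hφ.2, Real.pi_pos]⟩
    ⟨hφ'.1.le, by linarith [hφ'.2, Real.pi_pos]⟩ h5

end AngleModel

end SubspaceProblem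

end

/-! ### Parameters of systems: existence, uniqueness, dimensions, exhaustion. -/

noncomputable section

namespace SubspaceProblem

open Vertex

/-- The system is given by the one-dimensional projections with binary digits of `n`, or by the
projections in `ℂ²` with parameter `φ`. -/
def IsModel (τ₀ : ℝ) (l : Fin 8 ⊕ ℝ) (S : SubspaceSystem.{u} (Vertex 3 1)) : Prop :=
  match l with
  | .inl n => ∃ g, IsRealization S (exampleTau τ₀) (fun k => 1 - charProjections n k) g
  | .inr φ => φ ∈ Set.Ioo 0 (Real.pi / 2) ∧
      ∃ g, IsRealization S (exampleTau τ₀) (fun k => 1 - angleProjections φ k) g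

/-- The parameters for which there is a system. -/
def Allowed (c : ℝ) : Fin 8 ⊕ ℝ → Prop
  | .inl n => ((n : ℕ) : ℝ) ≤ c
  | .inr φ => φ ∈ Set.Ioo 0 (Real.pi / 2) ∧ 3 / 2 ≤ c ∧ 2 * Real.cos φ ^ 2 ≤ (c - 1) * (c - 2)

variable {τ₀ : ℝ} {l l' : Fin 8 ⊕ ℝ}

theorem exists_isModel (h : τ₀ ≠ 0) (hl : Allowed (1 / τ₀ ^ 2 - 16) l) :
    ∃ S : ExampleSystem, IsModel τ₀ l S := by
  rcases l with n | φ
  · have hR := isStarProjection_charProjections n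
    have hB := isPositive_blockOp (τ := exampleTau τ₀) (fun k => (hR k).one_sub) fun x => by
      rw [re_inner_schurOp_exampleTau_nonneg_iff hR h, charProjections_norm]
      exact mul_le_mul_of_nonneg_right hl (sq_nonneg _)
    exact ⟨_, _, isRealization_gramSystem hB⟩
  · have hR := isStarProjection_angleProjections φ
    have hB := isPositive_blockOp (τ := exampleTau τ₀) (fun k => (hR k).one_sub) fun x => by
      rw [re_inner_schurOp_exampleTau_nonneg_iff hR h]
      exact (angleProjections_le_iff hl.1).2 hl.2 x
    exact ⟨_, hl.1, _, isRealization_gramSystem hB⟩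

namespace IsModel

variable {S : SubspaceSystem.{u} (Vertex 3 1)} {S' : SubspaceSystem.{v} (Vertex 3 1)}

theorem allowed (hS : IsModel τ₀ l S) (h : τ₀ ≠ 0) : Allowed (1 / τ₀ ^ 2 - 16) l := by
  rcases l with n | φ
  · obtain ⟨g, hg⟩ := hS
    have hR := isStarProjection_charProjections n
    have h1 := re_inner_schurOp_nonneg (fun k => (hR k).one_sub) hg.gram (EuclideanSpace.single 0 1)
    rw [re_inner_schurOp_exampleTau_nonneg_iff hR h, charProjections_norm] at h1
    simpa [Allowed] using h1
  · obtain ⟨hφ, g, hg⟩ := hS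
    have hR := isStarProjection_angleProjections φ
    exact ⟨hφ, (angleProjections_le_iff hφ).1 fun v =>
      (re_inner_schurOp_exampleTau_nonneg_iff hR h v).1
        (re_inner_schurOp_nonneg (fun k => (hR k).one_sub) hg.gram v)⟩

theorem satisfies (hS : IsModel τ₀ l S) : S.Satisfies (exampleTau τ₀) := by
  rcases l with n | φ
  · obtain ⟨g, hg⟩ := hS
    exact hg.satisfies fun k => (isStarProjection_charProjections n k).one_sub
  · obtain ⟨_, g, hg⟩ := hS
    exact hg.satisfies fun k => (isStarProjection_angleProjections φ k).one_sub

theorem _root_.SubspaceProblem.IsRealization.isNonzero {m r : ℕ} {τ : Fin (m + r) → ℝ}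
    {S : SubspaceSystem.{u} (Vertex m r)} {K : Type*} [NormedAddCommGroup K]
    [InnerProductSpace ℂ K] [Nontrivial K] {Q : Fin m → K →L[ℂ] K}
    {g : Vertex m r → K →L[ℂ] S.carrier} (h : IsRealization S τ Q g) : S.IsNonzero := by
  obtain ⟨x, hx⟩ := exists_ne (0 : K)
  exact ⟨centre, (Submodule.ne_bot_iff _).2 ⟨g centre x, (h.mem_iff _ _).2 ⟨x, rfl⟩, fun h0 =>
    hx (h.injective centre (h0.trans (map_zero _).symm))⟩⟩

theorem isNonzero (hS : IsModel τ₀ l S) : S.IsNonzero := by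
  rcases l with n | φ
  · exact hS.choose_spec.isNonzero
  · exact hS.2.choose_spec.isNonzero

theorem isIrreducible (hS : IsModel τ₀ l S) (h : τ₀ ≠ 0) : S.IsIrreducible := by
  rcases l with n | φ
  · exact hS.choose_spec.isIrreducible (exampleTau_ne_zero h) fun A _ => exists_eq_smul_fin_one A
  · refine hS.2.choose_spec.isIrreducible (exampleTau_ne_zero h) fun A hA =>
      angleProjections_irreducible hS.1 A fun k x => ?_
    have h1 := hA k x
    simpa using h1

theorem unitarilyEquiv (hS : IsModel τ₀ l S) (hS' : IsModel τ₀ l S') : S.UnitarilyEquiv S' := by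
  rcases l with n | φ
  · exact hS.choose_spec.unitarilyEquiv hS'.choose_spec (.refl ℂ _) fun _ _ => rfl
  · exact hS.2.choose_spec.unitarilyEquiv hS'.2.choose_spec (.refl ℂ _) fun _ _ => rfl

/-- Equivalent systems have unitarily equivalent triples. The dimension of K separates the two kinds
of parameters; within a kind, the digits and the angle are invariants. -/
theorem eq_of_unitarilyEquiv (hS : IsModel τ₀ l S) (hS' : IsModel τ₀ l' S') (h : τ₀ ≠ 0)
    (hU : S.UnitarilyEquiv S') : l = l' := by
  have hsub : ∀ {K K' : Type} [NormedAddCommGroup K] [InnerProductSpace ℂ K] [NormedAddCommGroup K']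
      [InnerProductSpace ℂ K'] {R : Fin 3 → K →L[ℂ] K} {R' : Fin 3 → K' →L[ℂ] K'}
      {W : K ≃ₗᵢ[ℂ] K'}, (∀ k x, W ((1 - R k) x) = (1 - R' k) (W x)) →
      ∀ k x, W (R k x) = R' k (W x) := by
    intro K K' _ _ _ _ R R' W hW k x
    have h1 := hW k x
    simpa using h1
  rcases l with n | φ <;> rcases l' with n' | φ'
  · obtain ⟨g, hg⟩ := hS
    obtain ⟨g', hg'⟩ := hS'
    obtain ⟨W, hW⟩ := hg.exists_of_unitarilyEquiv hg' (exampleTau_ne_zero h) hU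
    have hW := hsub hW
    refine congrArg _ (charProjections_injective fun k => ?_)
    -- A unitary of a line is multiplication by a scalar, so it commutes with everything and the
    -- triples coincide.
    obtain ⟨c, hc⟩ := exists_eq_smul_fin_one (W.toContinuousLinearEquiv : _ →L[ℂ] _)
    ext1 x
    refine W.injective ?_
    rw [hW]
    have h1 : ∀ y, W y = c • y := fun y => congrArg (fun F : _ →L[ℂ] _ => F y) hc
    rw [h1, h1, map_smul]
  · obtain ⟨g, hg⟩ := hS
    obtain ⟨_, g', hg'⟩ := hS'
    obtain ⟨W, hW⟩ := hg.exists_of_unitarilyEquiv hg' (exampleTau_ne_zero h) hU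
    have h1 := W.toLinearEquiv.finrank_eq
    simp at h1
  · obtain ⟨_, g, hg⟩ := hS
    obtain ⟨g', hg'⟩ := hS'
    obtain ⟨W, hW⟩ := hg.exists_of_unitarilyEquiv hg' (exampleTau_ne_zero h) hU
    have h1 := W.toLinearEquiv.finrank_eq
    simp at h1
  · obtain ⟨hφ, g, hg⟩ := hS
    obtain ⟨hφ', g', hg'⟩ := hS'
    obtain ⟨W, hW⟩ := hg.exists_of_unitarilyEquiv hg' (exampleTau_ne_zero h) hU
    exact congrArg _ (angleProjections_inj hφ hφ' W (hsub hW))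

theorem correspondsToAngle {φ : ℝ} (hS : IsModel τ₀ (.inr φ) S) (h : τ₀ ≠ 0) :
    CorrespondsToAngle (exampleTau τ₀) φ S := by
  have hR := isStarProjection_angleProjections φ
  have hB := isPositive_blockOp (τ := exampleTau τ₀) (fun k => (hR k).one_sub) fun x => by
    rw [re_inner_schurOp_exampleTau_nonneg_iff hR h]
    exact (angleProjections_le_iff hS.1).2 (hS.allowed h).2 x
  exact ⟨hB, hS.unitarilyEquiv (S' := gramSystem _ hB) ⟨hS.1, _, isRealization_gramSystem hB⟩⟩

theorem card_vertex : Fintype.card (Vertex 3 1) = 8 := rfl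

/-- Out of 8 one loses one dimension for every zero digit, where Q_k = 1, and one more when n = c,
where the Schur complement vanishes. -/
theorem hasGenDim_char {n : Fin 8} (hS : IsModel τ₀ (.inl n) S) (h : τ₀ ≠ 0) {d : ℕ}
    (hd : d + ((if ((n : ℕ) : ℝ) = 1 / τ₀ ^ 2 - 16 then 1 else 0) +
      ∑ k : Fin 3, if (n : ℕ).testBit k then 0 else 1) = 8) : S.HasGenDim d 1 := by
  obtain ⟨g, hg⟩ := hS
  have hR := isStarProjection_charProjections n
  obtain ⟨hfin, h1⟩ := hg.finrank_add fun k => (hR k).one_sub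
  have hτ : ((τ₀ ^ 2 : ℝ) : ℂ) ≠ 0 := by exact_mod_cast pow_ne_zero 2 h
  have hM : ∀ x, schurOp (exampleTau τ₀) (fun k => 1 - charProjections n k) x =
      (((τ₀ ^ 2 : ℝ) : ℂ) * ((1 / τ₀ ^ 2 - 16 - ((n : ℕ) : ℝ) : ℝ) : ℂ)) • x := by
    intro x
    have h2 := charProjections_sum n x
    rw [schurOp_exampleTau h, sub_sub, sub_sub, ← add_assoc, h2, ← sub_smul, smul_smul]
    push_cast
    rfl
  have h3 : Module.finrank ℂ (LinearMap.ker
      (schurOp (exampleTau τ₀) fun k => 1 - charProjections n k).toLinearMap) =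
      if ((n : ℕ) : ℝ) = 1 / τ₀ ^ 2 - 16 then 1 else 0 := by
    split_ifs with hc
    · have h4 : LinearMap.ker
          (schurOp (exampleTau τ₀) fun k => 1 - charProjections n k).toLinearMap = ⊤ := by
        refine eq_top_iff.2 fun x _ => (hM x).trans ?_
        rw [hc, sub_self]
        simp
      rw [h4, finrank_top]
      simp
    · have h4 : LinearMap.ker
          (schurOp (exampleTau τ₀) fun k => 1 - charProjections n k).toLinearMap = ⊥ := by
        refine (Submodule.eq_bot_iff _).2 fun x hx => ?_
        have h5 := (hM x).symm.trans hx
        refine (smul_eq_zero.1 h5).resolve_left (mul_ne_zero hτ ?_)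
        exact_mod_cast sub_ne_zero.2 (Ne.symm hc)
      rw [h4, finrank_bot]
  have hk : ∀ k, Module.finrank ℂ (LinearMap.ker (1 - (1 - charProjections n k)).toLinearMap) =
      if (n : ℕ).testBit k then 0 else 1 := fun k => by
    rw [sub_sub_cancel, finrank_ker_charProjections]
  simp only [hk, h3, card_vertex,
    finrank_euclideanSpace_fin] at h1
  refine ⟨?_, fun i => ?_⟩
  · rw [← Module.finrank_eq_rank]
    congr 1
    omega
  · rw [hg.rank_space, finrank_euclideanSpace_fin]

/-- Out of 16 the ranges of Q₁, Q₂, Q₃ take 1 + 1 + 2, which leaves 12; one more is lost when det(c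
- R₁ - 2R₂) = 0. -/
theorem hasGenDim_angle {φ : ℝ} (hS : IsModel τ₀ (.inr φ) S) (h : τ₀ ≠ 0) {d : ℕ}
    (hd : d + (if 2 * Real.cos φ ^ 2 = (1 / τ₀ ^ 2 - 16 - 1) * (1 / τ₀ ^ 2 - 16 - 2)
      then 1 else 0) = 12) : S.HasGenDim d 2 := by
  obtain ⟨hφ, g, hg⟩ := hS
  have hR := isStarProjection_angleProjections φ
  obtain ⟨hfin, h1⟩ := hg.finrank_add fun k => (hR k).one_sub
  have hk : ∀ k, Module.finrank ℂ (LinearMap.ker (1 - (1 - angleProjections φ k)).toLinearMap) =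
      if k = 2 then 2 else 1 := fun k => by
    rw [sub_sub_cancel, finrank_ker_angleProjections hφ]
  simp only [hk, finrank_ker_combination hφ h rfl,
    card_vertex, finrank_euclideanSpace_fin] at h1
  have h2 : ∑ k : Fin 3, (if k = 2 then 2 else 1) = 4 := by decide
  rw [h2] at h1
  refine ⟨?_, fun i => ?_⟩
  · rw [← Module.finrank_eq_rank]
    congr 1
    omega
  · rw [hg.rank_space, finrank_euclideanSpace_fin]

end IsModel

theorem IsRealization.exists_isModel {S : SubspaceSystem.{u} (Vertex 3 1)} {K : Type*}
    [NormedAddCommGroup K] [InnerProductSpace ℂ K] [CompleteSpace K] [Nontrivial K]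
    {R : Fin 3 → K →L[ℂ] K} {g : Vertex 3 1 → K →L[ℂ] S.carrier}
    (hg : IsRealization S (exampleTau τ₀) (fun k => 1 - R k) g) (hR : ∀ k, IsStarProjection (R k))
    (hinv : ∀ M : Submodule ℂ K, IsClosed (M : Set K) → M ≠ ⊥ → (∀ k, ∀ x ∈ M, R k x ∈ M) → M = ⊤)
    (h : τ₀ ≠ 0) (hc : 1 / τ₀ ^ 2 - 16 ≤ 4) : ∃ l, IsModel τ₀ l S := by
  have hsub : ∀ {K' : Type} [NormedAddCommGroup K'] [InnerProductSpace ℂ K']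
      {R' : Fin 3 → K' →L[ℂ] K'} {W : K ≃ₗᵢ[ℂ] K'},
      (∀ k x, W (R k x) = R' k (W x)) → ∀ k x, W ((1 - R k) x) = (1 - R' k) (W x) := by
    intro K' _ _ R' W hW k x
    simp [hW]
  rcases exists_model hR hinv hc (fun x => (re_inner_schurOp_exampleTau_nonneg_iff hR h x).1
      (re_inner_schurOp_nonneg (fun k => (hR k).one_sub) hg.gram x)) with
    ⟨n, W, hW⟩ | ⟨φ, hφ, W, hW⟩
  · exact ⟨.inl n, _, hg.congr W (hsub hW)⟩
  · exact ⟨.inr φ, hφ, _, hg.congr W (hsub hW)⟩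

theorem exists_isModel_of_isIrreducible {S : SubspaceSystem.{u} (Vertex 3 1)} (h : τ₀ ≠ 0)
    (hc : 1 / τ₀ ^ 2 - 16 ≤ 4) (hS : S.Satisfies (exampleTau τ₀)) (hne : S.IsNonzero)
    (hirr : S.IsIrreducible) : ∃ l, IsModel τ₀ l S := by
  obtain ⟨Q, g, hQ, hg, hnt, hinv⟩ := exists_isRealization hS (exampleTau_ne_zero h) hne hirr
  have e : Q = fun k => 1 - (1 - Q k) := by simp
  rw [e] at hg
  refine hg.exists_isModel (fun k => (hQ k).one_sub) (fun M hM hM0 hMR => hinv M hM hM0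
    fun k x hx => ?_) h hc
  have h1 := M.sub_mem hx (hMR k x hx)
  simpa using h1

/-- A family of systems with pairwise different parameters which exhaust the allowed ones is a
classification. -/
theorem isClassification_of_isModel (h : τ₀ ≠ 0) (hc : 1 / τ₀ ^ 2 - 16 ≤ 4) {I : Type*}
    {F : I → ExampleSystem} {p : I → Fin 8 ⊕ ℝ} (hF : ∀ i, IsModel τ₀ (p i) (F i))
    (hp : Function.Injective p) (hs : ∀ l, Allowed (1 / τ₀ ^ 2 - 16) l → ∃ i, p i = l) :
    IsClassification.{u} (exampleTau τ₀) F where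
  satisfies i := (hF i).satisfies
  nonzero i := (hF i).isNonzero
  irreducible i := (hF i).isIrreducible h
  inequivalent i j hU := hp ((hF i).eq_of_unitarilyEquiv (hF j) h hU)
  exhaustive S hS hne hirr := by
    obtain ⟨l, hl⟩ := exists_isModel_of_isIrreducible h hc hS hne hirr
    obtain ⟨i, rfl⟩ := hs l (hl.allowed h)
    exact ⟨i, hl.unitarilyEquiv (hF i)⟩

/-- For negative c the inequality R₁ + 2R₂ + 4R₃ ≤ c fails at every nonzero vector, so the central
subspace is zero and with it all the others. -/
theorem not_isNonzero_of_neg {S : SubspaceSystem.{u} (Vertex 3 1)} (h : τ₀ ≠ 0)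
    (hc : 1 / τ₀ ^ 2 - 16 < 0) (hS : S.Satisfies (exampleTau τ₀)) : ¬ S.IsNonzero := by
  have hτ := exampleTau_ne_zero h
  rintro ⟨i, hi⟩
  obtain ⟨x, hx, hx0⟩ := Submodule.exists_mem_ne_zero_of_ne_bot hi
  obtain ⟨y, rfl⟩ := (normalizedProj_mem_iff hS hτ i x).1 hx
  have hQ := isStarProjection_pairOperator hS hτ
  have h1 := re_inner_schurOp_nonneg hQ (normalizedProj_gram hS hτ) y
  have h2 : pairOperator S (exampleTau τ₀) = fun k => 1 - (1 - pairOperator S (exampleTau τ₀) k) := by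
    simp
  rw [h2, re_inner_schurOp_exampleTau_nonneg_iff (fun k => (hQ k).one_sub) h] at h1
  have h3 : y = 0 := by
    by_contra h0
    have h4 : 0 < ‖y‖ ^ 2 := by positivity
    nlinarith [sq_nonneg ‖(1 - pairOperator S (exampleTau τ₀) 0) y‖,
      sq_nonneg ‖(1 - pairOperator S (exampleTau τ₀) 1) y‖,
      sq_nonneg ‖(1 - pairOperator S (exampleTau τ₀) 2) y‖]
  exact hx0 (by rw [h3, map_zero])

end SubspaceProblem

end

/-! ### The lists, according to the value of c. -/

noncomputable section

namespace SubspaceProblem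

variable {τ₀ : ℝ}

/-- The alternatives distinguish n < c, with nonsingular Schur complement, from n = c, where the
dimension drops by one. -/
theorem exists_char_family (h : τ₀ ≠ 0) {a d : ℕ} (p : Fin a → Fin 8)
    (hp : ∀ i, (((p i : ℕ) : ℝ) < 1 / τ₀ ^ 2 - 16 ∧
        d + (∑ k : Fin 3, if (p i : ℕ).testBit k then 0 else 1) = 8) ∨
      (((p i : ℕ) : ℝ) = 1 / τ₀ ^ 2 - 16 ∧
        d + (1 + ∑ k : Fin 3, if (p i : ℕ).testBit k then 0 else 1) = 8)) :
    ∃ F : Fin a → ExampleSystem, (∀ i, IsModel τ₀ (.inl (p i)) (F i)) ∧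
      ∀ i, (F i).HasGenDim d 1 := by
  have hF : ∀ i, ∃ S : ExampleSystem, IsModel τ₀ (.inl (p i)) S := fun i =>
    exists_isModel h (by rcases hp i with h | h <;> [exact h.1.le; exact h.1.le])
  choose F hF using hF
  refine ⟨F, hF, fun i => (hF i).hasGenDim_char h ?_⟩
  rcases hp i with h | h
  · rw [if_neg h.1.ne, zero_add, h.2]
  · rw [if_pos h.1, h.2]

theorem exists_angle_family (h : τ₀ ≠ 0) {I : Set ℝ} (hI : ∀ φ ∈ I, φ ∈ Set.Ioo 0 (Real.pi / 2) ∧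
      3 / 2 ≤ 1 / τ₀ ^ 2 - 16 ∧
      2 * Real.cos φ ^ 2 < (1 / τ₀ ^ 2 - 16 - 1) * (1 / τ₀ ^ 2 - 16 - 2)) :
    ∃ F : I → ExampleSystem, (∀ φ : I, IsModel τ₀ (.inr φ) (F φ)) ∧
      ∀ φ, (F φ).HasGenDim 12 2 ∧ CorrespondsToAngle (exampleTau τ₀) φ (F φ) := by
  have hF : ∀ φ : I, ∃ S : ExampleSystem, IsModel τ₀ (.inr φ) S := fun φ =>
    exists_isModel h ⟨(hI φ φ.2).1, (hI φ φ.2).2.1, (hI φ φ.2).2.2.le⟩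
  choose F hF using hF
  refine ⟨F, hF, fun φ => ⟨(hF φ).hasGenDim_angle h ?_, (hF φ).correspondsToAngle h⟩⟩
  rw [if_neg (hI φ φ.2).2.2.ne]

/-- For `c ≥ 3`, the projections with any parameter satisfy the inequality strictly. -/
theorem angle_strict {φ c : ℝ} (hφ : φ ∈ Set.Ioo 0 (Real.pi / 2)) (hc : 3 ≤ c) :
    φ ∈ Set.Ioo 0 (Real.pi / 2) ∧ 3 / 2 ≤ c ∧ 2 * Real.cos φ ^ 2 < (c - 1) * (c - 2) := by
  have h1 := sin_pos_of_mem hφ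
  have h2 := Real.sin_sq_add_cos_sq φ
  refine ⟨hφ, by linarith, ?_⟩
  have h3 : 0 < Real.sin φ ^ 2 := by positivity
  nlinarith

/-- For `c ≤ 2` no parameter satisfies the inequality. -/
theorem not_allowed_inr {φ c : ℝ} (hc : c ≤ 2) : ¬ Allowed c (.inr φ) := by
  rintro ⟨hφ, h1, h2⟩
  have h3 : 0 < Real.cos φ ^ 2 := pow_pos (cos_pos_of_mem hφ) 2
  nlinarith

theorem le_of_allowed {n : Fin 8} {c : ℝ} {N : ℕ} (h : Allowed c (.inl n)) (hc : c < N + 1) :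
    (n : ℕ) ≤ N := by
  have h1 : ((n : ℕ) : ℝ) ≤ c := h
  have h2 : ((n : ℕ) : ℝ) < ((N + 1 : ℕ) : ℝ) := by push_cast; linarith
  exact Nat.lt_succ_iff.1 (by exact_mod_cast h2)

/-- The values n = 0, …, 4 are allowed. Their dimensions are 5, 6, 6, 7 and, because 4 = c, 6 - 1 =
5. Every angle is strictly allowed. -/
theorem classification_four (h : τ₀ ≠ 0) (hc : 1 / τ₀ ^ 2 - 16 = 4) :
    ∃ (F₅ : Fin 2 → ExampleSystem) (F₆ : Fin 2 → ExampleSystem) (F₇ : Fin 1 → ExampleSystem)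
      (F₁₂ : Set.Ioo 0 (Real.pi / 2) → ExampleSystem),
      (∀ i, (F₅ i).HasGenDim 5 1) ∧ (∀ i, (F₆ i).HasGenDim 6 1) ∧ (∀ i, (F₇ i).HasGenDim 7 1) ∧
      (∀ φ, (F₁₂ φ).HasGenDim 12 2 ∧ CorrespondsToAngle (exampleTau τ₀) φ (F₁₂ φ)) ∧
      IsClassification.{u} (exampleTau τ₀) (Sum.elim F₅ (Sum.elim F₆ (Sum.elim F₇ F₁₂))) := by
  obtain ⟨F₅, h5, h5'⟩ := exists_char_family h (d := 5) ![0, 4] fun i => by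
    fin_cases i
    · exact Or.inl ⟨by norm_num at *; linarith, by decide⟩
    · exact Or.inr ⟨by norm_num at *; linarith, by decide⟩
  obtain ⟨F₆, h6, h6'⟩ := exists_char_family h (d := 6) ![1, 2] fun i => by
    fin_cases i
    · exact Or.inl ⟨by norm_num at *; linarith, by decide⟩
    · exact Or.inl ⟨by norm_num at *; linarith, by decide⟩
  obtain ⟨F₇, h7, h7'⟩ := exists_char_family h (d := 7) ![3] fun i => by
    fin_cases i
    · exact Or.inl ⟨by norm_num at *; linarith, by decide⟩
  obtain ⟨F₁₂, h12, h12'⟩ := exists_angle_family (I := Set.Ioo 0 (Real.pi / 2)) h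
    fun φ hφ => angle_strict hφ (by linarith)
  refine ⟨F₅, F₆, F₇, F₁₂, h5', h6', h7', h12', isClassification_of_isModel h (by linarith)
    (p := Sum.elim (fun i => .inl (![0, 4] i)) (Sum.elim (fun i => .inl (![1, 2] i)) (Sum.elim (fun i => .inl (![3] i)) (fun φ => .inr φ)))) ?_ ?_ ?_⟩
  · rintro (i | i | i | φ)
    exacts [h5 i, h6 i, h7 i, h12 φ]
  · rintro (i | i | i | φ) (j | j | j | ψ) hij
    all_goals first
      | (obtain rfl : φ = ψ := Subtype.ext (Sum.inr.inj hij); rfl)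
      | (fin_cases i <;> fin_cases j <;> simp at hij ⊢)
      | cases hij
  · rintro (n | φ) hl
    · have hn := le_of_allowed (N := 4) hl (by norm_num at *; linarith)
      have key : ∀ n : Fin 8, (n : ℕ) ≤ 4 → ∃ i : Fin 2 ⊕ Fin 2 ⊕ Fin 1,
          (Sum.elim ![0, 4] (Sum.elim ![1, 2] ![3]) : _ → Fin 8) i = n := by decide
      obtain ⟨i | i | i, hi⟩ := key n hn
      · exact ⟨.inl i, congrArg _ hi⟩
      · exact ⟨.inr (.inl i), congrArg _ hi⟩
      · exact ⟨.inr (.inr (.inl i)), congrArg _ hi⟩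
    · exact ⟨.inr (.inr (.inr ⟨φ, hl.1⟩)), rfl⟩

theorem classification_three_four (h : τ₀ ≠ 0) (hc : 3 < 1 / τ₀ ^ 2 - 16) (hc' : 1 / τ₀ ^ 2 - 16 < 4) :
    ∃ (F₅ : Fin 1 → ExampleSystem) (F₆ : Fin 2 → ExampleSystem) (F₇ : Fin 1 → ExampleSystem)
      (F₁₂ : Set.Ioo 0 (Real.pi / 2) → ExampleSystem),
      (∀ i, (F₅ i).HasGenDim 5 1) ∧ (∀ i, (F₆ i).HasGenDim 6 1) ∧ (∀ i, (F₇ i).HasGenDim 7 1) ∧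
      (∀ φ, (F₁₂ φ).HasGenDim 12 2 ∧ CorrespondsToAngle (exampleTau τ₀) φ (F₁₂ φ)) ∧
      IsClassification.{u} (exampleTau τ₀) (Sum.elim F₅ (Sum.elim F₆ (Sum.elim F₇ F₁₂))) := by
  obtain ⟨F₅, h5, h5'⟩ := exists_char_family h (d := 5) ![0] fun i => by
    fin_cases i
    · exact Or.inl ⟨by norm_num at *; linarith, by decide⟩
  obtain ⟨F₆, h6, h6'⟩ := exists_char_family h (d := 6) ![1, 2] fun i => by
    fin_cases i
    · exact Or.inl ⟨by norm_num at *; linarith, by decide⟩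
    · exact Or.inl ⟨by norm_num at *; linarith, by decide⟩
  obtain ⟨F₇, h7, h7'⟩ := exists_char_family h (d := 7) ![3] fun i => by
    fin_cases i
    · exact Or.inl ⟨by norm_num at *; linarith, by decide⟩
  obtain ⟨F₁₂, h12, h12'⟩ := exists_angle_family (I := Set.Ioo 0 (Real.pi / 2)) h
    fun φ hφ => angle_strict hφ (by linarith)
  refine ⟨F₅, F₆, F₇, F₁₂, h5', h6', h7', h12', isClassification_of_isModel h (by linarith)
    (p := Sum.elim (fun i => .inl (![0] i)) (Sum.elim (fun i => .inl (![1, 2] i)) (Sum.elim (fun i => .inl (![3] i)) (fun φ => .inr φ)))) ?_ ?_ ?_⟩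
  · rintro (i | i | i | φ)
    exacts [h5 i, h6 i, h7 i, h12 φ]
  · rintro (i | i | i | φ) (j | j | j | ψ) hij
    all_goals first
      | (obtain rfl : φ = ψ := Subtype.ext (Sum.inr.inj hij); rfl)
      | (fin_cases i <;> fin_cases j <;> simp at hij ⊢)
      | cases hij
  · rintro (n | φ) hl
    · have hn := le_of_allowed (N := 3) hl (by norm_num at *; linarith)
      have key : ∀ n : Fin 8, (n : ℕ) ≤ 3 → ∃ i : Fin 1 ⊕ Fin 2 ⊕ Fin 1,
          (Sum.elim ![0] (Sum.elim ![1, 2] ![3]) : _ → Fin 8) i = n := by decide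
      obtain ⟨i | i | i, hi⟩ := key n hn
      · exact ⟨.inl i, congrArg _ hi⟩
      · exact ⟨.inr (.inl i), congrArg _ hi⟩
      · exact ⟨.inr (.inr (.inl i)), congrArg _ hi⟩
    · exact ⟨.inr (.inr (.inr ⟨φ, hl.1⟩)), rfl⟩

/-- Now 3 = c lowers the dimension of n = 3 from 7 to 6. At c = 3 the bound for the angle reads
cos²φ ≤ 1, still strict on the open interval. -/
theorem classification_three (h : τ₀ ≠ 0) (hc : 1 / τ₀ ^ 2 - 16 = 3) :
    ∃ (F₅ : Fin 1 → ExampleSystem) (F₆ : Fin 3 → ExampleSystem)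
      (F₁₂ : Set.Ioo 0 (Real.pi / 2) → ExampleSystem),
      (∀ i, (F₅ i).HasGenDim 5 1) ∧ (∀ i, (F₆ i).HasGenDim 6 1) ∧
      (∀ φ, (F₁₂ φ).HasGenDim 12 2 ∧ CorrespondsToAngle (exampleTau τ₀) φ (F₁₂ φ)) ∧
      IsClassification.{u} (exampleTau τ₀) (Sum.elim F₅ (Sum.elim F₆ F₁₂)) := by
  obtain ⟨F₅, h5, h5'⟩ := exists_char_family h (d := 5) ![0] fun i => by
    fin_cases i
    · exact Or.inl ⟨by norm_num at *; linarith, by decide⟩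
  obtain ⟨F₆, h6, h6'⟩ := exists_char_family h (d := 6) ![1, 2, 3] fun i => by
    fin_cases i
    · exact Or.inl ⟨by norm_num at *; linarith, by decide⟩
    · exact Or.inl ⟨by norm_num at *; linarith, by decide⟩
    · exact Or.inr ⟨by norm_num at *; linarith, by decide⟩
  obtain ⟨F₁₂, h12, h12'⟩ := exists_angle_family (I := Set.Ioo 0 (Real.pi / 2)) h
    fun φ hφ => angle_strict hφ (by linarith)
  refine ⟨F₅, F₆, F₁₂, h5', h6', h12', isClassification_of_isModel h (by linarith)
    (p := Sum.elim (fun i => .inl (![0] i)) (Sum.elim (fun i => .inl (![1, 2, 3] i)) (fun φ => .inr φ))) ?_ ?_ ?_⟩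
  · rintro (i | i | φ)
    exacts [h5 i, h6 i, h12 φ]
  · rintro (i | i | φ) (j | j | ψ) hij
    all_goals first
      | (obtain rfl : φ = ψ := Subtype.ext (Sum.inr.inj hij); rfl)
      | (fin_cases i <;> fin_cases j <;> simp at hij ⊢)
      | cases hij
  · rintro (n | φ) hl
    · have hn := le_of_allowed (N := 3) hl (by norm_num at *; linarith)
      have key : ∀ n : Fin 8, (n : ℕ) ≤ 3 → ∃ i : Fin 1 ⊕ Fin 3,
          (Sum.elim ![0] ![1, 2, 3] : _ → Fin 8) i = n := by decide
      obtain ⟨i | i, hi⟩ := key n hn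
      · exact ⟨.inl i, congrArg _ hi⟩
      · exact ⟨.inr (.inl i), congrArg _ hi⟩
    · exact ⟨.inr (.inr ⟨φ, hl.1⟩), rfl⟩

/-- At c = 2 the bound becomes cos²φ ≤ 0, which excludes all angles, and n = 2 drops from dimension
6 to 5. -/
theorem classification_two (h : τ₀ ≠ 0) (hc : 1 / τ₀ ^ 2 - 16 = 2) :
    ∃ (F₅ : Fin 2 → ExampleSystem) (F₆ : Fin 1 → ExampleSystem),
      (∀ i, (F₅ i).HasGenDim 5 1) ∧ (∀ i, (F₆ i).HasGenDim 6 1) ∧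
      IsClassification.{u} (exampleTau τ₀) (Sum.elim F₅ F₆) := by
  obtain ⟨F₅, h5, h5'⟩ := exists_char_family h (d := 5) ![0, 2] fun i => by
    fin_cases i
    · exact Or.inl ⟨by norm_num at *; linarith, by decide⟩
    · exact Or.inr ⟨by norm_num at *; linarith, by decide⟩
  obtain ⟨F₆, h6, h6'⟩ := exists_char_family h (d := 6) ![1] fun i => by
    fin_cases i
    · exact Or.inl ⟨by norm_num at *; linarith, by decide⟩
  refine ⟨F₅, F₆, h5', h6', isClassification_of_isModel h (by linarith)
    (p := Sum.elim (fun i => .inl (![0, 2] i)) (fun i => .inl (![1] i))) ?_ ?_ ?_⟩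
  · rintro (i | i)
    exacts [h5 i, h6 i]
  · rintro (i | i) (j | j) hij
    all_goals fin_cases i <;> fin_cases j <;> simp at hij ⊢
  · rintro (n | φ) hl
    · have hn := le_of_allowed (N := 2) hl (by norm_num at *; linarith)
      have key : ∀ n : Fin 8, (n : ℕ) ≤ 2 → ∃ i : Fin 2 ⊕ Fin 1,
          (Sum.elim ![0, 2] ![1] : _ → Fin 8) i = n := by decide
      obtain ⟨i | i, hi⟩ := key n hn
      · exact ⟨.inl i, congrArg _ hi⟩
      · exact ⟨.inr i, congrArg _ hi⟩
    · exact absurd hl (not_allowed_inr (by linarith))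

theorem classification_one_two (h : τ₀ ≠ 0) (hc : 1 < 1 / τ₀ ^ 2 - 16) (hc' : 1 / τ₀ ^ 2 - 16 < 2) :
    ∃ (F₅ : Fin 1 → ExampleSystem) (F₆ : Fin 1 → ExampleSystem),
      (∀ i, (F₅ i).HasGenDim 5 1) ∧ (∀ i, (F₆ i).HasGenDim 6 1) ∧
      IsClassification.{u} (exampleTau τ₀) (Sum.elim F₅ F₆) := by
  obtain ⟨F₅, h5, h5'⟩ := exists_char_family h (d := 5) ![0] fun i => by
    fin_cases i
    · exact Or.inl ⟨by norm_num at *; linarith, by decide⟩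
  obtain ⟨F₆, h6, h6'⟩ := exists_char_family h (d := 6) ![1] fun i => by
    fin_cases i
    · exact Or.inl ⟨by norm_num at *; linarith, by decide⟩
  refine ⟨F₅, F₆, h5', h6', isClassification_of_isModel h (by linarith)
    (p := Sum.elim (fun i => .inl (![0] i)) (fun i => .inl (![1] i))) ?_ ?_ ?_⟩
  · rintro (i | i)
    exacts [h5 i, h6 i]
  · rintro (i | i) (j | j) hij
    all_goals fin_cases i <;> fin_cases j <;> simp at hij ⊢
  · rintro (n | φ) hl
    · have hn := le_of_allowed (N := 1) hl (by norm_num at *; linarith)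
      have key : ∀ n : Fin 8, (n : ℕ) ≤ 1 → ∃ i : Fin 1 ⊕ Fin 1,
          (Sum.elim ![0] ![1] : _ → Fin 8) i = n := by decide
      obtain ⟨i | i, hi⟩ := key n hn
      · exact ⟨.inl i, congrArg _ hi⟩
      · exact ⟨.inr i, congrArg _ hi⟩
    · exact absurd hl (not_allowed_inr (by linarith))

theorem classification_one (h : τ₀ ≠ 0) (hc : 1 / τ₀ ^ 2 - 16 = 1) :
    ∃ (F₅ : Fin 2 → ExampleSystem),
      (∀ i, (F₅ i).HasGenDim 5 1) ∧
      IsClassification.{u} (exampleTau τ₀) F₅ := by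
  obtain ⟨F₅, h5, h5'⟩ := exists_char_family h (d := 5) ![0, 1] fun i => by
    fin_cases i
    · exact Or.inl ⟨by norm_num at *; linarith, by decide⟩
    · exact Or.inr ⟨by norm_num at *; linarith, by decide⟩
  refine ⟨F₅, h5', isClassification_of_isModel h (by linarith)
    (p := (fun i => .inl (![0, 1] i))) ?_ ?_ ?_⟩
  · exact h5
  · intro i j hij
    all_goals fin_cases i <;> fin_cases j <;> simp at hij ⊢
  · rintro (n | φ) hl
    · have hn := le_of_allowed (N := 1) hl (by norm_num at *; linarith)
      have key : ∀ n : Fin 8, (n : ℕ) ≤ 1 → ∃ i : Fin 2,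
          (![0, 1] : _ → Fin 8) i = n := by decide
      obtain ⟨i, hi⟩ := key n hn
      exact ⟨i, congrArg _ hi⟩
    · exact absurd hl (not_allowed_inr (by linarith))

theorem classification_zero_one (h : τ₀ ≠ 0) (hc : 0 < 1 / τ₀ ^ 2 - 16) (hc' : 1 / τ₀ ^ 2 - 16 < 1) :
    ∃ (F₅ : Fin 1 → ExampleSystem),
      (∀ i, (F₅ i).HasGenDim 5 1) ∧
      IsClassification.{u} (exampleTau τ₀) F₅ := by
  obtain ⟨F₅, h5, h5'⟩ := exists_char_family h (d := 5) ![0] fun i => by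
    fin_cases i
    · exact Or.inl ⟨by norm_num at *; linarith, by decide⟩
  refine ⟨F₅, h5', isClassification_of_isModel h (by linarith)
    (p := (fun i => .inl (![0] i))) ?_ ?_ ?_⟩
  · exact h5
  · intro i j hij
    exact Subsingleton.elim _ _
  · rintro (n | φ) hl
    · have hn := le_of_allowed (N := 0) hl (by norm_num at *; linarith)
      have key : ∀ n : Fin 8, (n : ℕ) ≤ 0 → ∃ i : Fin 1,
          (![0] : _ → Fin 8) i = n := by decide
      obtain ⟨i, hi⟩ := key n hn
      exact ⟨i, congrArg _ hi⟩
    · exact absurd hl (not_allowed_inr (by linarith))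

/-- Only n = 0 remains, with equality: 8 - 3 - 1 = 4. -/
theorem classification_zero (h : τ₀ ≠ 0) (hc : 1 / τ₀ ^ 2 - 16 = 0) :
    ∃ (F₄ : Fin 1 → ExampleSystem),
      (∀ i, (F₄ i).HasGenDim 4 1) ∧
      IsClassification.{u} (exampleTau τ₀) F₄ := by
  obtain ⟨F₄, h4, h4'⟩ := exists_char_family h (d := 4) ![0] fun i => by
    fin_cases i
    · exact Or.inr ⟨by norm_num at *; linarith, by decide⟩
  refine ⟨F₄, h4', isClassification_of_isModel h (by linarith)
    (p := (fun i => .inl (![0] i))) ?_ ?_ ?_⟩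
  · exact h4
  · intro i j hij
    exact Subsingleton.elim _ _
  · rintro (n | φ) hl
    · have hn := le_of_allowed (N := 0) hl (by norm_num at *; linarith)
      have key : ∀ n : Fin 8, (n : ℕ) ≤ 0 → ∃ i : Fin 1,
          (![0] : _ → Fin 8) i = n := by decide
      obtain ⟨i, hi⟩ := key n hn
      exact ⟨i, congrArg _ hi⟩
    · exact absurd hl (not_allowed_inr (by linarith))

theorem exampleAngle_eq (h : τ₀ ≠ 0) : exampleAngle τ₀ =
    Real.arccos (√((1 / τ₀ ^ 2 - 16 - 1) * (1 / τ₀ ^ 2 - 16 - 2) / 2)) := by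
  rw [exampleAngle]
  congr 2
  field_simp
  ring

/-- On the interval (2, 3) the quantity (c - 1)(c - 2)/2 increases from 0 to 1, so the critical
angle is well defined; it is the one at which the determinant vanishes. -/
theorem exampleAngle_spec (h : τ₀ ≠ 0) (hc : 2 < 1 / τ₀ ^ 2 - 16) (hc' : 1 / τ₀ ^ 2 - 16 < 3) :
    exampleAngle τ₀ ∈ Set.Ioo 0 (Real.pi / 2) ∧ 2 * Real.cos (exampleAngle τ₀) ^ 2 =
      (1 / τ₀ ^ 2 - 16 - 1) * (1 / τ₀ ^ 2 - 16 - 2) := by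
  rw [exampleAngle_eq h]
  generalize 1 / τ₀ ^ 2 - 16 = c at *
  have h0 : 0 < (c - 1) * (c - 2) / 2 := div_pos (mul_pos (by linarith) (by linarith)) two_pos
  have h1 : (c - 1) * (c - 2) / 2 < 1 := by nlinarith
  have h2 : √((c - 1) * (c - 2) / 2) < 1 := by
    rw [Real.sqrt_lt' one_pos]
    simpa using h1
  refine ⟨⟨Real.arccos_pos.2 h2, Real.arccos_lt_pi_div_two.2 (Real.sqrt_pos.2 h0)⟩, ?_⟩
  rw [Real.cos_arccos (by linarith [Real.sqrt_nonneg ((c - 1) * (c - 2) / 2)]) h2.le,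
    Real.sq_sqrt h0.le]
  ring

/-- Cosine decreases, so the allowed angles are those not below the critical one. At the critical
angle the Schur complement has a one-dimensional kernel, and dimension 12 drops to 11. -/
theorem classification_two_three (h : τ₀ ≠ 0) (hc : 2 < 1 / τ₀ ^ 2 - 16)
    (hc' : 1 / τ₀ ^ 2 - 16 < 3) :
    ∃ (F₅ : Fin 1 → ExampleSystem) (F₆ : Fin 2 → ExampleSystem)
        (F₁₂ : Set.Ioo (exampleAngle τ₀) (Real.pi / 2) → ExampleSystem)
        (F₁₁ : Fin 1 → ExampleSystem),
      (∀ i, (F₅ i).HasGenDim 5 1) ∧ (∀ i, (F₆ i).HasGenDim 6 1) ∧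
      (∀ φ, (F₁₂ φ).HasGenDim 12 2 ∧ CorrespondsToAngle (exampleTau τ₀) φ (F₁₂ φ)) ∧
      (∀ i, (F₁₁ i).HasGenDim 11 2 ∧
        CorrespondsToAngle (exampleTau τ₀) (exampleAngle τ₀) (F₁₁ i)) ∧
      IsClassification.{u} (exampleTau τ₀)
        (Sum.elim F₅ (Sum.elim F₆ (Sum.elim F₁₂ F₁₁))) := by
  obtain ⟨F₅, h5, h5'⟩ := exists_char_family h (d := 5) ![0] fun i => by
    fin_cases i
    · exact Or.inl ⟨by norm_num at *; linarith, by decide⟩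
  obtain ⟨F₆, h6, h6'⟩ := exists_char_family h (d := 6) ![1, 2] fun i => by
    fin_cases i
    · exact Or.inl ⟨by norm_num at *; linarith, by decide⟩
    · exact Or.inl ⟨by norm_num at *; linarith, by decide⟩
  obtain ⟨hα, hα'⟩ := exampleAngle_spec h hc hc'
  have hcos : ∀ φ ∈ Set.Ioo 0 (Real.pi / 2), 2 * Real.cos φ ^ 2 <
      (1 / τ₀ ^ 2 - 16 - 1) * (1 / τ₀ ^ 2 - 16 - 2) ↔ exampleAngle τ₀ < φ := by
    intro φ hφ
    rw [← hα', mul_lt_mul_iff_right₀ two_pos, pow_lt_pow_iff_left₀ (cos_pos_of_mem hφ).le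
      (cos_pos_of_mem hα).le two_ne_zero]
    exact Real.strictAntiOn_cos.lt_iff_gt ⟨hφ.1.le, by linarith [hφ.2, Real.pi_pos]⟩
      ⟨hα.1.le, by linarith [hα.2, Real.pi_pos]⟩
  obtain ⟨F₁₂, h12, h12'⟩ := exists_angle_family (I := Set.Ioo (exampleAngle τ₀) (Real.pi / 2)) h
    fun φ hφ => ⟨⟨hα.1.trans hφ.1, hφ.2⟩, by linarith, (hcos φ ⟨hα.1.trans hφ.1, hφ.2⟩).2 hφ.1⟩
  obtain ⟨S, hS⟩ := exists_isModel (l := .inr (exampleAngle τ₀)) h ⟨hα, by linarith, hα'.le⟩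
  refine ⟨F₅, F₆, F₁₂, fun _ => S, h5', h6', h12', fun _ => ⟨hS.hasGenDim_angle h ?_,
    hS.correspondsToAngle h⟩, isClassification_of_isModel h (by linarith)
    (p := Sum.elim (fun i => .inl (![0] i)) (Sum.elim (fun i => .inl (![1, 2] i))
      (Sum.elim (fun φ => .inr φ) fun _ => .inr (exampleAngle τ₀)))) ?_ ?_ ?_⟩
  · rw [if_pos hα']
  · rintro (i | i | φ | i)
    exacts [h5 i, h6 i, h12 φ, hS]
  · rintro (i | i | φ | i) (j | j | ψ | j) hij
    all_goals first
      | (obtain rfl : φ = ψ := Subtype.ext (Sum.inr.inj hij); rfl)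
      | exact absurd (Sum.inr.inj hij) φ.2.1.ne'
      | exact absurd (Sum.inr.inj hij) ψ.2.1.ne
      | (fin_cases i <;> fin_cases j <;> simp at hij ⊢)
      | cases hij
  · rintro (n | φ) hl
    · have hn := le_of_allowed (N := 2) hl (by norm_num at *; linarith)
      have key : ∀ n : Fin 8, (n : ℕ) ≤ 2 → ∃ i : Fin 1 ⊕ Fin 2,
          (Sum.elim ![0] ![1, 2] : _ → Fin 8) i = n := by decide
      obtain ⟨i | i, hi⟩ := key n hn
      · exact ⟨.inl i, congrArg _ hi⟩
      · exact ⟨.inr (.inl i), congrArg _ hi⟩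
    · rcases lt_trichotomy φ (exampleAngle τ₀) with h1 | h1 | h1
      · have h2 : Real.cos (exampleAngle τ₀) < Real.cos φ :=
          Real.strictAntiOn_cos ⟨hl.1.1.le, by linarith [hl.1.2, Real.pi_pos]⟩
            ⟨hα.1.le, by linarith [hα.2, Real.pi_pos]⟩ h1
        have h3 := pow_lt_pow_left₀ h2 (cos_pos_of_mem hα).le two_ne_zero
        have h4 := hl.2.2
        linarith
      · exact ⟨.inr (.inr (.inr 0)), congrArg _ h1.symm⟩
      · exact ⟨.inr (.inr (.inl ⟨φ, h1, hl.1.2⟩)), rfl⟩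

/-! ### Translation of the bounds on τ₀ into bounds on c. -/

section Threshold

theorem one_div_sq_of_eq {N : ℝ} (hN : 0 < N) (h : τ₀ = 1 / √N) :
    1 / τ₀ ^ 2 - 16 = N - 16 := by
  rw [h, div_pow, Real.sq_sqrt hN.le]
  field_simp

theorem one_div_sq_lt {N : ℝ} (hN : 0 < N) (h : 1 / √N < τ₀) :
    1 / τ₀ ^ 2 - 16 < N - 16 := by
  have h1 : 0 < 1 / √N := by positivity
  have h2 := pow_lt_pow_left₀ h h1.le two_ne_zero
  rw [div_pow, Real.sq_sqrt hN.le] at h2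
  have h3 := one_div_lt_one_div_of_lt (by positivity) h2
  rw [one_pow, one_div_one_div] at h3
  linarith

theorem lt_one_div_sq {N : ℝ} (hN : 0 < N) (h0 : 0 < τ₀) (h : τ₀ < 1 / √N) :
    N - 16 < 1 / τ₀ ^ 2 - 16 := by
  have h2 := pow_lt_pow_left₀ h h0.le two_ne_zero
  rw [div_pow, Real.sq_sqrt hN.le] at h2
  have h3 := one_div_lt_one_div_of_lt (by positivity) h2
  rw [one_pow, one_div_one_div] at h3
  linarith

end Threshold

end SubspaceProblem

end

theorem mainTheorem10 (τ₀ : ℝ) (hτ₀ : τ₀ ∈ Set.Ioo (0 : ℝ) (1 / 3)) :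
    -- the wild range
    (τ₀ < 1 / √20 → IsStarWild.{u} (exampleTau τ₀)) ∧
    -- 1
    (τ₀ = 1 / √20 →
      ∃ (F₅ : Fin 2 → ExampleSystem) (F₆ : Fin 2 → ExampleSystem)
        (F₇ : Fin 1 → ExampleSystem)
        (F₁₂ : Set.Ioo 0 (Real.pi / 2) → ExampleSystem),
        (∀ i, (F₅ i).HasGenDim 5 1) ∧ (∀ i, (F₆ i).HasGenDim 6 1) ∧ (∀ i, (F₇ i).HasGenDim 7 1) ∧
        (∀ φ, (F₁₂ φ).HasGenDim 12 2 ∧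
          CorrespondsToAngle (exampleTau τ₀) φ (F₁₂ φ)) ∧
        IsClassification.{u} (exampleTau τ₀)
          (Sum.elim F₅ (Sum.elim F₆ (Sum.elim F₇ F₁₂)))) ∧
    -- 2
    (1 / √20 < τ₀ ∧ τ₀ < 1 / √19 →
      ∃ (F₅ : Fin 1 → ExampleSystem) (F₆ : Fin 2 → ExampleSystem)
        (F₇ : Fin 1 → ExampleSystem)
        (F₁₂ : Set.Ioo 0 (Real.pi / 2) → ExampleSystem),
        (∀ i, (F₅ i).HasGenDim 5 1) ∧ (∀ i, (F₆ i).HasGenDim 6 1) ∧ (∀ i, (F₇ i).HasGenDim 7 1) ∧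
        (∀ φ, (F₁₂ φ).HasGenDim 12 2 ∧
          CorrespondsToAngle (exampleTau τ₀) φ (F₁₂ φ)) ∧
        IsClassification.{u} (exampleTau τ₀)
          (Sum.elim F₅ (Sum.elim F₆ (Sum.elim F₇ F₁₂)))) ∧
    -- 3
    (τ₀ = 1 / √19 →
      ∃ (F₅ : Fin 1 → ExampleSystem) (F₆ : Fin 3 → ExampleSystem)
        (F₁₂ : Set.Ioo 0 (Real.pi / 2) → ExampleSystem),
        (∀ i, (F₅ i).HasGenDim 5 1) ∧ (∀ i, (F₆ i).HasGenDim 6 1) ∧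
        (∀ φ, (F₁₂ φ).HasGenDim 12 2 ∧
          CorrespondsToAngle (exampleTau τ₀) φ (F₁₂ φ)) ∧
        IsClassification.{u} (exampleTau τ₀)
          (Sum.elim F₅ (Sum.elim F₆ F₁₂))) ∧
    -- 4
    (1 / √19 < τ₀ ∧ τ₀ < 1 / √18 →
      0 < (1 - 17 * τ₀ ^ 2) * (1 - 18 * τ₀ ^ 2) / (2 * τ₀ ^ 4) ∧
      (1 - 17 * τ₀ ^ 2) * (1 - 18 * τ₀ ^ 2) / (2 * τ₀ ^ 4) < 1 ∧
      exampleAngle τ₀ ∈ Set.Ioo 0 (Real.pi / 2) ∧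
      ∃ (F₅ : Fin 1 → ExampleSystem) (F₆ : Fin 2 → ExampleSystem)
        (F₁₂ : Set.Ioo (exampleAngle τ₀) (Real.pi / 2) →
          ExampleSystem)
        (F₁₁ : Fin 1 → ExampleSystem),
        (∀ i, (F₅ i).HasGenDim 5 1) ∧ (∀ i, (F₆ i).HasGenDim 6 1) ∧
        (∀ φ, (F₁₂ φ).HasGenDim 12 2 ∧
          CorrespondsToAngle (exampleTau τ₀) φ (F₁₂ φ)) ∧
        (∀ i, (F₁₁ i).HasGenDim 11 2 ∧
          CorrespondsToAngle (exampleTau τ₀)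
            (exampleAngle τ₀) (F₁₁ i)) ∧
        IsClassification.{u} (exampleTau τ₀)
          (Sum.elim F₅ (Sum.elim F₆ (Sum.elim F₁₂ F₁₁)))) ∧
    -- 5
    (τ₀ = 1 / √18 →
      ∃ (F₅ : Fin 2 → ExampleSystem) (F₆ : Fin 1 → ExampleSystem),
        (∀ i, (F₅ i).HasGenDim 5 1) ∧ (∀ i, (F₆ i).HasGenDim 6 1) ∧
        IsClassification.{u} (exampleTau τ₀) (Sum.elim F₅ F₆)) ∧
    -- 6
    (1 / √18 < τ₀ ∧ τ₀ < 1 / √17 →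
      ∃ (F₅ : Fin 1 → ExampleSystem) (F₆ : Fin 1 → ExampleSystem),
        (∀ i, (F₅ i).HasGenDim 5 1) ∧ (∀ i, (F₆ i).HasGenDim 6 1) ∧
        IsClassification.{u} (exampleTau τ₀) (Sum.elim F₅ F₆)) ∧
    -- 7
    (τ₀ = 1 / √17 →
      ∃ F₅ : Fin 2 → ExampleSystem, (∀ i, (F₅ i).HasGenDim 5 1) ∧
        IsClassification.{u} (exampleTau τ₀) F₅) ∧
    -- 8
    (1 / √17 < τ₀ ∧ τ₀ < 1 / 4 →
      ∃ F₅ : Fin 1 → ExampleSystem, (∀ i, (F₅ i).HasGenDim 5 1) ∧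
        IsClassification.{u} (exampleTau τ₀) F₅) ∧
    -- 9
    (τ₀ = 1 / 4 →
      ∃ F₄ : Fin 1 → ExampleSystem, (∀ i, (F₄ i).HasGenDim 4 1) ∧
        IsClassification.{u} (exampleTau τ₀) F₄) ∧
    -- no nonzero system
    (1 / 4 < τ₀ → ∀ S : SubspaceSystem.{u} (Vertex 3 1),
      S.Satisfies (exampleTau τ₀) → ¬ S.IsNonzero) := by
  have h0 := hτ₀.1
  have h := h0.ne'
  -- This puts the threshold 1/4, which corresponds to c = 0, in the common form 1/√N, where c = N -
  -- 16.
  have h16 : (1 / 4 : ℝ) = 1 / √16 := by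
    rw [show (16 : ℝ) = 4 ^ 2 by norm_num, Real.sqrt_sq (by norm_num)]
  have heq : ∀ N : ℝ, 0 < N → τ₀ = 1 / √N → 1 / τ₀ ^ 2 - 16 = N - 16 :=
    fun _ hN => one_div_sq_of_eq hN
  have hlt : ∀ N : ℝ, 0 < N → 1 / √N < τ₀ → 1 / τ₀ ^ 2 - 16 < N - 16 :=
    fun _ hN => one_div_sq_lt hN
  have hgt : ∀ N : ℝ, 0 < N → τ₀ < 1 / √N → N - 16 < 1 / τ₀ ^ 2 - 16 :=
    fun _ hN => lt_one_div_sq hN h0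
  rw [h16]
  refine ⟨fun hw => isStarWild_exampleTau h0 ?_,
    fun he => classification_four h ((heq 20 (by norm_num) he).trans (by norm_num)),
    fun he => classification_three_four h ?_ ?_,
    fun he => classification_three h ((heq 19 (by norm_num) he).trans (by norm_num)),
    fun he => ?_,
    fun he => classification_two h ((heq 18 (by norm_num) he).trans (by norm_num)),
    fun he => classification_one_two h ?_ ?_,
    fun he => classification_one h ((heq 17 (by norm_num) he).trans (by norm_num)),
    fun he => classification_zero_one h ?_ ?_,
    fun he => classification_zero h ((heq 16 (by norm_num) he).trans (by norm_num)),
    fun he S hS => not_isNonzero_of_neg h ?_ hS⟩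
  · have h1 := hgt 20 (by norm_num) hw
    have h2 : 20 < 1 / τ₀ ^ 2 := by linarith
    rwa [lt_div_iff₀ (by positivity)] at h2
  · linarith [hgt 19 (by norm_num) he.2]
  · linarith [hlt 20 (by norm_num) he.1]
  · have hc : 2 < 1 / τ₀ ^ 2 - 16 := by linarith [hgt 18 (by norm_num) he.2]
    have hc' : 1 / τ₀ ^ 2 - 16 < 3 := by linarith [hlt 19 (by norm_num) he.1]
    have e : (1 - 17 * τ₀ ^ 2) * (1 - 18 * τ₀ ^ 2) / (2 * τ₀ ^ 4) =
        (1 / τ₀ ^ 2 - 16 - 1) * (1 / τ₀ ^ 2 - 16 - 2) / 2 := by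
      field_simp
      ring
    rw [e]
    exact ⟨div_pos (mul_pos (by linarith) (by linarith)) two_pos, by nlinarith,
      (exampleAngle_spec h hc hc').1, classification_two_three h hc hc'⟩
  · linarith [hgt 17 (by norm_num) he.2]
  · linarith [hlt 18 (by norm_num) he.1]
  · linarith [hgt 16 (by norm_num) he.2]
  · linarith [hlt 17 (by norm_num) he.1]
  · linarith [hlt 16 (by norm_num) he]
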